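/- Let $N\ge 1$, let $\eta=(\eta_{\alpha\beta})$ be a symmetric nondegenerate complex $N\times N$ matrix with inverse $(\eta^{\alpha\beta})$, and let $0\neq\overline A=(A^1,\dots,A^{N+1})\in\mathbb C^{N+1}$. Repeated Greek indices are summed. **Ancestor vector potentials.** For $L\ge1$ and $\overline A\in\mathbb C^L$ put $q^\alpha_a:=t^\alpha_a-A^\alpha\delta_{a,1}$. A sequence of *descendant vector potentials* (based at the origin) with unit $A^\alpha\partial/\partial t^\alpha$ is a family $\mathcal F^{\alpha,a}\in\mathbb C[[t^*_*]]$, $1\le\alpha\le L$, $a\ge0$, in the variables $t^\beta_b$, $1\le \beta\le L$, $b\ge0$, such that, with $\mathcal F^{\alpha,a}:=(-1)^{a+1}q^\alpha_{-a-1}$ for $a<0$, $$\sum_{b\ge0}q^\beta_{b+1}\frac{\partial\mathcal F^{\alpha,a}}{\partial q^\beta_b}=-\mathcal F^{\alpha,a-1},\qquad \sum_{b\ge0}q^\beta_b\frac{\partial\mathcal F^{\alpha,a}}{\partial q^\beta_b}=\mathcal F^{\alpha,a}\qquad(a\in\mathbb Z),$$ $$\frac{\partial^2\mathcal F^{\alpha,0}}{\partial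 q^\beta_{b+1}\partial q^\gamma_c}=\frac{\partial\mathcal F^{\mu,0}}{\partial q^\beta_b}\frac{\partial^2\mathcal F^{\alpha,0}}{\partial q^\mu_0\partial q^\gamma_c},\qquad \frac{\partial\mathcal F^{\alpha,a+1}}{\partial q^\beta_b}+\frac{\partial\mathcal F^{\alpha,a}}{\partial q^\beta_{b+1}}=\frac{\partial\mathcal F^{\alpha,a}}{\partial q^\mu_0}\frac{\partial\mathcal F^{\mu,0}}{\partial q^\beta_b}\qquad(a,b,c\ge0).$$ It is called *ancestor* if $\partial\mathcal F^{\alpha,a}/\partial t^\beta_b$ vanishes at $t^*_*=0$ for all $\alpha,\beta$ and all $a,b\ge0$. **Pairs of ancestor potentials.** Let $L=N+1$. A sequence of ancestor vector potentials is of *open-closed type* with metric $\eta$ if $\mathcal F^{1,a},\dots,\mathcal F^{N,a}$ do not depend on $t^{N+1}_*$ and form a sequence of descendant vector potentials in the variables $t^\beta_b$, $\beta\le N$, with unit $\sum_{\alpha\le N}A^\alpha\partial/\partial t^\alpha$, that satisfies $\partial(\eta_{\alpha\mu}\mathcal F^{\mu,a})/\partial t^\beta_b=\partial(\eta_{\beta\mu}\mathcal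 F^{\mu,b})/\partial t^\alpha_a$ for $1\le\alpha,\beta\le N$ and $a,b\ge0$. Its pair of *closed and open ancestor potentials* is $$\mathcal F^c_0:=\tfrac12\sum_{a\ge0}q^\alpha_a\eta_{\alpha\mu}\mathcal F^{\mu,a},\qquad \mathcal F^o_0:=\mathcal F^{N+1,0},$$ and this pair determines the sequence. With $F^c:=\mathcal F^c_0|_{t^*_{\ge1}=0}$ and $F^o:=\mathcal F^o_0|_{t^*_{\ge1}=0}$, the pair defines on $T_0\mathbb C^{N+1}$ the algebra structure with structure constants $c^\alpha_{\beta\gamma}=\eta^{\alpha\mu}\frac{\partial^3F^c}{\partial t^\mu\partial t^\beta\partial t^\gamma}(0)$ for $\alpha\le N$ and $c^{N+1}_{\beta\gamma}=\frac{\partial^2F^o}{\partial t^\beta\partial t^\gamma}(0)$. The algebra structure is *semisimple* if it has no nonzero nilpotents. **The action.** Let $G^o_{N+1,+}$ be the group of all $R(z)=\mathrm{Id}+\sum_{i\ge1}R_iz^i\in\mathrm{End}(\mathbb C^{N+1})[[z]]$ such that the upper left $N\times N$ block $\pi(R(z))$ satisfies $\pi(R(-z))^T\,\eta\,\pi(R(z))=\eta$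 and the last column of every $R_i$, $i\ge1$, is zero. For $r(z)=\sum_{i\ge1}r_iz^i\in z\,\mathrm{End}(\mathbb C^{N+1})[[z]]$, the infinitesimal action on ancestor vector potentials is $$r(z).\mathcal F^{\alpha,a}=\sum_{i\ge1}(-1)^i(r_i)^\alpha_\mu\mathcal F^{\mu,a+i}+\sum_{i\ge1,\,j\ge0}(-1)^{i-j-1}(r_i)^\mu_\nu\frac{\partial\mathcal F^{\alpha,a}}{\partial q^\mu_j}\mathcal F^{\nu,i-j-1},$$ and $R(z)=\exp(r(z))$ sends a sequence of ancestor vector potentials to the value at $\theta=1$ of the curve of ancestor vector potentials ($\theta\in\mathbb R$, with derivatives taken coefficientwise) that starts at this sequence at $\theta=0$ and satisfies $\frac{d}{d\theta}\mathcal F^{\alpha,a}=r(z).\mathcal F^{\alpha,a}$. A pair of closed and open ancestor potentials is acted on through its sequence of ancestor vector potentials. **Proposition.** Fix a semisimple algebra structure on $T_0\mathbb C^{N+1}$. Then the above defines an action of the group $G^o_{N+1,+}$ on the space of pairs $(\mathcal F^c_0,\mathcal F^o_0)$ of closed and open ancestor potentials, with metric $\eta$ and unit $A^\alpha\partial/\partial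 t^\alpha$, that define this algebra structure on $T_0\mathbb C^{N+1}$, and this action is transitive. -/

import Mathlib

open scoped PowerSeries

noncomputable section

namespace OpenGivental

/-! ### Formal power series in the variables `t^α_a`

The variable `t^α_a`, `α : Fin L`, `a : ℕ`, is the variable with index `(α, a)`. Indices are
zero-based, so for `L = N + 1` the distinguished upper index is `Fin.last N`. -/

/-- The ring `ℂ[[t^*_*]]` of formal power series in `t^α_a`, `α : Fin L`, `a ≥ 0`. -/
abbrev Ser (L : ℕ) : Type := MvPowerSeries (Fin L × ℕ) ℂ

/-- The partial derivative `∂/∂t^α_a`, which is also `∂/∂q^α_a`. -/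
abbrev pd {L : ℕ} (α : Fin L) (a : ℕ) (f : Ser L) : Ser L := MvPowerSeries.pderiv ℂ (α, a) f

/-- The sum of a family of power series, computed coefficient by coefficient. It is only used for
families that have, for every monomial, finitely many members containing that monomial. -/
def formalSum {L : ℕ} {ι : Type} (f : ι → Ser L) : Ser L :=
  fun m => ∑ᶠ i, MvPowerSeries.coeff m (f i)

/-- The shifted variable `q^α_a = t^α_a - A^α δ_{a,1}`. -/
def q {L : ℕ} (A : Fin L → ℂ) (α : Fin L) (a : ℕ) : Ser L :=
  MvPowerSeries.X (α, a) - MvPowerSeries.C (if a = 1 then A α else 0)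

/-! ### Descendant and ancestor vector potentials -/

/-- A sequence of vectors of power series: `F a α` is `𝓕^{α,a}_0`. -/
abbrev VecSeq (L : ℕ) : Type := ℕ → Fin L → Ser L

/-- The extension of `𝓕^{α,a}_0` to all integers `a`, with
`𝓕^{α,a}_0 = (-1)^{a+1} q^α_{-a-1}` for `a < 0`. -/
def VecSeq.ext {L : ℕ} (A : Fin L → ℂ) (F : VecSeq L) : ℤ → Fin L → Ser L
  | Int.ofNat a, α => F a α
  | Int.negSucc n, α => (-1 : ℂ) ^ n • q A α n

/-- `F` is a sequence of descendant vector potentials (based at the origin) of a flat F-manifold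
with unit `A^α ∂/∂t^α`. -/
structure IsDescendant {L : ℕ} (A : Fin L → ℂ) (F : VecSeq L) : Prop where
  string : ∀ (α : Fin L) (a : ℤ),
    formalSum (fun b : ℕ => ∑ β, q A β (b + 1) * pd β b (F.ext A a α)) = -F.ext A (a - 1) α
  dilaton : ∀ (α : Fin L) (a : ℤ),
    formalSum (fun b : ℕ => ∑ β, q A β b * pd β b (F.ext A a α)) = F.ext A a α
  trr : ∀ (α β γ : Fin L) (b c : ℕ),
    pd β (b + 1) (pd γ c (F 0 α)) = ∑ μ, pd β b (F 0 μ) * pd μ 0 (pd γ c (F 0 α))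
  shift : ∀ (α β : Fin L) (a b : ℕ),
    pd β b (F (a + 1) α) + pd β (b + 1) (F a α) = ∑ μ, pd μ 0 (F a α) * pd β b (F 0 μ)

/-- `F` is a sequence of ancestor vector potentials with unit `A^α ∂/∂t^α`. -/
structure IsAncestor {L : ℕ} (A : Fin L → ℂ) (F : VecSeq L) : Prop where
  descendant : IsDescendant A F
  vanishing : ∀ (α β : Fin L) (a b : ℕ), MvPowerSeries.constantCoeff (pd β b (F a α)) = 0

/-! ### The action of the loop group on ancestor vector potentials -/

/-- `End(ℂ^L)[[z]]`; the entry `M α β` is `M(z)^α_β`. -/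
abbrev Loop (L : ℕ) : Type := Matrix (Fin L) (Fin L) ℂ⟦X⟧

/-- The coefficient `M_i` of `z^i` in `M(z)`. -/
def Loop.coeff {L : ℕ} (M : Loop L) (i : ℕ) : Matrix (Fin L) (Fin L) ℂ :=
  M.map (PowerSeries.coeff i)

/-- The exponential of `r(z) = ∑_{i ≥ 1} r_i z^i`: as `r_0 = 0`, the power `r(z)^k` does not
contribute to the coefficient of `z^n` for `k > n`. -/
def Loop.exp {L : ℕ} (r : Loop L) : Loop L :=
  Matrix.of fun α β => PowerSeries.mk fun n =>
    ∑ k ∈ Finset.range (n + 1), ((k.factorial : ℂ))⁻¹ * PowerSeries.coeff n ((r ^ k) α β)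

/-- The infinitesimal action of `r(z) = ∑_{i ≥ 1} r_i z^i`:
`r(z).𝓕^{α,a} = ∑_{i ≥ 1} (-1)^i (r_i)^α_μ 𝓕^{μ,a+i}
  + ∑_{i ≥ 1, j ≥ 0} (-1)^{i-j-1} (r_i)^μ_ν (∂𝓕^{α,a}/∂q^μ_j) 𝓕^{ν,i-j-1}`.
In the code the summation index `i` is shifted by one. -/
def infAct {L : ℕ} (A : Fin L → ℂ) (r : Loop L) (F : VecSeq L) : VecSeq L := fun a α =>
  formalSum (fun i : ℕ => ∑ μ, ((-1) ^ (i + 1) * r.coeff (i + 1) α μ) • F (a + (i + 1)) μ) +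
  formalSum (fun p : ℕ × ℕ => ∑ μ, ∑ ν,
    ((-1) ^ (p.1 + p.2) * r.coeff (p.1 + 1) μ ν) •
      (pd μ p.2 (F a α) * F.ext A ((p.1 : ℤ) - (p.2 : ℤ)) ν))

/-- `F' = R(z).F` for the action of `G_{L,+}` on ancestor vector potentials. With `R = exp r`, the
curve `θ ↦ exp(θ r(z)).F` is the integral curve of the infinitesimal action of `r(z)` that starts
at `F`, and `R(z).F` is its value at `θ = 1`. -/
def ActsTo {L : ℕ} (A : Fin L → ℂ) (R : Loop L) (F F' : VecSeq L) : Prop :=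
  ∃ (r : Loop L) (Φ : ℝ → VecSeq L),
    r.coeff 0 = 0 ∧ r.exp = R ∧ (∀ θ, IsAncestor A (Φ θ)) ∧ Φ 0 = F ∧ Φ 1 = F' ∧
    ∀ (θ : ℝ) (a : ℕ) (α : Fin L) (m : Fin L × ℕ →₀ ℕ),
      HasDerivAt (fun s : ℝ => MvPowerSeries.coeff m (Φ s a α))
        (MvPowerSeries.coeff m (infAct A r (Φ θ) a α)) θ

/-! ### The open-closed setting, `L = N + 1` -/

/-- The embedding of the variables `t^α_a`, `α ≤ N`, into the variables `t^α_a`, `α ≤ N + 1`. -/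
def closedVar (N : ℕ) : Fin N × ℕ ↪ Fin (N + 1) × ℕ :=
  Function.Embedding.prodMap Fin.castSuccEmb (Function.Embedding.refl ℕ)

/-- A power series in the `t^α_a`, `α ≤ N`, regarded as one in the `t^α_a`, `α ≤ N + 1`. -/
def incl {N : ℕ} (f : Ser N) : Ser (N + 1) := MvPowerSeries.rename (R := ℂ) (closedVar N) f

/-- The projection of `ℂ^{N+1}` to the first `N` coordinates. -/
def proj {N : ℕ} (A : Fin (N + 1) → ℂ) : Fin N → ℂ := fun α => A α.castSucc

/-- The descendant vector potentials `G` are of closed type with metric `η`. -/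
def IsClosedType {N : ℕ} (η : Matrix (Fin N) (Fin N) ℂ) (G : VecSeq N) : Prop :=
  ∀ (α β : Fin N) (a b : ℕ),
    pd β b (∑ μ, η α μ • G a μ) = pd α a (∑ μ, η β μ • G b μ)

/-- The closed descendant potential `(1/2) ∑_{a ≥ 0} q^α_a η_{αμ} 𝓕^{μ,a}_0`. -/
def closedPotential {N : ℕ} (η : Matrix (Fin N) (Fin N) ℂ) (A : Fin N → ℂ) (G : VecSeq N) :
    Ser N :=
  (1 / 2 : ℂ) • formalSum (fun a : ℕ => ∑ α, ∑ μ, η α μ • (q A α a * G a μ))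

/-- `F` is a sequence of ancestor vector potentials of open-closed type, with unit `A^α ∂/∂t^α` and
metric `η`, and `(Fc, Fo)` is its pair of closed and open potentials. -/
def HasPotentials {N : ℕ} (η : Matrix (Fin N) (Fin N) ℂ) (A : Fin (N + 1) → ℂ)
    (F : VecSeq (N + 1)) (Fc : Ser N) (Fo : Ser (N + 1)) : Prop :=
  IsAncestor A F ∧
  (∃ G : VecSeq N, (∀ (a : ℕ) (α : Fin N), F a α.castSucc = incl (G a α)) ∧
    IsDescendant (proj A) G ∧ IsClosedType η G ∧ Fc = closedPotential η (proj A) G) ∧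
  Fo = F 0 (Fin.last N)

/-- The structure constants `c^α_{βγ}` at the origin of the algebra structure defined by
`F^c = Fc|_{t_{≥1} = 0}` and `F^o = Fo|_{t_{≥1} = 0}`: these are `η^{αμ} ∂³F^c/∂t^μ∂t^β∂t^γ` for
`α ≤ N` and `∂²F^o/∂t^β∂t^γ` for `α = N + 1`. -/
def structConst {N : ℕ} (η : Matrix (Fin N) (Fin N) ℂ) (Fc : Ser N) (Fo : Ser (N + 1))
    (α β γ : Fin (N + 1)) : ℂ :=
  Fin.lastCases (motive := fun _ => ℂ)
    (MvPowerSeries.constantCoeff (pd β 0 (pd γ 0 Fo)))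
    (fun α' : Fin N => ∑ μ, η⁻¹ α' μ *
      MvPowerSeries.constantCoeff (pd μ.castSucc 0 (pd β 0 (pd γ 0 (incl Fc)))))
    α

/-- The product on `ℂ^L` with the structure constants `c^α_{βγ}`, written `c α β γ`. -/
def algMul {L : ℕ} (c : Fin L → Fin L → Fin L → ℂ) (v w : Fin L → ℂ) : Fin L → ℂ :=
  fun α => ∑ β, ∑ γ, c α β γ * v β * w γ

/-- Semisimplicity of the algebra with structure constants `c`: there are no nonzero nilpotents.
Here `(algMul c v)^[k] v` is the power `v^{k+1}`. -/
def IsSemisimple {L : ℕ} (c : Fin L → Fin L → Fin L → ℂ) : Prop :=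
  ∀ (v : Fin L → ℂ) (k : ℕ), (algMul c v)^[k] v = 0 → v = 0

/-- The space of pairs of closed and open ancestor potentials, with metric `η` and unit
`A^α ∂/∂t^α`, that define the algebra structure with structure constants `c` on `T_0 ℂ^{N+1}`. -/
def AncestorPairs {N : ℕ} (η : Matrix (Fin N) (Fin N) ℂ) (A : Fin (N + 1) → ℂ)
    (c : Fin (N + 1) → Fin (N + 1) → Fin (N + 1) → ℂ) : Type :=
  {P : Ser N × Ser (N + 1) //
    (∃ F : VecSeq (N + 1), HasPotentials η A F P.1 P.2) ∧ structConst η P.1 P.2 = c}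

/-- `Q = R(z).P` for the action on pairs of closed and open ancestor potentials induced by the
action on ancestor vector potentials. -/
def PairActsTo {N : ℕ} (η : Matrix (Fin N) (Fin N) ℂ) (A : Fin (N + 1) → ℂ) (R : Loop (N + 1))
    (P Q : Ser N × Ser (N + 1)) : Prop :=
  ∃ F F' : VecSeq (N + 1),
    HasPotentials η A F P.1 P.2 ∧ HasPotentials η A F' Q.1 Q.2 ∧ ActsTo A R F F'

/-! ### The group `G^o_{N+1,+}` -/

/-- The adjoint `M(-z)^T`. -/
def Loop.adj {L : ℕ} (M : Loop L) : Loop L := (M.map PowerSeries.evalNegHom).transpose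

/-- The condition `M(-z)^T η M(z) = η`. -/
def IsSymplectic {N : ℕ} (η : Matrix (Fin N) (Fin N) ℂ) (M : Loop N) : Prop :=
  M.adj * η.map PowerSeries.C * M = η.map PowerSeries.C

/-- The matrix `π(M)` obtained by deleting the last row and the last column of `M`. -/
def Loop.corner {N : ℕ} (M : Loop (N + 1)) : Loop N := M.submatrix Fin.castSucc Fin.castSucc

/-- The conditions defining `G^o_{N+1,+}`: `R(z) = Id + ∑_{i ≥ 1} R_i z^i`,
`π(R(z)) ∈ G^c_{N,+}` and `(R_i)^*_{N+1} = 0` for `i ≥ 1`. -/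
structure IsOpenLoop {N : ℕ} (η : Matrix (Fin N) (Fin N) ℂ) (R : Loop (N + 1)) : Prop where
  coeff_zero : R.coeff 0 = 1
  symplectic : IsSymplectic η R.corner
  last_col : ∀ (i : ℕ) (α : Fin (N + 1)), 1 ≤ i → R.coeff i α (Fin.last N) = 0

theorem Loop.adj_mul {L : ℕ} (M K : Loop L) : Loop.adj (M * K) = K.adj * M.adj := by
  simp [Loop.adj, Matrix.map_mul, Matrix.transpose_mul]

theorem Loop.adj_one {L : ℕ} : (1 : Loop L).adj = 1 := by
  simp [Loop.adj]

theorem Loop.coeff_zero_mul {L : ℕ} (M K : Loop L) :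
    Loop.coeff (M * K) 0 = M.coeff 0 * K.coeff 0 := by
  ext α β
  simp [Loop.coeff, Matrix.mul_apply]

theorem Loop.coeff_zero_one {L : ℕ} : (1 : Loop L).coeff 0 = 1 := by
  ext α β
  by_cases h : α = β <;> simp [Loop.coeff, Matrix.one_apply, h]

/-- The last column of an element of `G^o_{N+1,+}` is that of the identity matrix. -/
theorem IsOpenLoop.col {N : ℕ} {η : Matrix (Fin N) (Fin N) ℂ} {R : Loop (N + 1)}
    (h : IsOpenLoop η R) (α : Fin (N + 1)) :
    R α (Fin.last N) = (1 : Loop (N + 1)) α (Fin.last N) := by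
  ext i
  have h1 : (1 : Loop (N + 1)) α (Fin.last N)
      = PowerSeries.C ((1 : Matrix (Fin (N + 1)) (Fin (N + 1)) ℂ) α (Fin.last N)) := by
    by_cases hα : α = Fin.last N <;> simp [Matrix.one_apply, hα]
  rw [h1, PowerSeries.coeff_C]
  rcases Nat.eq_zero_or_pos i with rfl | hi
  · have := congrFun (congrFun h.coeff_zero α) (Fin.last N)
    simpa [Loop.coeff] using this
  · have := h.last_col i α hi
    simpa [Loop.coeff, hi.ne'] using this

theorem lastCol_of {N : ℕ} {R : Loop (N + 1)}
    (h : ∀ α, R α (Fin.last N) = (1 : Loop (N + 1)) α (Fin.last N)) (i : ℕ) (α : Fin (N + 1))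
    (hi : 1 ≤ i) : R.coeff i α (Fin.last N) = 0 := by
  have hi' : i ≠ 0 := by omega
  by_cases hα : α = Fin.last N <;>
    simp [Loop.coeff, h, hα, PowerSeries.coeff_one, hi']

theorem Loop.corner_mul {N : ℕ} (M K : Loop (N + 1))
    (h : ∀ α, M α (Fin.last N) = (1 : Loop (N + 1)) α (Fin.last N)) :
    Loop.corner (M * K) = M.corner * K.corner := by
  ext1 α β
  simp only [Loop.corner, Matrix.submatrix_apply, Matrix.mul_apply, Fin.sum_univ_castSucc]
  rw [h, Matrix.one_apply_ne (Fin.castSucc_lt_last α).ne, zero_mul, add_zero]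

theorem Loop.corner_one {N : ℕ} : (1 : Loop (N + 1)).corner = 1 := by
  simp [Loop.corner, Matrix.submatrix_one _ (Fin.castSucc_injective N)]

theorem IsOpenLoop.one {N : ℕ} (η : Matrix (Fin N) (Fin N) ℂ) :
    IsOpenLoop η (1 : Loop (N + 1)) where
  coeff_zero := Loop.coeff_zero_one
  symplectic := by simp [IsSymplectic, Loop.corner_one, Loop.adj_one]
  last_col := lastCol_of fun _ => rfl

theorem IsOpenLoop.mul {N : ℕ} {η : Matrix (Fin N) (Fin N) ℂ} {R S : Loop (N + 1)}
    (hR : IsOpenLoop η R) (hS : IsOpenLoop η S) : IsOpenLoop η (R * S) where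
  coeff_zero := by rw [Loop.coeff_zero_mul, hR.coeff_zero, hS.coeff_zero, one_mul]
  symplectic := by
    have h1 := hR.symplectic
    have h2 := hS.symplectic
    unfold IsSymplectic at *
    rw [Loop.corner_mul R S hR.col, Loop.adj_mul]
    calc _ = S.corner.adj * (R.corner.adj * η.map PowerSeries.C * R.corner) * S.corner := by
          simp only [Matrix.mul_assoc]
      _ = _ := by rw [h1, h2]
  last_col := lastCol_of fun α => by
    rw [Matrix.mul_apply]
    simp_rw [hS.col, ← Matrix.mul_apply, Matrix.mul_one]
    exact hR.col α

theorem IsOpenLoop.inv {N : ℕ} {η : Matrix (Fin N) (Fin N) ℂ} {R S : Loop (N + 1)}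
    (hR : IsOpenLoop η R) (hRS : R * S = 1) (hSR : S * R = 1) : IsOpenLoop η S := by
  have hcol : ∀ α, S α (Fin.last N) = (1 : Loop (N + 1)) α (Fin.last N) := fun α => by
    rw [← hSR, Matrix.mul_apply]
    simp_rw [hR.col, ← Matrix.mul_apply, Matrix.mul_one]
  refine ⟨?_, ?_, lastCol_of hcol⟩
  · have := Loop.coeff_zero_mul R S
    rwa [hRS, Loop.coeff_zero_one, hR.coeff_zero, one_mul, eq_comm] at this
  · have h1 := hR.symplectic
    have hc : R.corner * S.corner = 1 := by
      rw [← Loop.corner_mul R S hR.col, hRS, Loop.corner_one]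
    have ha : S.corner.adj * R.corner.adj = 1 := by
      rw [← Loop.adj_mul, hc, Loop.adj_one]
    unfold IsSymplectic at *
    calc S.corner.adj * η.map PowerSeries.C * S.corner
        = S.corner.adj * (R.corner.adj * η.map PowerSeries.C * R.corner) * S.corner := by rw [h1]
      _ = (S.corner.adj * R.corner.adj) * η.map PowerSeries.C * (R.corner * S.corner) := by
          simp only [Matrix.mul_assoc]
      _ = η.map PowerSeries.C := by rw [ha, hc, Matrix.one_mul, Matrix.mul_one]

/-- The group `G^o_{N+1,+}`. -/
def openLoopGroup {N : ℕ} (η : Matrix (Fin N) (Fin N) ℂ) : Subgroup (Loop (N + 1))ˣ where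
  carrier := {R | IsOpenLoop η (R : Loop (N + 1))}
  one_mem' := IsOpenLoop.one η
  mul_mem' hR hS := IsOpenLoop.mul hR hS
  inv_mem' {R} hR := IsOpenLoop.inv hR R.mul_inv R.inv_mul

end OpenGivental

end

open scoped PowerSeries

noncomputable section

namespace OpenGivental

open MvPowerSeries

/-! ### Vector fields on the infinite-dimensional phase space -/

section Phase

variable {L : ℕ} {K : Type} [CommRing K]

/-! A sequence of vector potentials is encoded as one Laurent vector `J`, the sum over all integers
`a` of `𝓕^{α,a}(-z)^{-a-1}`. Its nonnegative powers of `z` carry the coordinates `q`, so `J`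
parametrizes a cone as a graph over them. Let `nrm J` project onto negative powers of `z` along the
tangent spaces of this cone. In these terms the string and dilaton equations say that `z⁻¹J` and `J`
are tangent, the remaining equations say that `z∂J` and `z∂∂J` are tangent (`isAncestor_of_graph`),
and `r(z)` acts infinitesimally by `J ↦ nrm J (r(z) J)` (`coeff_infAct`).

Give `t^α_a` the weight `1 - a`. The ancestor condition implies that all monomials of `𝓕^{α,a}` have
weight at least `a + 2` (`IsAncestor.lev`). With respect to this filtration `z^i` raises levels by
`i`, so `J ↦ nrm J (r(z) J)` is a contraction. Picard iteration therefore produces flows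
(`exists_flow`), the coefficients are polynomial in time, and integral curves are unique
(`IsCurve.unique`). Along a flow every defect of tangency satisfies a homogeneous linear equation
that gains one level per step, so a defect that vanishes initially vanishes forever
(`IsFlow.isCone`). Independence of the last variables and the Lagrangian symmetry of the closed
sector persist by the same argument (`IsFlow.indep`, `IsFlow.closed`); this is where the vanishing
last column and the symplectic condition enter.

The group law (`ActsTo.mul`) comes from a flat connection on the square of two times `θ`, `s` whose
edges carry the generators of the two factors, of the product, and zero. By flatness the family of
`θ`-flows is also a flow in `s` (`IsFlow.parameter`), so both ways around the square have the same
endpoint.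

For transitivity a group element is built order by order. If two sequences agree to some order, the
leading part of their difference satisfies the linearized associativity equations. In a basis of
idempotents `e i` with characters `χ k` these equations and the string equation leave only the
numbers `χ k (∂_{e i}^{n+2})`, `i ≠ k`, undetermined (`sm_of_pure`), and the recursion relations
extend agreement from the small phase space to all variables (`IsAncestor.lev_of_sm`). A generator
with leading term `r_n z^n` changes these numbers by `(-1)^n χ k (r_n e i)` (`char_leading`). Hence
a unique off-diagonal `r_n` corrects them, and the open-closed type of both sequences forces this
`r_n` into the Lie algebra of the group (`idemMat_last`, `idemMat_symp`). The limit of the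
corrections carries one sequence to the other (`exists_openLie`). -/

/-- Power series in the variables `t^α_a` over a coefficient ring `K`. -/
abbrev PS (L : ℕ) (K : Type) [CommRing K] : Type := MvPowerSeries (Fin L × ℕ) K

/-- Each coefficient of `T g` depends on finitely many coefficients of `g`. -/
def Finitary (T : PS L K → PS L K) : Prop :=
  ∀ m, ∃ S : Finset (Fin L × ℕ →₀ ℕ), ∀ g h, (∀ m' ∈ S, coeff m' g = coeff m' h) →
    coeff m (T g) = coeff m (T h)

theorem Finitary.comp {T U : PS L K → PS L K} (hT : Finitary T) (hU : Finitary U) :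
    Finitary fun g => T (U g) := by
  classical
  intro m
  obtain ⟨S, hS⟩ := hT m
  choose V hV using hU
  refine ⟨S.biUnion V, fun g h H => hS _ _ fun m' hm' => hV m' _ _ fun m'' hm'' => ?_⟩
  exact H _ (Finset.mem_biUnion.2 ⟨m', hm', hm''⟩)

theorem Finitary.add {T U : PS L K → PS L K} (hT : Finitary T) (hU : Finitary U) :
    Finitary fun g => T g + U g := by
  classical
  intro m
  obtain ⟨S, hS⟩ := hT m
  obtain ⟨S', hS'⟩ := hU m
  refine ⟨S ∪ S', fun g h H => ?_⟩
  rw [map_add, map_add, hS g h fun m' h' => H _ (Finset.mem_union_left _ h'),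
    hS' g h fun m' h' => H _ (Finset.mem_union_right _ h')]

theorem Finitary.mul_left {T : PS L K → PS L K} (f : PS L K) (hT : Finitary T) :
    Finitary fun g => f * T g := by
  classical
  intro m
  choose V hV using hT
  refine ⟨(Finset.HasAntidiagonal.antidiagonal m).biUnion fun p => V p.2, fun g h H => ?_⟩
  rw [coeff_mul, coeff_mul]
  refine Finset.sum_congr rfl fun p hp => ?_
  rw [hV p.2 g h fun m' h' => H _ (Finset.mem_biUnion.2 ⟨p, hp, h'⟩)]

theorem Finitary.const (f : PS L K) : Finitary fun _ => f :=
  fun _ => ⟨∅, fun _ _ _ => rfl⟩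

theorem Finitary.sum {ι : Type} (s : Finset ι) {T : ι → PS L K → PS L K}
    (hT : ∀ i ∈ s, Finitary (T i)) : Finitary fun g => ∑ i ∈ s, T i g := by
  classical
  induction s using Finset.induction_on with
  | empty => simpa using Finitary.const 0
  | insert a s ha ih =>
    simp only [Finset.sum_insert ha]
    exact (hT a (Finset.mem_insert_self a s)).add
      (ih fun i hi => hT i (Finset.mem_insert_of_mem hi))

theorem Finitary.pderiv (j : Fin L × ℕ) : Finitary fun g : PS L K => MvPowerSeries.pderiv K j g := by
  intro m
  refine ⟨{m + Finsupp.single j 1}, fun g h H => ?_⟩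
  rw [coeff_pderiv, coeff_pderiv, H _ (Finset.mem_singleton_self _)]

/-- The finitary derivations: the vector fields `∑ f^α_a ∂/∂t^α_a` for locally finite families. -/
def vf (L : ℕ) (K : Type) [CommRing K] :
    LieSubalgebra K (Derivation K (PS L K) (PS L K)) where
  carrier := {δ | Finitary δ}
  add_mem' ha hb := ha.add hb
  zero_mem' := Finitary.const 0
  smul_mem' c δ hδ := by
    have := Finitary.mul_left (C c) hδ
    simp only [← smul_eq_C_mul] at this
    exact this
  lie_mem' {δ ε} hδ hε := by
    have h1 := (Finitary.comp hδ hε).add (Finitary.mul_left (-1) (Finitary.comp hε hδ))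
    simp only [neg_mul, one_mul, ← sub_eq_add_neg] at h1
    intro m
    obtain ⟨S, hS⟩ := h1 m
    exact ⟨S, fun g h H => by
      rw [Derivation.commutator_apply, Derivation.commutator_apply]
      exact hS g h H⟩

instance : FunLike (vf L K) (PS L K) (PS L K) where
  coe δ := δ.1
  coe_injective _ _ h := Subtype.ext (DFunLike.coe_injective h)

instance : AddMonoidHomClass (vf L K) (PS L K) (PS L K) where
  map_add δ := map_add δ.1
  map_zero δ := map_zero δ.1

theorem vf_finitary (δ : vf L K) : Finitary δ := δ.2

theorem vf_mul (δ : vf L K) (f g : PS L K) : δ (f * g) = f * δ g + g * δ f := δ.1.leibniz f g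

theorem vf_smul (δ : vf L K) (c : K) (g : PS L K) : δ (c • g) = c • δ g := δ.1.map_smul c g

theorem vf_C (δ : vf L K) (c : K) : δ (C c) = 0 := δ.1.map_algebraMap c

theorem vf_lie (δ ε : vf L K) (g : PS L K) : ⁅δ, ε⁆ g = δ (ε g) - ε (δ g) :=
  Derivation.commutator_apply g

theorem vf_add_apply (δ ε : vf L K) (g : PS L K) : (δ + ε) g = δ g + ε g := rfl

/-- By the Leibniz rule a derivation on polynomials is determined by its values on the variables.
Being finitary, it sees only a polynomial truncation of a series in each coefficient. -/
theorem vf_ext {δ ε : vf L K} (h : ∀ j, δ (X j) = ε (X j)) : δ = ε := by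
  classical
  have hpoly : ∀ p : MvPolynomial (Fin L × ℕ) K, δ (p : PS L K) = ε (p : PS L K) := by
    intro p
    induction p using MvPolynomial.induction_on with
    | C a => rw [MvPolynomial.coe_C, vf_C, vf_C]
    | add p p' hp hp' => rw [MvPolynomial.coe_add, map_add, map_add, hp, hp']
    | mul_X p j hp => rw [MvPolynomial.coe_mul, MvPolynomial.coe_X, vf_mul, vf_mul, hp, h]
  refine DFunLike.ext _ _ fun g => ?_
  ext m
  obtain ⟨S, hS⟩ := vf_finitary δ m
  obtain ⟨S', hS'⟩ := vf_finitary ε m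
  let p : MvPolynomial (Fin L × ℕ) K := ∑ m' ∈ S ∪ S', MvPolynomial.monomial m' (coeff m' g)
  have hp : ∀ m' ∈ S ∪ S', coeff m' g = coeff m' (p : PS L K) := by
    intro m' hm'
    rw [MvPolynomial.coeff_coe, MvPolynomial.coeff_sum, Finset.sum_eq_single m']
    · simp
    · intro b _ hb
      simp [MvPolynomial.coeff_monomial, hb]
    · exact fun h' => absurd hm' h'
  rw [hS g p fun m' h' => hp _ (Finset.mem_union_left _ h'),
    hS' g p fun m' h' => hp _ (Finset.mem_union_right _ h'), hpoly]

/-- The coordinate vector field `∂/∂t^β_b`. -/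
def cvf (j : Fin L × ℕ) : vf L K := ⟨pderiv K j, Finitary.pderiv j⟩

theorem cvf_apply (j : Fin L × ℕ) (g : PS L K) : cvf j g = pderiv K j g := rfl

/-! ### Laurent vectors -/

/-- Vectors `∑_a w^a (-z)^{-a-1}` whose components are locally finite as `a → -∞`. -/
def LV (L : ℕ) (K : Type) [CommRing K] : Submodule (PS L K) (ℤ → Fin L → PS L K) where
  carrier := {w | ∀ S : Finset (Fin L × ℕ →₀ ℕ), ∃ M : ℤ, ∀ a < M, ∀ μ, ∀ m ∈ S,
    coeff m (w a μ) = 0}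
  add_mem' {v w} hv hw S := by
    obtain ⟨M, hM⟩ := hv S
    obtain ⟨M', hM'⟩ := hw S
    refine ⟨min M M', fun a ha μ m hm => ?_⟩
    simp [hM a (lt_of_lt_of_le ha (min_le_left _ _)) μ m hm,
      hM' a (lt_of_lt_of_le ha (min_le_right _ _)) μ m hm]
  zero_mem' S := ⟨0, fun a _ μ m _ => by simp⟩
  smul_mem' f w hw S := by
    classical
    obtain ⟨M, hM⟩ := hw (S.biUnion fun m => (Finset.HasAntidiagonal.antidiagonal m).image Prod.snd)
    refine ⟨M, fun a ha μ m hm => ?_⟩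
    simp only [Pi.smul_apply, smul_eq_mul, coeff_mul]
    refine Finset.sum_eq_zero fun p hp => ?_
    rw [hM a ha μ p.2 (Finset.mem_biUnion.2 ⟨m, hm, Finset.mem_image_of_mem _ hp⟩), mul_zero]

instance : CoeFun (LV L K) fun _ => ℤ → Fin L → PS L K := ⟨fun w => w.1⟩

@[simp] theorem LV.add_apply (v w : LV L K) (a : ℤ) (μ : Fin L) : (v + w) a μ = v a μ + w a μ := rfl
@[simp] theorem LV.sub_apply (v w : LV L K) (a : ℤ) (μ : Fin L) : (v - w) a μ = v a μ - w a μ := rfl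
@[simp] theorem LV.neg_apply (v : LV L K) (a : ℤ) (μ : Fin L) : (-v) a μ = -v a μ := rfl
@[simp] theorem LV.zero_apply (a : ℤ) (μ : Fin L) : (0 : LV L K) a μ = 0 := rfl
@[simp] theorem LV.smul_apply (f : PS L K) (v : LV L K) (a : ℤ) (μ : Fin L) :
    (f • v) a μ = f * v a μ := rfl

theorem LV.sum_apply {ι : Type} (s : Finset ι) (w : ι → LV L K) (a : ℤ) (μ : Fin L) :
    (∑ i ∈ s, w i) a μ = ∑ i ∈ s, w i a μ := by
  rw [Submodule.coe_sum, Finset.sum_apply, Finset.sum_apply]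

theorem LV.ext {v w : LV L K} (h : ∀ a μ, v a μ = w a μ) : v = w :=
  Subtype.ext (funext fun a => funext fun μ => h a μ)

/-- The coefficient of `z^b` in the `β`-th component of `w`. -/
def posC (w : LV L K) (j : Fin L × ℕ) : PS L K := (-1 : PS L K) ^ j.2 * w (Int.negSucc j.2) j.1

theorem posC_add (v w : LV L K) (j : Fin L × ℕ) : posC (v + w) j = posC v j + posC w j :=
  mul_add _ _ _

theorem posC_smul (f : PS L K) (w : LV L K) (j : Fin L × ℕ) : posC (f • w) j = f * posC w j := by
  simp only [posC, LV.smul_apply]; ring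

theorem posC_finite (w : LV L K) (S : Finset (Fin L × ℕ →₀ ℕ)) :
    ∃ B : ℕ, ∀ b ≥ B, ∀ β, ∀ m ∈ S, coeff m (posC w (β, b)) = 0 := by
  obtain ⟨M, hM⟩ := w.2 S
  refine ⟨(-M).toNat, fun b hb β m hm => ?_⟩
  have := hM (Int.negSucc b) (by omega) β m hm
  rcases neg_one_pow_eq_or (PS L K) b with h | h <;> simp [posC, h, this]

/-- The values of the vector field `∑ w^β_b ∂/∂t^β_b`. -/
def dirFun (w : LV L K) (g : PS L K) : PS L K := fun m =>
  ∑ᶠ b : ℕ, coeff m (∑ β, posC w (β, b) * pderiv K (β, b) g)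

theorem dirFun_bound (w : LV L K) (m : Fin L × ℕ →₀ ℕ) :
    ∃ B₀ : ℕ, ∀ g, ∀ b ≥ B₀, coeff m (∑ β, posC w (β, b) * pderiv K (β, b) g) = 0 := by
  classical
  obtain ⟨B, hB⟩ := posC_finite w ((Finset.HasAntidiagonal.antidiagonal m).image Prod.fst)
  refine ⟨B, fun g b hb => ?_⟩
  rw [map_sum]
  refine Finset.sum_eq_zero fun β _ => ?_
  rw [coeff_mul]
  refine Finset.sum_eq_zero fun p hp => ?_
  rw [hB b hb β p.1 (Finset.mem_image_of_mem _ hp), zero_mul]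

/-- The truncation bound does not depend on `g`. This uniformity lets additivity, the Leibniz rule
and finitariness be checked on one finite sum. -/
theorem dirFun_coeff (w : LV L K) (m : Fin L × ℕ →₀ ℕ) :
    ∃ B₀ : ℕ, ∀ B ≥ B₀, ∀ g, coeff m (dirFun w g) =
      coeff m (∑ b ∈ Finset.range B, ∑ β, posC w (β, b) * pderiv K (β, b) g) := by
  obtain ⟨B₀, h⟩ := dirFun_bound w m
  refine ⟨B₀, fun B hB g => ?_⟩
  rw [map_sum]
  refine finsum_eq_sum_of_support_subset _ fun b hb => ?_
  by_contra hb'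
  exact hb (h g b (by simp at hb'; omega))

theorem dirFun_finitary (w : LV L K) : Finitary (dirFun w) := by
  intro m
  obtain ⟨B, hB⟩ := dirFun_coeff w m
  have : Finitary fun g => ∑ b ∈ Finset.range B, ∑ β, posC w (β, b) * pderiv K (β, b) g :=
    Finitary.sum _ fun b _ => Finitary.sum _ fun β _ => (Finitary.pderiv _).mul_left _
  obtain ⟨S, hS⟩ := this m
  exact ⟨S, fun g h H => by rw [hB B le_rfl, hB B le_rfl, hS g h H]⟩

/-- The vector field `∑ w^β_b ∂/∂t^β_b`. -/
def dir (w : LV L K) : vf L K :=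
  ⟨Derivation.mk'
    { toFun := dirFun w
      map_add' := fun g h => by
        ext m
        obtain ⟨B, hB⟩ := dirFun_coeff w m
        rw [map_add, hB B le_rfl, hB B le_rfl, hB B le_rfl, ← map_add]
        simp only [map_add, mul_add, Finset.sum_add_distrib]
      map_smul' := fun c g => by
        ext m
        obtain ⟨B, hB⟩ := dirFun_coeff w m
        rw [RingHom.id_apply, map_smul, hB B le_rfl, hB B le_rfl, ← map_smul]
        simp only [Derivation.map_smul, mul_smul_comm, Finset.smul_sum] }
    (fun f g => by
      classical
      ext m
      change coeff m (dirFun w (f * g)) = coeff m (f * dirFun w g + g * dirFun w f)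
      choose B hB using fun m => dirFun_coeff w m
      -- `M` exceeds the bounds for `m` and for all second entries of its antidiagonal, so every
      -- infinite sum in the Leibniz rule is cut at the same index.
      let M := B m + ∑ p ∈ Finset.HasAntidiagonal.antidiagonal m, B p.2
      have hM : ∀ p ∈ Finset.HasAntidiagonal.antidiagonal m, B p.2 ≤ M := fun p hp =>
        (Finset.single_le_sum (f := fun p : _ × (Fin L × ℕ →₀ ℕ) => B p.2)
          (fun _ _ => Nat.zero_le _) hp).trans (Nat.le_add_left _ _)
      have key : ∀ f g, coeff m (f * dirFun w g) = coeff m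
          (f * ∑ b ∈ Finset.range M, ∑ β, posC w (β, b) * pderiv K (β, b) g) := fun f g => by
        rw [coeff_mul, coeff_mul]
        exact Finset.sum_congr rfl fun p hp => by rw [hB p.2 M (hM p hp)]
      rw [map_add, key, key, hB m M (Nat.le_add_right _ _), ← map_add]
      congr 1
      simp only [Finset.mul_sum, ← Finset.sum_add_distrib]
      refine Finset.sum_congr rfl fun b _ => Finset.sum_congr rfl fun β _ => ?_
      rw [Derivation.leibniz, smul_eq_mul, smul_eq_mul]
      ring), dirFun_finitary w⟩

theorem dir_apply (w : LV L K) (g : PS L K) : dir w g = dirFun w g := rfl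

theorem dir_coeff (w : LV L K) (m : Fin L × ℕ →₀ ℕ) :
    ∃ B₀ : ℕ, ∀ B ≥ B₀, ∀ g, coeff m (dir w g) =
      coeff m (∑ b ∈ Finset.range B, ∑ β, posC w (β, b) * pderiv K (β, b) g) :=
  dirFun_coeff w m

theorem dir_eq_sum (w : LV L K) (B : ℕ) (h : ∀ b ≥ B, ∀ β, posC w (β, b) = 0) (g : PS L K) :
    dir w g = ∑ b ∈ Finset.range B, ∑ β, posC w (β, b) * pderiv K (β, b) g := by
  ext m
  rw [map_sum]
  refine finsum_eq_sum_of_support_subset _ fun b hb => ?_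
  by_contra hb'
  refine hb ?_
  change coeff m _ = 0
  rw [Finset.sum_eq_zero fun β _ => by rw [h b (by simp at hb'; omega) β, zero_mul], map_zero]

theorem dir_X (w : LV L K) (j : Fin L × ℕ) : dir w (X j) = posC w j := by
  classical
  ext m
  obtain ⟨B, hB⟩ := dir_coeff w m
  rw [hB (B + j.2 + 1) (by omega)]
  congr 1
  rw [Finset.sum_eq_single j.2, Finset.sum_eq_single j.1]
  · rw [pderiv_X_self, mul_one]
  · intro β _ hβ
    rw [pderiv_X_of_ne (fun h => hβ (by rw [h])), mul_zero]
  · simp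
  · intro b _ hb
    exact Finset.sum_eq_zero fun β _ => by
      rw [pderiv_X_of_ne (fun h => hb (by rw [h])), mul_zero]
  · intro h
    exact absurd (Finset.mem_range.2 (by omega)) h

theorem dir_add (v w : LV L K) : dir (v + w) = dir v + dir w :=
  vf_ext fun j => by rw [vf_add_apply, dir_X, dir_X, dir_X, posC_add]

theorem dir_smul (f : PS L K) (w : LV L K) (g : PS L K) : dir (f • w) g = f * dir w g := by
  classical
  ext m
  choose B hB using fun m => dir_coeff w m
  obtain ⟨B', hB'⟩ := dir_coeff (f • w) m
  let M := B' + ∑ p ∈ Finset.HasAntidiagonal.antidiagonal m, B p.2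
  have hM : ∀ p ∈ Finset.HasAntidiagonal.antidiagonal m, B p.2 ≤ M := fun p hp =>
    (Finset.single_le_sum (f := fun p : _ × (Fin L × ℕ →₀ ℕ) => B p.2)
      (fun _ _ => Nat.zero_le _) hp).trans (Nat.le_add_left _ _)
  rw [hB' M (Nat.le_add_right _ _), coeff_mul]
  have : ∀ p ∈ Finset.HasAntidiagonal.antidiagonal m, coeff p.1 f * coeff p.2 (dir w g) = coeff p.1 f *
      coeff p.2 (∑ b ∈ Finset.range M, ∑ β, posC w (β, b) * pderiv K (β, b) g) := fun p hp => by
    rw [hB p.2 M (hM p hp)]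
  rw [Finset.sum_congr rfl this, ← coeff_mul]
  simp only [Finset.mul_sum, posC_smul, mul_assoc]

theorem dir_eq_zero (w : LV L K) (h : ∀ j, posC w j = 0) : dir w = 0 :=
  vf_ext fun j => by rw [dir_X, h]; rfl

/-- The componentwise action of a vector field. -/
def act (δ : vf L K) : LV L K →+ LV L K where
  toFun w := ⟨fun a μ => δ (w a μ), fun S => by
    classical
    choose V hV using vf_finitary δ
    obtain ⟨M, hM⟩ := w.2 (S.biUnion V)
    refine ⟨M, fun a ha μ m hm => ?_⟩
    rw [hV m (w a μ) 0 fun m' hm' => ?_, map_zero, map_zero]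
    rw [hM a ha μ m' (Finset.mem_biUnion.2 ⟨m, hm, hm'⟩), map_zero]⟩
  map_zero' := LV.ext fun a μ => map_zero δ
  map_add' v w := LV.ext fun a μ => map_add δ _ _

@[simp] theorem act_apply (δ : vf L K) (w : LV L K) (a : ℤ) (μ : Fin L) : act δ w a μ = δ (w a μ) :=
  rfl

theorem act_lie (δ ε : vf L K) (w : LV L K) : act ⁅δ, ε⁆ w = act δ (act ε w) - act ε (act δ w) :=
  LV.ext fun _ _ => vf_lie _ _ _

theorem act_pos (δ : vf L K) (w : LV L K) (j : Fin L × ℕ) : posC (act δ w) j = δ (posC w j) := by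
  rcases neg_one_pow_eq_or (PS L K) j.2 with h | h <;> simp [posC, h]

theorem act_smul (δ : vf L K) (f : PS L K) (w : LV L K) :
    act δ (f • w) = f • act δ w + δ f • w :=
  LV.ext fun a μ => by
    simp only [act_apply, LV.smul_apply, LV.add_apply, vf_mul]
    ring

theorem act_zero_vf (w : LV L K) : act (0 : vf L K) w = 0 := LV.ext fun _ _ => rfl

theorem act_add_vf (δ ε : vf L K) (w : LV L K) : act (δ + ε) w = act δ w + act ε w :=
  LV.ext fun _ _ => rfl

/-- Multiplication by `z`. -/
def zL : Module.End (PS L K) (LV L K) where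
  toFun w := ⟨fun a μ => -w (a + 1) μ, fun S => by
    obtain ⟨M, hM⟩ := w.2 S
    exact ⟨M - 1, fun a ha μ m hm => by rw [map_neg, hM _ (by omega) μ m hm, neg_zero]⟩⟩
  map_add' v w := LV.ext fun a μ => neg_add _ _
  map_smul' f w := LV.ext fun a μ => by simp

/-- Multiplication by `z⁻¹`. -/
def zInv : Module.End (PS L K) (LV L K) where
  toFun w := ⟨fun a μ => -w (a - 1) μ, fun S => by
    obtain ⟨M, hM⟩ := w.2 S
    exact ⟨M, fun a ha μ m hm => by rw [map_neg, hM _ (by omega) μ m hm, neg_zero]⟩⟩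
  map_add' v w := LV.ext fun a μ => neg_add _ _
  map_smul' f w := LV.ext fun a μ => by simp

@[simp] theorem zL_apply (w : LV L K) (a : ℤ) (μ : Fin L) : zL w a μ = -w (a + 1) μ := rfl
@[simp] theorem zInv_apply (w : LV L K) (a : ℤ) (μ : Fin L) : zInv w a μ = -w (a - 1) μ := rfl

theorem zL_pow_apply (i : ℕ) (w : LV L K) (a : ℤ) (μ : Fin L) :
    (zL ^ i : Module.End _ _) w a μ = (-1 : PS L K) ^ i * w (a + i) μ := by
  induction i generalizing a with
  | zero => simp
  | succ i ih =>
    rw [pow_succ', Module.End.mul_apply, zL_apply, ih]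
    push_cast
    rw [show a + 1 + (i : ℤ) = a + (i + 1) by ring]
    ring

/-- The action of a matrix on the vector components. -/
def matL (M : Matrix (Fin L) (Fin L) K) : Module.End (PS L K) (LV L K) where
  toFun w := ⟨fun a α => ∑ μ, M α μ • w a μ, fun S => by
    obtain ⟨M', hM⟩ := w.2 S
    exact ⟨M', fun a ha μ m hm => by
      rw [map_sum]
      exact Finset.sum_eq_zero fun ν _ => by rw [map_smul, hM a ha ν m hm, smul_zero]⟩⟩
  map_add' v w := LV.ext fun a μ => by simp [Finset.sum_add_distrib]
  map_smul' f w := LV.ext fun a μ => by simp [Finset.mul_sum]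

@[simp] theorem matL_apply (M : Matrix (Fin L) (Fin L) K) (w : LV L K) (a : ℤ) (α : Fin L) :
    matL M w a α = ∑ μ, M α μ • w a μ := rfl

theorem matL_mul (M M' : Matrix (Fin L) (Fin L) K) : matL (M * M') = matL M * matL M' := by
  ext1 w
  refine LV.ext fun a α => ?_
  simp only [matL_apply, Module.End.mul_apply, Matrix.mul_apply, Finset.smul_sum, Finset.sum_smul,
    smul_smul]
  exact Finset.sum_comm

theorem matL_one : matL (1 : Matrix (Fin L) (Fin L) K) = 1 := by
  ext1 w
  refine LV.ext fun a α => ?_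
  simp [Matrix.one_apply]

theorem matL_add (M M' : Matrix (Fin L) (Fin L) K) : matL (M + M') = matL M + matL M' := by
  ext1 w
  refine LV.ext fun a α => ?_
  simp [add_smul, Finset.sum_add_distrib]

theorem matL_zero : matL (0 : Matrix (Fin L) (Fin L) K) = 0 := by
  ext1 w
  refine LV.ext fun a α => ?_
  simp

theorem matL_zL (M : Matrix (Fin L) (Fin L) K) : Commute (matL M) (zL : Module.End _ (LV L K)) := by
  refine LinearMap.ext fun w => LV.ext fun a α => ?_
  simp

theorem matL_zInv (M : Matrix (Fin L) (Fin L) K) :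
    Commute (matL M) (zInv : Module.End _ (LV L K)) := by
  refine LinearMap.ext fun w => LV.ext fun a α => ?_
  simp

theorem zL_zInv : Commute (zL : Module.End _ (LV L K)) zInv := by
  refine LinearMap.ext fun w => LV.ext fun a α => ?_
  simp

/-- The action of `∑_{i ≤ n} r_i z^i`. -/
def loop (n : ℕ) (r : ℕ → Matrix (Fin L) (Fin L) K) : Module.End (PS L K) (LV L K) :=
  ∑ i ∈ Finset.range (n + 1), matL (r i) * zL ^ i

theorem loop_apply (n : ℕ) (r : ℕ → Matrix (Fin L) (Fin L) K) (w : LV L K) (a : ℤ) (α : Fin L) :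
    loop n r w a α = ∑ i ∈ Finset.range (n + 1), ∑ μ, r i α μ • ((-1) ^ i * w (a + i) μ) := by
  simp only [loop, LinearMap.sum_apply, Module.End.mul_apply, LV.sum_apply, matL_apply,
    zL_pow_apply]

theorem loop_zL (n : ℕ) (r : ℕ → Matrix (Fin L) (Fin L) K) : Commute (loop n r) zL :=
  Commute.sum_left _ _ _ fun _ _ => (matL_zL _).mul_left ((Commute.refl _).pow_left _)

theorem loop_zInv (n : ℕ) (r : ℕ → Matrix (Fin L) (Fin L) K) : Commute (loop n r) zInv :=
  Commute.sum_left _ _ _ fun _ _ => (matL_zInv _).mul_left (zL_zInv.pow_left _)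

theorem act_zL (δ : vf L K) (w : LV L K) : act δ (zL w) = zL (act δ w) :=
  LV.ext fun a μ => by simp

theorem act_zInv (δ : vf L K) (w : LV L K) : act δ (zInv w) = zInv (act δ w) :=
  LV.ext fun a μ => by simp

theorem act_loop (n : ℕ) (r : ℕ → Matrix (Fin L) (Fin L) K) (δ : vf L K) (w : LV L K) :
    act δ (loop n r w) = loop n r (act δ w) :=
  LV.ext fun a μ => by
    simp only [loop_apply, act_apply, map_sum, vf_smul]
    refine Finset.sum_congr rfl fun i _ => Finset.sum_congr rfl fun ν _ => ?_
    rcases neg_one_pow_eq_or (PS L K) i with h | h <;> simp [h]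

/-! ### The normal projection along the tangent spaces of a cone -/

/-- The components of `J` of negative index are the shifted coordinates `q^α_a`. -/
def IsGraph (A : Fin L → K) (J : LV L K) : Prop :=
  ∀ j : Fin L × ℕ, posC J j = X j - C (if j.2 = 1 then A j.1 else 0)

/-- The projection to the span of negative powers of `z` along the tangent spaces of the cone with
points `J`. -/
def nrm (J : LV L K) : Module.End (PS L K) (LV L K) where
  toFun w := w - act (dir w) J
  map_add' v w := by
    rw [dir_add, act_add_vf]
    abel
  map_smul' f w := LV.ext fun a μ => by
    simp only [LV.sub_apply, LV.smul_apply, act_apply, dir_smul, RingHom.id_apply]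
    ring

theorem nrm_apply (J w : LV L K) : nrm J w = w - act (dir w) J := rfl

variable {A : Fin L → K} {J : LV L K}

/-- The nonnegative powers of `z` in `J` are the shifted coordinates, and differentiating these
along `δ` returns the components of `δ`. Consequently `nrm J` kills exactly such tangent vectors. -/
theorem IsGraph.dir_act (hJ : IsGraph A J) (δ : vf L K) : dir (act δ J) = δ :=
  vf_ext fun j => by rw [dir_X, act_pos, hJ j, map_sub, vf_C, sub_zero]

theorem IsGraph.nrm_act (hJ : IsGraph A J) (δ : vf L K) : nrm J (act δ J) = 0 := by
  rw [nrm_apply, hJ.dir_act, sub_self]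

theorem IsGraph.nrm_pos (hJ : IsGraph A J) (w : LV L K) (j : Fin L × ℕ) : posC (nrm J w) j = 0 := by
  have h : posC (nrm J w) j = posC w j - posC (act (dir w) J) j := by
    simp only [nrm_apply, posC, LV.sub_apply, mul_sub]
  rw [h, act_pos, hJ j, map_sub, vf_C, dir_X, sub_zero, sub_self]

theorem nrm_of_pos {w : LV L K} (h : ∀ j, posC w j = 0) : nrm J w = w := by
  rw [nrm_apply, dir_eq_zero w h, act_zero_vf, sub_zero]

theorem act_nrm_of_pos (δ : vf L K) {w : LV L K} (h : ∀ j, posC w j = 0) :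
    nrm J (act δ w) = act δ w :=
  nrm_of_pos fun j => by rw [act_pos, h, map_zero]

/-- The infinitesimal variation of the tangency defect `nrm J (O J)` under `J ↦ J + nrm J (R J)`. -/
theorem IsGraph.variation (hJ : IsGraph A J) (R : Module.End (PS L K) (LV L K))
    (hR : ∀ δ w, act δ (R w) = R (act δ w)) (O : LV L K →+ LV L K) (hO : ∀ w, O (R w) = R (O w)) :
    nrm J (O (nrm J (R J))) - act (dir (O J)) (nrm J (R J)) =
      nrm J (R (nrm J (O J))) - act (dir (R J)) (nrm J (O J)) +
        nrm J (act (dir (R J)) (O J) - O (act (dir (R J)) J)) := by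
  set V := dir (R J)
  set u := dir (O J) with hu
  have h1 : nrm J (R J) = R J - act V J := rfl
  have h2 : act u J = O J - nrm J (O J) := by rw [nrm_apply]; abel
  have h3 : act u (nrm J (R J)) = nrm J (act u (nrm J (R J))) :=
    (act_nrm_of_pos u (hJ.nrm_pos _)).symm
  -- The commutator of two vector fields is a vector field, so the two second derivatives of `J`
  -- differ by a tangent vector.
  have h4 : nrm J (act u (act V J)) = nrm J (act V (act u J)) := by
    rw [← sub_eq_zero, ← map_sub, ← act_lie, hJ.nrm_act]
  have h5 : nrm J (act V (nrm J (O J))) = act V (nrm J (O J)) := act_nrm_of_pos V (hJ.nrm_pos _)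
  rw [h3, h1, map_sub (act u), map_sub (nrm J) (act u _), h4, hR, h2]
  simp only [map_sub, hO, h5]
  abel

end Phase

/-! ### Weight filtration, and operations on the coefficient ring -/

section Weights

variable {L : ℕ} {K : Type} [CommRing K]

/-! ### The weight filtration -/

/-- The weight of a monomial, where `t^α_a` has weight `1 - a`. -/
def wt {L : ℕ} : (Fin L × ℕ →₀ ℕ) →+ ℤ := Finsupp.weight fun j => 1 - (j.2 : ℤ)

theorem wt_single (j : Fin L × ℕ) : wt (Finsupp.single j 1) = 1 - (j.2 : ℤ) := by
  simp [wt, Finsupp.weight_single]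

/-- Power series all of whose monomials have weight at least `n`. -/
def Lvl (n : ℤ) (g : PS L K) : Prop := ∀ m, wt m < n → coeff m g = 0

/-- Vectors whose component of index `a` has weights at least `a + n`. -/
def Lev (n : ℤ) (w : LV L K) : Prop := ∀ a α, Lvl (a + n) (w a α)

theorem Lvl.mono {n k : ℤ} {g : PS L K} (h : Lvl n g) (hk : k ≤ n) : Lvl k g :=
  fun m hm => h m (by omega)

theorem Lvl.zero (n : ℤ) : Lvl n (0 : PS L K) := fun m _ => by simp

theorem Lvl.add {n : ℤ} {f g : PS L K} (hf : Lvl n f) (hg : Lvl n g) : Lvl n (f + g) :=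
  fun m hm => by rw [map_add, hf m hm, hg m hm, add_zero]

theorem Lvl.neg {n : ℤ} {f : PS L K} (hf : Lvl n f) : Lvl n (-f) :=
  fun m hm => by rw [map_neg, hf m hm, neg_zero]

theorem Lvl.sub {n : ℤ} {f g : PS L K} (hf : Lvl n f) (hg : Lvl n g) : Lvl n (f - g) := by
  rw [sub_eq_add_neg]; exact hf.add hg.neg

theorem Lvl.of_sub {n : ℤ} {f g : PS L K} (h : Lvl n (f - g)) (hg : Lvl n g) : Lvl n f := by
  have := h.add hg
  rwa [sub_add_cancel] at this

theorem Lvl.smul {n : ℤ} {f : PS L K} (hf : Lvl n f) (c : K) : Lvl n (c • f) :=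
  fun m hm => by rw [map_smul, hf m hm, smul_zero]

theorem Lvl.sum {ι : Type} {n : ℤ} (s : Finset ι) {f : ι → PS L K} (hf : ∀ i ∈ s, Lvl n (f i)) :
    Lvl n (∑ i ∈ s, f i) := fun m hm => by
  rw [map_sum]
  exact Finset.sum_eq_zero fun i hi => hf i hi m hm

theorem Lvl.mul {n k : ℤ} {f g : PS L K} (hf : Lvl n f) (hg : Lvl k g) : Lvl (n + k) (f * g) := by
  classical
  intro m hm
  rw [coeff_mul]
  refine Finset.sum_eq_zero fun p hp => ?_
  have : wt p.1 + wt p.2 = wt m := by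
    rw [← map_add, Finset.HasAntidiagonal.mem_antidiagonal.1 hp]
  by_cases h : wt p.1 < n
  · rw [hf _ h, zero_mul]
  · rw [hg _ (by omega), mul_zero]

theorem Lvl.neg_one_pow_mul {n : ℤ} {f : PS L K} (hf : Lvl n f) (i : ℕ) :
    Lvl n ((-1) ^ i * f) := by
  rcases neg_one_pow_eq_or (PS L K) i with h | h <;> rw [h]
  · rwa [one_mul]
  · rw [neg_one_mul]; exact hf.neg

theorem Lvl.pderiv {n : ℤ} {g : PS L K} (hg : Lvl n g) (j : Fin L × ℕ) :
    Lvl (n - 1 + j.2) (MvPowerSeries.pderiv K j g) := fun m hm => by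
  rw [coeff_pderiv, hg _ (by rw [map_add, wt_single]; omega), zero_mul]

theorem Lev.mono {n k : ℤ} {w : LV L K} (h : Lev n w) (hk : k ≤ n) : Lev k w :=
  fun a α => (h a α).mono (by omega)

theorem Lev.zero (n : ℤ) : Lev n (0 : LV L K) := fun _ _ => Lvl.zero _

theorem Lev.add {n : ℤ} {v w : LV L K} (hv : Lev n v) (hw : Lev n w) : Lev n (v + w) :=
  fun a α => (hv a α).add (hw a α)

theorem Lev.neg {n : ℤ} {v : LV L K} (hv : Lev n v) : Lev n (-v) := fun a α => (hv a α).neg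

theorem Lev.sub {n : ℤ} {v w : LV L K} (hv : Lev n v) (hw : Lev n w) : Lev n (v - w) :=
  fun a α => (hv a α).sub (hw a α)

theorem Lev.of_sub {n : ℤ} {v w : LV L K} (h : Lev n (v - w)) (hw : Lev n w) : Lev n v := by
  have := h.add hw
  rwa [sub_add_cancel] at this

theorem Lev.sum {ι : Type} {n : ℤ} (s : Finset ι) {w : ι → LV L K} (hw : ∀ i ∈ s, Lev n (w i)) :
    Lev n (∑ i ∈ s, w i) := fun a α => by
  rw [LV.sum_apply]
  exact Lvl.sum s fun i hi => hw i hi a α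

theorem Lev.zL {n : ℤ} {w : LV L K} (hw : Lev n w) : Lev (n + 1) (zL w) :=
  fun a α => ((hw (a + 1) α).mono (by omega)).neg

theorem Lev.zInv {n : ℤ} {w : LV L K} (hw : Lev n w) : Lev (n - 1) (zInv w) :=
  fun a α => ((hw (a - 1) α).mono (by omega)).neg

theorem Lev.matL {n : ℤ} {w : LV L K} (hw : Lev n w) (M : Matrix (Fin L) (Fin L) K) :
    Lev n (matL M w) := fun a α =>
  Lvl.sum Finset.univ fun μ _ => (hw a μ).smul (M α μ)

theorem Lev.zL_pow {n : ℤ} {w : LV L K} (hw : Lev n w) (i : ℕ) :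
    Lev (n + i) ((OpenGivental.zL ^ i : Module.End _ _) w) := by
  intro a α
  rw [zL_pow_apply]
  exact ((hw (a + i) α).mono (by omega)).neg_one_pow_mul i

/-- A loop all of whose coefficients of degree below `k` vanish raises the level by `k`. -/
theorem Lev.loop_of {n : ℤ} {w : LV L K} (hw : Lev n w) (N k : ℕ)
    {r : ℕ → Matrix (Fin L) (Fin L) K} (hr : ∀ i < k, r i = 0) : Lev (n + k) (loop N r w) := by
  rw [loop, LinearMap.sum_apply]
  refine Lev.sum _ fun i _ => ?_
  by_cases h : i < k
  · rw [hr i h, matL_zero, zero_mul]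
    exact Lev.zero _
  · rw [Module.End.mul_apply]
    exact ((hw.zL_pow i).matL _).mono (by omega)

theorem Lev.loop {n : ℤ} {w : LV L K} (hw : Lev n w) (N : ℕ)
    {r : ℕ → Matrix (Fin L) (Fin L) K} (hr : r 0 = 0) : Lev (n + 1) (OpenGivental.loop N r w) := by
  have := hw.loop_of N 1 (r := r) fun i hi => by rwa [Nat.lt_one_iff.1 hi]
  simpa using this

theorem Lev.posC {n : ℤ} {w : LV L K} (hw : Lev n w) (j : Fin L × ℕ) :
    Lvl (n - 1 - j.2) (posC w j) :=
  ((hw (Int.negSucc j.2) j.1).mono (by omega)).neg_one_pow_mul j.2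

/-- The component along `∂/∂t_b` has weight at least `n - 1 - b`, while this derivative changes
weights by `b - 1`; the dependence on `b` cancels. -/
theorem Lev.dir {n k : ℤ} {w : LV L K} (hw : Lev n w) {g : PS L K} (hg : Lvl k g) :
    Lvl (n + k - 2) (dir w g) := fun m hm => by
  obtain ⟨B, hB⟩ := dir_coeff w m
  rw [hB B le_rfl]
  refine Lvl.sum _ (fun b _ => Lvl.sum _ fun β _ => ?_) m hm
  exact ((hw.posC (β, b)).mul (hg.pderiv (β, b))).mono (by simp only; omega)

theorem Lev.act_dir {n k : ℤ} {w v : LV L K} (hw : Lev n w) (hv : Lev k v) :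
    Lev (n + k - 2) (act (OpenGivental.dir w) v) :=
  fun a α => (hw.dir (hv a α)).mono (by omega)

theorem Lev.act_cvf {n : ℤ} {w : LV L K} (hw : Lev n w) (j : Fin L × ℕ) :
    Lev (n - 1 + j.2) (act (cvf j) w) :=
  fun a α => ((hw a α).pderiv j).mono (by omega)

theorem Lev.nrm {n : ℤ} {J w : LV L K} (hw : Lev n w) (hJ : Lev 2 J) : Lev n (nrm J w) :=
  hw.sub ((hw.act_dir hJ).mono (by omega))

theorem Lev.smul {n k : ℤ} {f : PS L K} {w : LV L K} (hf : Lvl k f) (hw : Lev n w) :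
    Lev (n + k) (f • w) :=
  fun a α => (hf.mul (hw a α)).mono (by omega)

/-- The dependence of the normal projection on the cone. -/
theorem nrm_sub_nrm (J J' w w' : LV L K) :
    nrm J w - nrm J' w' = (w - w') - act (dir (w - w')) J - act (dir w') (J - J') := by
  have h : dir w = dir (w - w') + dir w' := by rw [← dir_add, sub_add_cancel]
  rw [nrm_apply, nrm_apply, h, act_add_vf, map_sub]
  abel

/-- The right-hand side of the flow equation gains one level on differences. This contraction drives
both the convergence of the Picard iteration and the uniqueness of integral curves. -/
theorem Lev.nrm_loop_sub {n : ℤ} {J J' : LV L K} (hJ : Lev 2 J) (hJ' : Lev 2 J')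
    (h : Lev n (J - J')) (N : ℕ) {r : ℕ → Matrix (Fin L) (Fin L) K} (hr : r 0 = 0) :
    Lev (n + 1) (OpenGivental.nrm J (OpenGivental.loop N r J) -
      OpenGivental.nrm J' (OpenGivental.loop N r J')) := by
  rw [nrm_sub_nrm, ← map_sub]
  refine ((h.loop N hr).sub ?_).sub ?_
  · exact ((h.loop N hr).act_dir hJ).mono (by omega)
  · exact ((hJ'.loop N hr).act_dir h).mono (by omega)

/-- Vector fields with finitely many nonzero components act as finite sums. -/
theorem act_dir_eq_sum (w v : LV L K) (B : ℕ) (h : ∀ b ≥ B, ∀ β, posC w (β, b) = 0) :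
    act (dir w) v = ∑ b ∈ Finset.range B, ∑ β, posC w (β, b) • act (cvf (β, b)) v :=
  LV.ext fun a α => by
    rw [act_apply, dir_eq_sum w B h, LV.sum_apply]
    refine Finset.sum_congr rfl fun b _ => ?_
    rw [LV.sum_apply]
    rfl

/-- The level on which a loop with coefficients in degrees `k` and higher changes the normal part. -/
theorem Lev.nrm_loop_of {J : LV L K} (hJ : Lev 2 J) (N k : ℕ)
    {r : ℕ → Matrix (Fin L) (Fin L) K} (hr : ∀ i < k, r i = 0) :
    Lev (2 + k) (OpenGivental.nrm J (OpenGivental.loop N r J)) :=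
  (hJ.loop_of N k hr).nrm hJ

theorem matL_zL_pow_lev {n : ℤ} {w : LV L K} (hw : Lev n w) (M : Matrix (Fin L) (Fin L) K)
    (i : ℕ) : Lev (n + i) ((OpenGivental.matL M * OpenGivental.zL ^ i : Module.End _ _) w) :=
  (hw.zL_pow i).matL M

theorem loop_succ (n : ℕ) (r : ℕ → Matrix (Fin L) (Fin L) K) (w : LV L K) :
    loop (n + 1) r w = loop n r w + (matL (r (n + 1)) * zL ^ (n + 1) : Module.End _ _) w := by
  rw [loop, Finset.sum_range_succ]; rfl

/-- The product of two truncated loops agrees with the truncated product in low degrees. -/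
theorem Lev.loop_mul {m : ℤ} {w : LV L K} (hw : Lev m w) (n : ℕ)
    (r s : ℕ → Matrix (Fin L) (Fin L) K) :
    Lev (m + n + 1) (OpenGivental.loop n r (OpenGivental.loop n s w) - OpenGivental.loop n
      (fun i => ∑ p ∈ Finset.HasAntidiagonal.antidiagonal i, r p.1 * s p.2) w) := by
  have h1 : (OpenGivental.loop n r * OpenGivental.loop n s : Module.End _ (LV L K)) =
      ∑ i ∈ Finset.range (n + 1), ∑ j ∈ Finset.range (n + 1),
        OpenGivental.matL (r i * s j) * OpenGivental.zL ^ (i + j) := by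
    simp only [OpenGivental.loop, Finset.sum_mul_sum]
    refine Finset.sum_congr rfl fun i _ => Finset.sum_congr rfl fun j _ => ?_
    rw [matL_mul, pow_add, mul_assoc, mul_assoc, ← mul_assoc (OpenGivental.zL ^ i),
      ← ((matL_zL (s j)).pow_right i).eq, mul_assoc]
  have h2 : (OpenGivental.loop n
      (fun i => ∑ p ∈ Finset.HasAntidiagonal.antidiagonal i, r p.1 * s p.2) :
        Module.End _ (LV L K)) =
      ∑ i ∈ Finset.range (n + 1), ∑ j ∈ Finset.range (n + 1 - i),
        OpenGivental.matL (r i * s j) * OpenGivental.zL ^ (i + j) := by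
    rw [← Finset.sum_range_diag_flip (n + 1) fun i j =>
      (OpenGivental.matL (r i * s j) * OpenGivental.zL ^ (i + j) : Module.End _ (LV L K)),
      OpenGivental.loop]
    refine Finset.sum_congr rfl fun i _ => ?_
    have h : (OpenGivental.matL (∑ p ∈ Finset.HasAntidiagonal.antidiagonal i, r p.1 * s p.2) :
        Module.End _ (LV L K)) =
        ∑ p ∈ Finset.HasAntidiagonal.antidiagonal i, OpenGivental.matL (r p.1 * s p.2) :=
      map_sum (AddMonoidHom.mk' (OpenGivental.matL (L := L) (K := K)) matL_add) _ _
    rw [h, Finset.Nat.sum_antidiagonal_eq_sum_range_succ_mk, Finset.sum_mul]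
    refine Finset.sum_congr rfl fun k hk => ?_
    rw [Nat.add_sub_cancel' (Nat.lt_succ_iff.1 (Finset.mem_range.1 hk))]
  have h1' := LinearMap.congr_fun h1 w
  have h2' := LinearMap.congr_fun h2 w
  simp only [LinearMap.sum_apply] at h1' h2'
  rw [Module.End.mul_apply] at h1'
  -- The terms with `i + j ≤ n` cancel. In the remaining ones `z ^ (i + j)` raises the level by at
  -- least `n + 1`.
  rw [h1', h2', ← Finset.sum_sub_distrib]
  refine Lev.sum _ fun i hi => ?_
  have hle : n + 1 - i ≤ n + 1 := Nat.sub_le _ _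
  rw [← Finset.sum_sdiff (Finset.range_subset_range.2 hle), add_sub_cancel_right]
  refine Lev.sum _ fun j hj => ?_
  rw [Finset.mem_sdiff, Finset.mem_range, Finset.mem_range] at hj
  exact (matL_zL_pow_lev hw _ _).mono (by push_cast; omega)

/-! ### Change of coefficients -/

variable {K' : Type} [CommRing K'] (φ : K →+* K')

/-- The change of coefficients of a Laurent vector. -/
def mapLV (w : LV L K) : LV L K' :=
  ⟨fun a μ => MvPowerSeries.map φ (w a μ), fun S => by
    obtain ⟨M, hM⟩ := w.2 S
    exact ⟨M, fun a ha μ m hm => by rw [coeff_map, hM a ha μ m hm, map_zero]⟩⟩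

@[simp] theorem mapLV_apply (w : LV L K) (a : ℤ) (μ : Fin L) :
    mapLV φ w a μ = MvPowerSeries.map φ (w a μ) := rfl

theorem map_pderiv' (j : Fin L × ℕ) (g : PS L K) :
    MvPowerSeries.map φ (MvPowerSeries.pderiv K j g) =
      MvPowerSeries.pderiv K' j (MvPowerSeries.map φ g) := by
  ext m
  simp [coeff_pderiv]

theorem map_smul' (c : K) (g : PS L K) :
    MvPowerSeries.map φ (c • g) = φ c • MvPowerSeries.map φ g := by
  ext m
  simp

theorem mapLV_posC (w : LV L K) (j : Fin L × ℕ) :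
    posC (mapLV φ w) j = MvPowerSeries.map φ (posC w j) := by
  simp [posC]

theorem mapLV_dir (w : LV L K) (g : PS L K) :
    MvPowerSeries.map φ (dir w g) = dir (mapLV φ w) (MvPowerSeries.map φ g) := by
  ext m
  obtain ⟨B, hB⟩ := dir_coeff w m
  obtain ⟨B', hB'⟩ := dir_coeff (mapLV φ w) m
  rw [coeff_map, hB (max B B') (le_max_left _ _), hB' (max B B') (le_max_right _ _), ← coeff_map]
  simp only [map_sum, map_mul, mapLV_posC, map_pderiv']

theorem mapLV_sub (v w : LV L K) : mapLV φ (v - w) = mapLV φ v - mapLV φ w :=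
  LV.ext fun a μ => by simp

theorem mapLV_act_dir (v w : LV L K) :
    mapLV φ (act (dir v) w) = act (dir (mapLV φ v)) (mapLV φ w) :=
  LV.ext fun a μ => by simp [mapLV_dir]

theorem mapLV_act_cvf (j : Fin L × ℕ) (w : LV L K) :
    mapLV φ (act (cvf j) w) = act (cvf j) (mapLV φ w) :=
  LV.ext fun a μ => by simp [cvf_apply, map_pderiv']

theorem mapLV_nrm (J w : LV L K) : mapLV φ (nrm J w) = nrm (mapLV φ J) (mapLV φ w) := by
  rw [nrm_apply, nrm_apply, mapLV_sub, mapLV_act_dir]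

theorem mapLV_zL (w : LV L K) : mapLV φ (zL w) = zL (mapLV φ w) :=
  LV.ext fun a μ => by simp

theorem mapLV_zInv (w : LV L K) : mapLV φ (zInv w) = zInv (mapLV φ w) :=
  LV.ext fun a μ => by simp

theorem mapLV_loop (n : ℕ) (r : ℕ → Matrix (Fin L) (Fin L) K) (w : LV L K) :
    mapLV φ (loop n r w) = loop n (fun i => (r i).map φ) (mapLV φ w) :=
  LV.ext fun a μ => by simp [loop_apply, map_smul']

theorem Lev.mapLV {n : ℤ} {w : LV L K} (hw : Lev n w) : Lev n (mapLV φ w) :=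
  fun a α m hm => by rw [mapLV_apply, coeff_map, hw a α m hm, map_zero]

theorem IsGraph.mapLV {A : Fin L → K} {J : LV L K} (hJ : IsGraph A J) :
    IsGraph (fun α => φ (A α)) (mapLV φ J) := fun j => by
  rw [mapLV_posC, hJ j, map_sub, map_X, map_C]
  split_ifs <;> simp

/-! ### Derivations of the coefficients -/

/-- A derivation of the coefficient ring, applied to all coefficients. -/
def cder (D : Derivation ℤ K K) (g : PS L K) : PS L K := fun m => D (coeff m g)

variable (D : Derivation ℤ K K)

theorem coeff_cder (g : PS L K) (m : Fin L × ℕ →₀ ℕ) : coeff m (cder D g) = D (coeff m g) := rfl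

theorem cder_add (f g : PS L K) : cder D (f + g) = cder D f + cder D g := by
  ext m; simp [coeff_cder]

theorem cder_neg (f : PS L K) : cder D (-f) = -cder D f := by
  ext m; simp [coeff_cder]

theorem cder_sum {ι : Type} (s : Finset ι) (f : ι → PS L K) :
    cder D (∑ i ∈ s, f i) = ∑ i ∈ s, cder D (f i) := by
  ext m; simp [coeff_cder]

theorem cder_mul (f g : PS L K) : cder D (f * g) = cder D f * g + f * cder D g := by
  classical
  ext m
  simp only [coeff_cder, coeff_mul, map_add, map_sum, Derivation.leibniz, smul_eq_mul,
    ← Finset.sum_add_distrib]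
  exact Finset.sum_congr rfl fun p _ => by ring

theorem cder_smul (c : K) (g : PS L K) : cder D (c • g) = D c • g + c • cder D g := by
  ext m
  simp only [coeff_cder, map_smul, smul_eq_mul, Derivation.leibniz, map_add]
  ring

theorem cder_pderiv (j : Fin L × ℕ) (g : PS L K) :
    cder D (MvPowerSeries.pderiv K j g) = MvPowerSeries.pderiv K j (cder D g) := by
  ext m
  have h : D ((m j : K) + 1) = 0 := by
    rw [map_add, D.map_natCast, D.map_one_eq_zero, add_zero]
  simp only [coeff_cder, coeff_pderiv, Derivation.leibniz, smul_eq_mul, h]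
  ring

theorem cder_neg_one_pow_mul (i : ℕ) (g : PS L K) :
    cder D ((-1) ^ i * g) = (-1) ^ i * cder D g := by
  rcases neg_one_pow_eq_or (PS L K) i with h | h <;> simp [h, cder_neg]

theorem Lvl.cder {n : ℤ} {g : PS L K} (hg : Lvl n g) : Lvl n (cder D g) :=
  fun m hm => by rw [coeff_cder, hg m hm, map_zero]

/-- A derivation of the coefficient ring, applied to Laurent vectors. -/
def lder : LV L K →+ LV L K where
  toFun w := ⟨fun a μ => cder D (w a μ), fun S => by
    obtain ⟨M, hM⟩ := w.2 S
    exact ⟨M, fun a ha μ m hm => by rw [coeff_cder, hM a ha μ m hm, map_zero]⟩⟩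
  map_zero' := LV.ext fun a μ => by ext m; simp [coeff_cder]
  map_add' v w := LV.ext fun a μ => cder_add D _ _

@[simp] theorem lder_apply (w : LV L K) (a : ℤ) (μ : Fin L) : lder D w a μ = cder D (w a μ) := rfl

theorem lder_posC (w : LV L K) (j : Fin L × ℕ) : posC (lder D w) j = cder D (posC w j) :=
  (cder_neg_one_pow_mul D _ _).symm

theorem cder_dir (w : LV L K) (g : PS L K) :
    cder D (dir w g) = dir (lder D w) g + dir w (cder D g) := by
  ext m
  obtain ⟨B, hB⟩ := dir_coeff w m
  obtain ⟨B', hB'⟩ := dir_coeff (lder D w) m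
  rw [map_add, coeff_cder, hB (max B B') (le_max_left _ _), hB (max B B') (le_max_left _ _),
    hB' (max B B') (le_max_right _ _), ← coeff_cder, ← map_add]
  simp only [cder_sum, cder_mul, cder_pderiv, lder_posC, ← Finset.sum_add_distrib]

theorem lder_act_dir (v w : LV L K) :
    lder D (act (dir v) w) = act (dir (lder D v)) w + act (dir v) (lder D w) :=
  LV.ext fun _ _ => cder_dir D _ _

theorem lder_act_cvf (j : Fin L × ℕ) (w : LV L K) :
    lder D (act (cvf j) w) = act (cvf j) (lder D w) :=
  LV.ext fun _ _ => cder_pderiv D _ _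

theorem lder_zL (w : LV L K) : lder D (zL w) = zL (lder D w) :=
  LV.ext fun a μ => by simp [cder_neg]

theorem lder_zInv (w : LV L K) : lder D (zInv w) = zInv (lder D w) :=
  LV.ext fun a μ => by simp [cder_neg]

theorem lder_loop (n : ℕ) (r : ℕ → Matrix (Fin L) (Fin L) K) (w : LV L K) :
    lder D (loop n r w) = loop n (fun i => (r i).map D) w + loop n r (lder D w) :=
  LV.ext fun a μ => by
    simp only [lder_apply, loop_apply, cder_sum, cder_smul, LV.add_apply, Finset.sum_add_distrib,
      cder_neg_one_pow_mul, Matrix.map_apply]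

/-- The variation of the tangency defect of `O J`. -/
theorem lder_nrm (J w : LV L K) :
    lder D (nrm J w) = nrm J (lder D w) - act (dir w) (lder D J) := by
  rw [nrm_apply, nrm_apply, map_sub, lder_act_dir]
  abel

theorem Lev.lder {n : ℤ} {w : LV L K} (hw : Lev n w) : Lev n (lder D w) :=
  fun a α => (hw a α).cder D

end Weights

/-! ### Propagation of the cone equations along flows -/

section Flow

variable {L : ℕ} {K : Type} [CommRing K] {A : Fin L → K}

/-! ### Flows and their commutation with the coordinate vector fields -/

/-- `J` is a solution of `D J = nrm J (ρ J)` for the loop `ρ`, level by level. -/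
def IsFlow (D : Derivation ℤ K K) (ρ : ℕ → Matrix (Fin L) (Fin L) K) (J : LV L K) : Prop :=
  ∀ n : ℕ, Lev (3 + n) (lder D J - nrm J (loop n ρ J))

theorem IsGraph.posC_cvf {J : LV L K} (hJ : IsGraph A J) (j k : Fin L × ℕ) :
    posC (act (cvf j) J) k = if k = j then 1 else 0 := by
  classical
  rw [act_pos, hJ k, map_sub, vf_C, sub_zero, cvf_apply, pderiv_X, Pi.single_apply]

theorem neg_one_pow_mul_eq_zero {i : ℕ} {f : PS L K} : (-1 : PS L K) ^ i * f = 0 ↔ f = 0 := by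
  rcases neg_one_pow_eq_or (PS L K) i with h | h <;> simp [h]

theorem posC_loop_eq_zero {w : LV L K} {B : ℕ} (h : ∀ b ≥ B, ∀ β, posC w (β, b) = 0) (n : ℕ)
    (r : ℕ → Matrix (Fin L) (Fin L) K) : ∀ b ≥ B + n, ∀ β, posC (loop n r w) (β, b) = 0 := by
  intro b hb β
  rw [posC, neg_one_pow_mul_eq_zero, loop_apply]
  refine Finset.sum_eq_zero fun i hi => Finset.sum_eq_zero fun μ _ => ?_
  have hi' := Finset.mem_range.1 hi
  have h1 := h (b - i) (by omega) μ
  rw [posC, neg_one_pow_mul_eq_zero] at h1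
  rw [show Int.negSucc b + (i : ℤ) = Int.negSucc (b - i) by simp only at *; omega, h1, mul_zero,
    smul_zero]

theorem IsGraph.posC_loop_cvf {J : LV L K} (hJ : IsGraph A J) (j : Fin L × ℕ) (n : ℕ)
    (r : ℕ → Matrix (Fin L) (Fin L) K) :
    ∀ b ≥ j.2 + 1 + n, ∀ β, posC (loop n r (act (cvf j) J)) (β, b) = 0 :=
  posC_loop_eq_zero (fun b hb β => by
    rw [hJ.posC_cvf, if_neg]
    rintro rfl
    simp only at hb
    omega) n r

theorem lie_cvf_dir (j : Fin L × ℕ) (w : LV L K) :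
    ⁅(cvf j : vf L K), dir w⁆ = dir (act (cvf j) w) :=
  vf_ext fun k => by
    classical
    rw [vf_lie, dir_X, dir_X, act_pos, cvf_apply, cvf_apply, pderiv_X, sub_eq_self, Pi.single_apply]
    split_ifs
    · exact (dir w).1.map_one_eq_zero
    · exact map_zero _

/-- The commutator of the flow vector field with a coordinate vector field, as a finite sum. -/
theorem IsGraph.act_dir_cvf {J : LV L K} (hJ : IsGraph A J) (j : Fin L × ℕ) (n : ℕ)
    (r : ℕ → Matrix (Fin L) (Fin L) K) (v : LV L K) :
    act (cvf j) (act (dir (loop n r J)) v) - act (dir (loop n r J)) (act (cvf j) v) =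
      ∑ b ∈ Finset.range (j.2 + 1 + n), ∑ β,
        posC (loop n r (act (cvf j) J)) (β, b) • act (cvf (β, b)) v := by
  rw [← act_lie, lie_cvf_dir, act_loop, act_dir_eq_sum _ _ _ (hJ.posC_loop_cvf j n r)]

variable {D : Derivation ℤ K K} {ρ : ℕ → Matrix (Fin L) (Fin L) K} {J : LV L K}

/-- The product rule for `nrm J (O J)` contains the derivative of `J` linearly. Replacing that
derivative by `nrm J (loop n ρ J)` costs an error of level `3 + n + c`, since the omitted degrees of
`ρ` are larger than `n`; `IsGraph.variation` evaluates the rest. The result is linear in the defect,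
except for the commutator of `O` with the flow vector field. -/
theorem IsFlow.defect (hfl : IsFlow D ρ J) (hJ : IsGraph A J) (h2 : Lev 2 J)
    (n : ℕ) (O : LV L K →+ LV L K) (hO : ∀ w, O (loop n ρ w) = loop n ρ (O w))
    (hOD : ∀ w, lder D (O w) = O (lder D w)) (c : ℤ) (hOl : ∀ m w, Lev m w → Lev (m + c) (O w)) :
    Lev (3 + n + c) (lder D (nrm J (O J)) - (nrm J (loop n ρ (nrm J (O J))) -
      act (dir (loop n ρ J)) (nrm J (O J)) +
        nrm J (act (dir (loop n ρ J)) (O J) - O (act (dir (loop n ρ J)) J)))) := by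
  rw [← hJ.variation (loop n ρ) (fun δ w => act_loop n ρ δ w) O hO, lder_nrm, hOD]
  have h : ∀ x y : LV L K, nrm J (O x) - act (dir (O J)) x - (nrm J (O y) - act (dir (O J)) y) =
      nrm J (O (x - y)) - act (dir (O J)) (x - y) := fun x y => by
    simp only [map_sub]; abel
  rw [h]
  exact ((hOl _ _ (hfl n)).nrm h2).sub (((hOl _ _ h2).act_dir (hfl n)).mono (by omega))

/-! ### Vanishing of quantities that vanish initially -/

/-- An element of `K` with vanishing derivative and vanishing value at the initial time is zero. -/
def IsClock {R : Type} [CommRing R] (D : Derivation ℤ K K) (ev : K →+* R) : Prop :=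
  ∀ x, D x = 0 → ev x = 0 → x = 0

variable {R : Type} [CommRing R] {ev : K →+* R}

theorem IsClock.lvl (hc : IsClock D ev) {g : PS L K} {n : ℤ} (h : Lvl n (cder D g))
    (h0 : MvPowerSeries.map ev g = 0) : Lvl n g :=
  fun m hm => hc _ (h m hm) (by rw [← coeff_map, h0, map_zero])

theorem IsClock.lev (hc : IsClock D ev) {w : LV L K} {n : ℤ} (h : Lev n (lder D w))
    (h0 : mapLV ev w = 0) : Lev n w :=
  fun a α => hc.lvl (h a α) (by rw [← mapLV_apply, h0]; rfl)

theorem Lvl.eq_zero {g : PS L K} {c : ℤ} (h : ∀ n : ℕ, Lvl (c + n) g) : g = 0 := by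
  ext m
  exact h (wt m - c + 1).toNat m (by omega)

theorem Lev.eq_zero {w : LV L K} {c : ℤ} (h : ∀ n : ℕ, Lev (c + n) w) : w = 0 :=
  LV.ext fun a α => Lvl.eq_zero (c := a + c) fun n => (h n a α).mono (by omega)

/-! ### Invariance of the defining equations -/

/-- When `O` commutes with all vector fields the commutator term drops out. The derivative of the
defect is then a linear expression in the defect of one level more, because `ρ 0 = 0`, and induction
on the level applies. The string and dilaton equations are the cases of multiplication by `z⁻¹` and
of the identity. -/
theorem IsFlow.defect_central (hfl : IsFlow D ρ J) (hJ : IsGraph A J) (h2 : Lev 2 J)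
    (hρ : ρ 0 = 0) (hc : IsClock D ev)
    (O : LV L K →+ LV L K) (hO : ∀ n w, O (loop n ρ w) = loop n ρ (O w))
    (hOδ : ∀ δ w, O (act δ w) = act δ (O w))
    (hOD : ∀ w, lder D (O w) = O (lder D w)) (c : ℤ) (hOl : ∀ m w, Lev m w → Lev (m + c) (O w))
    (h0 : mapLV ev (nrm J (O J)) = 0) : nrm J (O J) = 0 := by
  refine Lev.eq_zero (c := 2 + c) fun n => ?_
  induction n with
  | zero => simpa using (hOl _ _ h2).nrm h2
  | succ n ih =>
    refine hc.lev ?_ h0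
    have := hfl.defect hJ h2 n O (hO n) hOD c hOl
    rw [hOδ, sub_self, map_zero, add_zero] at this
    have h3 : Lev (2 + c + (n + 1 : ℕ)) (nrm J (loop n ρ (nrm J (O J))) -
        act (dir (loop n ρ J)) (nrm J (O J))) :=
      (((ih.loop n hρ).nrm h2).mono (by push_cast; omega)).sub
        (((h2.loop n hρ).act_dir ih).mono (by push_cast; omega))
    exact Lev.of_sub (this.mono (k := 2 + c + (n + 1 : ℕ)) (by push_cast; omega)) h3

/-- The tangency defect of multiplication by `z` on the tangent spaces of the cone. -/
def tanDef (J : LV L K) (j : Fin L × ℕ) : LV L K := nrm J (zL (act (cvf j) J))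

/-- The second-order tangency defect. -/
def rulDef (J : LV L K) (j k : Fin L × ℕ) : LV L K := nrm J (zL (act (cvf j) (act (cvf k) J)))

/-- Here `O` is `z∂_j`, and its commutator with the flow vector field is a finite combination of
other `z∂_k`. The defects for all `j` together thus satisfy a closed linear system, and the
induction on the level treats all of them simultaneously, with starting level `2 + j.2`. -/
theorem IsFlow.tanDef_eq_zero (hfl : IsFlow D ρ J) (hJ : IsGraph A J) (h2 : Lev 2 J)
    (hρ : ρ 0 = 0) (hc : IsClock D ev) (h0 : ∀ j, mapLV ev (tanDef J j) = 0) (j : Fin L × ℕ) :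
    tanDef J j = 0 := by
  have hOl : ∀ j : Fin L × ℕ, ∀ m (w : LV L K), Lev m w → Lev (m + j.2) (zL (act (cvf j) w)) :=
    fun j m w hw => ((hw.act_cvf j).zL).mono (by omega)
  suffices H : ∀ n : ℕ, ∀ j : Fin L × ℕ, Lev (2 + j.2 + n) (tanDef J j) from
    Lev.eq_zero fun n => H n j
  intro n
  induction n with
  | zero => exact fun j => by simpa [tanDef] using (hOl j _ _ h2).nrm h2
  | succ n ih =>
    intro j
    refine hc.lev ?_ (h0 j)
    let O : LV L K →+ LV L K := (zL : Module.End _ (LV L K)).toAddMonoidHom.comp (act (cvf j))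
    have := hfl.defect hJ h2 n O (fun w => by
        change zL (act _ (loop n ρ w)) = loop n ρ (zL (act _ w))
        rw [act_loop]
        exact (LinearMap.congr_fun (loop_zL n ρ) _).symm)
      (fun w => by
        change lder D (zL (act _ w)) = zL (act _ (lder D w))
        rw [lder_zL, lder_act_cvf]) j.2 (hOl j)
    change Lev _ (lder D (tanDef J j) - (nrm J (loop n ρ (tanDef J j)) -
      act (dir (loop n ρ J)) (tanDef J j) + nrm J (act (dir (loop n ρ J)) (zL (act (cvf j) J)) -
        zL (act (cvf j) (act (dir (loop n ρ J)) J))))) at this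
    rw [act_zL, ← map_sub zL, ← neg_sub (act (cvf j) _), hJ.act_dir_cvf] at this
    simp only [map_neg, map_sum, map_smul] at this
    have h3 : Lev (2 + j.2 + (n + 1 : ℕ)) (nrm J (loop n ρ (tanDef J j)) -
        act (dir (loop n ρ J)) (tanDef J j) + -∑ b ∈ Finset.range (j.2 + 1 + n), ∑ β,
          posC (loop n ρ (act (cvf j) J)) (β, b) • tanDef J (β, b)) := by
      refine ((((((ih j).loop n hρ).nrm h2).mono (by push_cast; omega)).sub
        (((h2.loop n hρ).act_dir (ih j)).mono (by push_cast; omega)))).add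
          (Lev.neg (Lev.sum _ fun b _ => Lev.sum _ fun β _ => ?_))
      refine (Lev.smul (((h2.act_cvf j).loop n hρ).posC (β, b)) (ih (β, b))).mono ?_
      simp only
      push_cast
      omega
    exact Lev.of_sub (this.mono (k := 2 + j.2 + (n + 1 : ℕ)) (by push_cast; omega)) h3

/-- Commuting the flow vector field past two coordinate derivatives yields second-order defects
again, and also first-order defects from differentiating the coefficients of the commutator. The
latter vanish by `hE`, so the second-order defects form a closed linear system. -/
theorem IsFlow.rulDef_eq_zero (hfl : IsFlow D ρ J) (hJ : IsGraph A J) (h2 : Lev 2 J)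
    (hρ : ρ 0 = 0) (hc : IsClock D ev) (hE : ∀ j, tanDef J j = 0)
    (h0 : ∀ j k, mapLV ev (rulDef J j k) = 0) (j k : Fin L × ℕ) : rulDef J j k = 0 := by
  have hOl : ∀ j k : Fin L × ℕ, ∀ m (w : LV L K), Lev m w →
      Lev (m + (j.2 + k.2 - 1)) (zL (act (cvf j) (act (cvf k) w))) :=
    fun j k m w hw => (((hw.act_cvf k).act_cvf j).zL).mono (by omega)
  suffices H : ∀ n : ℕ, ∀ j k : Fin L × ℕ, Lev (2 + (j.2 + k.2 - 1) + n) (rulDef J j k) from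
    Lev.eq_zero fun n => H n j k
  intro n
  induction n with
  | zero => exact fun j k => by simpa [rulDef] using (hOl j k _ _ h2).nrm h2
  | succ n ih =>
    intro j k
    refine hc.lev ?_ (h0 j k)
    let O : LV L K →+ LV L K :=
      (zL : Module.End _ (LV L K)).toAddMonoidHom.comp ((act (cvf j)).comp (act (cvf k)))
    have := hfl.defect hJ h2 n O (fun w => by
        change zL (act _ (act _ (loop n ρ w))) = loop n ρ (zL (act _ (act _ w)))
        rw [act_loop, act_loop]
        exact (LinearMap.congr_fun (loop_zL n ρ) _).symm)
      (fun w => by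
        change lder D (zL (act _ (act _ w))) = zL (act _ (act _ (lder D w)))
        rw [lder_zL, lder_act_cvf, lder_act_cvf]) (j.2 + k.2 - 1) (hOl j k)
    set V := dir (loop n ρ J) with hV
    change Lev _ (lder D (rulDef J j k) - (nrm J (loop n ρ (rulDef J j k)) -
      act V (rulDef J j k) + nrm J (act V (zL (act (cvf j) (act (cvf k) J))) -
        zL (act (cvf j) (act (cvf k) (act V J)))))) at this
    have hcomm : act V (zL (act (cvf j) (act (cvf k) J))) -
        zL (act (cvf j) (act (cvf k) (act V J))) =
        -zL (∑ b ∈ Finset.range (j.2 + 1 + n), ∑ β,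
          posC (loop n ρ (act (cvf j) J)) (β, b) • act (cvf (β, b)) (act (cvf k) J)) -
        zL (∑ b ∈ Finset.range (k.2 + 1 + n), ∑ β,
          (posC (loop n ρ (act (cvf k) J)) (β, b) • act (cvf j) (act (cvf (β, b)) J) +
            cvf j (posC (loop n ρ (act (cvf k) J)) (β, b)) • act (cvf (β, b)) J)) := by
      rw [← hJ.act_dir_cvf j n ρ]
      simp only [← act_smul]
      simp only [← map_sum]
      rw [← hJ.act_dir_cvf k n ρ, act_zL, ← hV]
      simp only [map_sub]
      abel
    rw [hcomm] at this
    simp only [map_sub, map_neg, map_sum, map_smul, map_add] at this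
    have h3 : Lev (2 + (j.2 + k.2 - 1) + (n + 1 : ℕ)) (nrm J (loop n ρ (rulDef J j k)) -
        act V (rulDef J j k) + (-(∑ b ∈ Finset.range (j.2 + 1 + n), ∑ β,
          posC (loop n ρ (act (cvf j) J)) (β, b) • rulDef J (β, b) k) -
          ∑ b ∈ Finset.range (k.2 + 1 + n), ∑ β,
          (posC (loop n ρ (act (cvf k) J)) (β, b) • rulDef J j (β, b) +
            cvf j (posC (loop n ρ (act (cvf k) J)) (β, b)) • tanDef J (β, b)))) := by
      refine ((((((ih j k).loop n hρ).nrm h2).mono (by push_cast; omega)).sub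
        (((h2.loop n hρ).act_dir (ih j k)).mono (by push_cast; omega)))).add (Lev.sub
          (Lev.neg (Lev.sum _ fun b _ => Lev.sum _ fun β _ => ?_))
            (Lev.sum _ fun b _ => Lev.sum _ fun β _ => Lev.add ?_ ?_))
      · refine (Lev.smul (((h2.act_cvf j).loop n hρ).posC (β, b)) (ih (β, b) k)).mono ?_
        simp only
        push_cast
        omega
      · refine (Lev.smul (((h2.act_cvf k).loop n hρ).posC (β, b)) (ih j (β, b))).mono ?_
        simp only
        push_cast
        omega
      · rw [hE, smul_zero]
        exact Lev.zero _
    exact Lev.of_sub (this.mono (k := 2 + (j.2 + k.2 - 1) + (n + 1 : ℕ)) (by push_cast; omega)) h3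

theorem IsFlow.lev_lder_cvf (hfl : IsFlow D ρ J) (hJ : IsGraph A J) (j : Fin L × ℕ) (n : ℕ) :
    Lev (2 + j.2 + n) (lder D (act (cvf j) J) - (loop n ρ (act (cvf j) J) -
      act (dir (loop n ρ J)) (act (cvf j) J) -
      ∑ b ∈ Finset.range (j.2 + 1 + n), ∑ β,
        posC (loop n ρ (act (cvf j) J)) (β, b) • act (cvf (β, b)) J)) := by
  have h := ((hfl n).act_cvf j).mono (k := 2 + j.2 + n) (by omega)
  rw [nrm_apply, map_sub, map_sub, act_loop, ← lder_act_cvf] at h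
  rw [← hJ.act_dir_cvf]
  convert h using 2
  abel

end Flow

/-! ### Propagation of the open-closed conditions along flows -/

section OpenClosed

variable {N : ℕ} {K : Type} [CommRing K] {A : Fin (N + 1) → K}
variable {D : Derivation ℤ K K} {ρ : ℕ → Matrix (Fin (N + 1)) (Fin (N + 1)) K} {J : LV (N + 1) K}
variable {R : Type} [CommRing R] {ev : K →+* R}

/-! ### The closed sector -/

/-- As the upper entries of the last column of `ρ` vanish, the closed components of `ρ J` involve
only closed components of `J`. In the commutator sum a term with `β` the last index contains one of
the derivatives under study as second factor, and any other term contains one in its coefficient.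
The system is therefore linear and closed. -/
theorem IsFlow.indep (hfl : IsFlow D ρ J) (hJ : IsGraph A J) (h2 : Lev 2 J)
    (hρ : ρ 0 = 0) (hc : IsClock D ev) (hlast : ∀ i (α : Fin N), ρ i α.castSucc (Fin.last N) = 0)
    (h0 : ∀ (b : ℕ) (a : ℤ) (α : Fin N),
      MvPowerSeries.map ev (pderiv K (Fin.last N, b) (J a α.castSucc)) = 0)
    (b : ℕ) (a : ℤ) (α : Fin N) : pderiv K (Fin.last N, b) (J a α.castSucc) = 0 := by
  suffices H : ∀ n : ℕ, ∀ (b : ℕ) (a : ℤ) (α : Fin N),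
      Lvl (a + 1 + b + n) (pderiv K (Fin.last N, b) (J a α.castSucc)) from
    Lvl.eq_zero fun n => H n b a α
  intro n
  induction n with
  | zero => exact fun b a α => ((h2 a α.castSucc).pderiv (Fin.last N, b)).mono (by simp only; omega)
  | succ n ih =>
    intro b a α
    refine hc.lvl ?_ (h0 b a α)
    have hloop : ∀ (a : ℤ) (α : Fin N),
        Lvl (a + 1 + b + (n + 1 : ℕ))
          (loop n ρ (act (cvf (Fin.last N, b)) J) a α.castSucc) := fun a α => by
      rw [loop_apply]
      refine Lvl.sum _ fun i _ => Lvl.sum _ fun μ _ => ?_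
      rcases Nat.eq_zero_or_pos i with rfl | hi
      · simpa [hρ] using Lvl.zero _
      refine Fin.lastCases ?_ (fun μ => ?_) μ
      · rw [hlast, zero_smul]
        exact Lvl.zero _
      · exact (((ih b (a + i) μ).neg_one_pow_mul i).smul _).mono (by push_cast; omega)
    have := hfl.lev_lder_cvf hJ (Fin.last N, b) n a α.castSucc
    simp only [LV.sub_apply, lder_apply, act_apply, cvf_apply, LV.sum_apply, LV.smul_apply] at this
    refine Lvl.of_sub (this.mono (by push_cast; omega)) (((hloop a α).sub ?_).sub
      (Lvl.sum _ fun b' _ => Lvl.sum _ fun β _ => ?_))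
    · exact ((h2.loop n hρ).dir (ih b a α)).mono (by push_cast; omega)
    · refine Fin.lastCases ?_ (fun β => ?_) β
      · exact ((((h2.act_cvf (Fin.last N, b)).loop n hρ).posC (Fin.last N, b')).mul
          (ih b' a α)).mono (by push_cast; omega)
      · exact (((hloop (Int.negSucc b') β).neg_one_pow_mul b').mul
          ((h2 a α.castSucc).pderiv (β.castSucc, b'))).mono (by push_cast; omega)

/-- The truncated symplectic form on the first `N` components. -/
def symp (η : Matrix (Fin N) (Fin N) K) (B : ℕ) :
    LV (N + 1) K →ₗ[PS (N + 1) K] LV (N + 1) K →ₗ[PS (N + 1) K] PS (N + 1) K :=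
  LinearMap.mk₂ _ (fun v w => ∑ b ∈ Finset.range B, ∑ α, ∑ μ, η α μ •
      (v b α.castSucc * posC w (μ.castSucc, b) - posC v (α.castSucc, b) * w b μ.castSucc))
    (fun v v' w => by
      simp only [LV.add_apply, posC_add, ← Finset.sum_add_distrib, ← smul_add]
      refine Finset.sum_congr rfl fun _ _ => Finset.sum_congr rfl fun _ _ =>
        Finset.sum_congr rfl fun _ _ => congrArg _ ?_
      ring)
    (fun f v w => by
      simp only [LV.smul_apply, posC_smul, smul_eq_mul, Finset.mul_sum]
      refine Finset.sum_congr rfl fun _ _ => Finset.sum_congr rfl fun _ _ =>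
        Finset.sum_congr rfl fun _ _ => ?_
      rw [mul_smul_comm]
      congr 1
      ring)
    (fun v w w' => by
      simp only [LV.add_apply, posC_add, ← Finset.sum_add_distrib, ← smul_add]
      refine Finset.sum_congr rfl fun _ _ => Finset.sum_congr rfl fun _ _ =>
        Finset.sum_congr rfl fun _ _ => congrArg _ ?_
      ring)
    (fun f v w => by
      simp only [LV.smul_apply, posC_smul, smul_eq_mul, Finset.mul_sum]
      refine Finset.sum_congr rfl fun _ _ => Finset.sum_congr rfl fun _ _ =>
        Finset.sum_congr rfl fun _ _ => ?_
      rw [mul_smul_comm]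
      congr 1
      ring)

variable {η : Matrix (Fin N) (Fin N) K}

theorem symp_apply (B : ℕ) (v w : LV (N + 1) K) : symp η B v w =
    ∑ b ∈ Finset.range B, ∑ α, ∑ μ, η α μ •
      (v b α.castSucc * posC w (μ.castSucc, b) - posC v (α.castSucc, b) * w b μ.castSucc) := rfl

theorem symp_act (B : ℕ) (δ : vf (N + 1) K) (v w : LV (N + 1) K) :
    δ (symp η B v w) = symp η B (act δ v) w + symp η B v (act δ w) := by
  simp only [symp_apply, map_sum, vf_smul, map_sub, vf_mul, act_apply, act_pos,
    ← Finset.sum_add_distrib, ← smul_add]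
  refine Finset.sum_congr rfl fun _ _ => Finset.sum_congr rfl fun _ _ =>
    Finset.sum_congr rfl fun _ _ => congrArg _ ?_
  ring

theorem cder_sub (D : Derivation ℤ K K) {L : ℕ} (f g : PS L K) :
    cder D (f - g) = cder D f - cder D g := by
  rw [sub_eq_add_neg, cder_add, cder_neg, sub_eq_add_neg]

theorem symp_lder (B : ℕ) (hη : ∀ α μ, D (η α μ) = 0) (v w : LV (N + 1) K) :
    cder D (symp η B v w) = symp η B (lder D v) w + symp η B v (lder D w) := by
  simp only [symp_apply, cder_sum, cder_smul, hη, zero_smul, zero_add, cder_sub, cder_mul,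
    lder_apply, lder_posC, ← Finset.sum_add_distrib, ← smul_add]
  refine Finset.sum_congr rfl fun _ _ => Finset.sum_congr rfl fun _ _ =>
    Finset.sum_congr rfl fun _ _ => congrArg _ ?_
  ring

theorem Lev.symp {n k : ℤ} {v w : LV (N + 1) K} (hv : Lev n v) (hw : Lev k w) (B : ℕ) :
    Lvl (n + k - 1) (symp η B v w) := by
  rw [symp_apply]
  refine Lvl.sum _ fun b _ => Lvl.sum _ fun α _ => Lvl.sum _ fun μ _ => Lvl.smul (Lvl.sub ?_ ?_) _
  · exact ((hv b α.castSucc).mul (hw.posC (μ.castSucc, b))).mono (by simp only; omega)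
  · exact ((hv.posC (α.castSucc, b)).mul (hw b μ.castSucc)).mono (by simp only; omega)

theorem posC_zL_zero {L : ℕ} (w : LV L K) (β : Fin L) : posC (zL w) (β, 0) = -w (0 : ℕ) β := by
  simp [posC]

theorem posC_zL_succ {L : ℕ} (w : LV L K) (β : Fin L) (b : ℕ) :
    posC (zL w) (β, b + 1) = posC w (β, b) := by
  simp only [posC, zL_apply, pow_succ]
  rw [show Int.negSucc (b + 1) + 1 = Int.negSucc b by omega]
  ring

/-- Multiplication by `z` is skew for the residue pairing. After the index shift the sums cancel,
the two boundary terms at `z^0` cancel each other, and those at the truncation index vanish by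
hypothesis. -/
theorem symp_zL (B : ℕ) (v w : LV (N + 1) K) (hv : ∀ β, posC v (β, B) = 0)
    (hw : ∀ β, posC w (β, B) = 0) :
    symp η (B + 1) (zL v) w + symp η (B + 1) v (zL w) = 0 := by
  have h1 : ∑ b ∈ Finset.range (B + 1), ∑ α, ∑ μ, η α μ •
      ((zL v : LV (N + 1) K) b α.castSucc * posC w (μ.castSucc, b)) =
      -∑ b ∈ Finset.range B, ∑ α, ∑ μ, η α μ •
        (v (b + 1 : ℕ) α.castSucc * posC w (μ.castSucc, b)) := by
    rw [Finset.sum_range_succ]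
    simp [hw]
  have h2 : ∑ b ∈ Finset.range (B + 1), ∑ α, ∑ μ, η α μ •
      (posC v (α.castSucc, b) * (zL w : LV (N + 1) K) b μ.castSucc) =
      -∑ b ∈ Finset.range B, ∑ α, ∑ μ, η α μ •
        (posC v (α.castSucc, b) * w (b + 1 : ℕ) μ.castSucc) := by
    rw [Finset.sum_range_succ]
    simp [hv]
  simp only [symp_apply, smul_sub, Finset.sum_sub_distrib, h1, h2]
  rw [Finset.sum_range_succ' (fun b => ∑ α, ∑ μ, η α μ •
      (posC (zL v) (α.castSucc, b) * w b μ.castSucc)),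
    Finset.sum_range_succ' (fun b => ∑ α, ∑ μ, η α μ •
      (v b α.castSucc * posC (zL w) (μ.castSucc, b)))]
  simp only [posC_zL_succ, posC_zL_zero, neg_mul, mul_neg, smul_neg, Finset.sum_neg_distrib]
  abel

theorem symp_zL_pow (B i : ℕ) (v w : LV (N + 1) K) (hv : ∀ b ≥ B, ∀ β, posC v (β, b) = 0)
    (hw : ∀ b ≥ B, ∀ β, posC w (β, b) = 0) (C : ℕ) (hC : B + i < C) :
    symp η C ((zL ^ i : Module.End _ _) v) w =
      (-1) ^ i * symp η C v ((zL ^ i : Module.End _ _) w) := by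
  induction i generalizing B v w with
  | zero => simp
  | succ i ih =>
    obtain ⟨C, rfl⟩ := Nat.exists_eq_add_one_of_ne_zero (show C ≠ 0 by omega)
    have hzw : ∀ b ≥ B + 1, ∀ β, posC (zL w) (β, b) = 0 := fun b hb β => by
      obtain ⟨b, rfl⟩ := Nat.exists_eq_add_one_of_ne_zero (show b ≠ 0 by omega)
      rw [posC_zL_succ, hw b (by omega)]
    have hzv : ∀ b ≥ B + i, ∀ β, posC ((zL ^ i : Module.End _ _) v) (β, b) = 0 := by
      have := posC_loop_eq_zero hv i (fun k => if k = i then 1 else 0)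
      have h2 : loop i (fun k => if k = i then (1 : Matrix (Fin (N + 1)) (Fin (N + 1)) K) else 0) v
          = (zL ^ i : Module.End _ _) v := by
        rw [loop, Finset.sum_eq_single i]
        · simp [matL_one]
        · intro k _ hk
          simp [hk, matL_zero]
        · simp
      rwa [h2] at this
    have h1 := symp_zL (η := η) C ((zL ^ i : Module.End _ _) v) w
      (hzv C (by omega)) (hw C (by omega))
    rw [pow_succ', Module.End.mul_apply, eq_neg_of_add_eq_zero_left h1,
      ih (B + 1) v (zL w) (fun b hb => hv b (by omega)) hzw (by omega), ← Module.End.mul_apply,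
      ← pow_succ, pow_succ']
    ring

theorem symp_matL (B : ℕ) (M : Matrix (Fin (N + 1)) (Fin (N + 1)) K) (s : K)
    (hlast : ∀ α : Fin N, M α.castSucc (Fin.last N) = 0)
    (hM : ∀ α μ, ∑ κ, M κ.castSucc α.castSucc * η κ μ +
      s * ∑ κ, η α κ * M κ.castSucc μ.castSucc = 0) (v w : LV (N + 1) K) :
    symp η B (matL M v) w + s • symp η B v (matL M w) = 0 := by
  have hp : ∀ (w : LV (N + 1) K) (α : Fin N) (b : ℕ), posC (matL M w) (α.castSucc, b) =
      ∑ κ : Fin N, M α.castSucc κ.castSucc • posC w (κ.castSucc, b) := fun w α b => by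
    simp only [posC, matL_apply, Fin.sum_univ_castSucc, hlast, zero_smul, add_zero, Finset.mul_sum,
      mul_smul_comm]
  have hm : ∀ (w : LV (N + 1) K) (a : ℤ) (α : Fin N), matL M w a α.castSucc =
      ∑ κ : Fin N, M α.castSucc κ.castSucc • w a κ.castSucc := fun w α b => by
    simp only [matL_apply, Fin.sum_univ_castSucc, hlast, zero_smul, add_zero]
  rw [symp_apply, symp_apply, Finset.smul_sum, ← Finset.sum_add_distrib]
  refine Finset.sum_eq_zero fun b _ => ?_
  have key : ∀ f g : Fin N → PS (N + 1) K,
      ∑ α, ∑ μ, η α μ • ((∑ κ : Fin N, M α.castSucc κ.castSucc • f κ) * g μ) +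
      s • ∑ α, ∑ μ, η α μ • (f α * ∑ κ : Fin N, M μ.castSucc κ.castSucc • g κ) = 0 := by
    intro f g
    have e1 : ∑ α, ∑ μ, η α μ • ((∑ κ : Fin N, M α.castSucc κ.castSucc • f κ) * g μ) =
        ∑ α, ∑ μ, (∑ κ, M κ.castSucc α.castSucc * η κ μ) • (f α * g μ) := by
      simp only [Finset.sum_mul, Finset.smul_sum, Finset.sum_smul, smul_mul_assoc, smul_smul]
      rw [Finset.sum_congr rfl fun α _ => Finset.sum_comm, Finset.sum_comm]
      refine Finset.sum_congr rfl fun κ _ => ?_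
      rw [Finset.sum_comm]
      simp only [mul_comm]
    have e2 : ∑ α, ∑ μ, η α μ • (f α * ∑ κ : Fin N, M μ.castSucc κ.castSucc • g κ) =
        ∑ α, ∑ μ, (∑ κ, η α κ * M κ.castSucc μ.castSucc) • (f α * g μ) := by
      simp only [Finset.mul_sum, Finset.smul_sum, Finset.sum_smul, mul_smul_comm, smul_smul]
      exact Finset.sum_congr rfl fun α _ => Finset.sum_comm
    rw [e1, e2, Finset.smul_sum, ← Finset.sum_add_distrib]
    refine Finset.sum_eq_zero fun α _ => ?_
    rw [Finset.smul_sum, ← Finset.sum_add_distrib]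
    refine Finset.sum_eq_zero fun μ _ => ?_
    rw [smul_smul, ← add_smul, hM, zero_smul]
  have k1 := key (fun κ => v b κ.castSucc) (fun κ => posC w (κ.castSucc, b))
  have k2 := key (fun κ => posC v (κ.castSucc, b)) (fun κ => w b κ.castSucc)
  simp only [hp, hm, smul_sub, Finset.sum_sub_distrib]
  rw [← sub_eq_zero.2 (k1.trans k2.symm)]
  abel

/-- The infinitesimal symplectic condition for the upper left block of a loop. -/
def IsSympLoop (η : Matrix (Fin N) (Fin N) K) (ρ : ℕ → Matrix (Fin (N + 1)) (Fin (N + 1)) K) :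
    Prop :=
  ∀ i α μ, ∑ κ : Fin N, ρ i κ.castSucc α.castSucc * η κ μ +
    (-1) ^ i * ∑ κ : Fin N, η α κ * ρ i κ.castSucc μ.castSucc = 0

/-- Moving `z^i` across the form produces the sign `(-1)^i`, which is the sign in `IsSympLoop`. The
truncation `C` has to exceed all powers of `z` that arise. -/
theorem symp_loop (hlast : ∀ i (α : Fin N), ρ i α.castSucc (Fin.last N) = 0)
    (hs : IsSympLoop η ρ) (B n : ℕ) (v w : LV (N + 1) K) (hv : ∀ b ≥ B, ∀ β, posC v (β, b) = 0)
    (hw : ∀ b ≥ B, ∀ β, posC w (β, b) = 0) (C : ℕ) (hC : B + n < C) :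
    symp η C (loop n ρ v) w + symp η C v (loop n ρ w) = 0 := by
  simp only [loop, LinearMap.sum_apply, map_sum]
  rw [← Finset.sum_add_distrib]
  refine Finset.sum_eq_zero fun i hi => ?_
  have hi := Finset.mem_range.1 hi
  have h1 := symp_matL (η := η) C (ρ i) ((-1) ^ i) (hlast i) (hs i)
    ((zL ^ i : Module.End _ _) v) w
  have h2 := symp_zL_pow (η := η) B i v (matL (ρ i) w) hv (fun b hb β => by
    have := fun μ => hw b hb μ
    simp only [posC, neg_one_pow_mul_eq_zero] at this ⊢
    simp [this]) C (by omega)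
  rw [((matL_zL (ρ i)).pow_right i).eq, Module.End.mul_apply, ← Module.End.mul_apply (zL ^ i),
    ← ((matL_zL (ρ i)).pow_right i).eq, Module.End.mul_apply, eq_neg_of_add_eq_zero_left h1, h2,
    ← Module.End.mul_apply (zL ^ i), ← ((matL_zL (ρ i)).pow_right i).eq, Module.End.mul_apply]
  rcases Nat.even_or_odd i with h | h <;> simp [h.neg_one_pow]

/-- The form on two coordinate tangent vectors measures the failure of the closedness relation: the
cone of the closed sector is Lagrangian precisely when all these values vanish. The value does not
depend on the truncation once it exceeds both indices. -/
theorem IsGraph.symp_cvf (hJ : IsGraph A J) (β α : Fin N) (b a B : ℕ) (hb : b < B) (ha : a < B) :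
    symp η B (act (cvf (β.castSucc, b)) J) (act (cvf (α.castSucc, a)) J) =
      ∑ ν, η ν α • pderiv K (β.castSucc, b) (J a ν.castSucc) -
        ∑ μ, η β μ • pderiv K (α.castSucc, a) (J b μ.castSucc) := by
  classical
  simp only [symp_apply, smul_sub, Finset.sum_sub_distrib, hJ.posC_cvf, Prod.mk.injEq,
    Fin.castSucc_inj]
  congr 1
  · rw [Finset.sum_eq_single a]
    · simp [cvf_apply]
    · intro c _ hc
      simp [hc]
    · simp [ha]
  · rw [Finset.sum_eq_single b]
    · simp [cvf_apply]
    · intro c _ hc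
      simp [hc]
    · simp [hb]

/-- In the derivative of the pairing of two tangent vectors the two loop terms cancel, since `ρ` is
skew. What remains is a derivative of the pairing and a combination of pairings of other coordinate
tangent vectors; those with a last index vanish by `hind`. -/
theorem IsFlow.closed (hfl : IsFlow D ρ J) (hJ : IsGraph A J) (h2 : Lev 2 J)
    (hρ : ρ 0 = 0) (hc : IsClock D ev) (hη : ∀ α μ, D (η α μ) = 0)
    (hlast : ∀ i (α : Fin N), ρ i α.castSucc (Fin.last N) = 0) (hs : IsSympLoop η ρ)
    (hind : ∀ (b : ℕ) (a : ℤ) (α : Fin N), pderiv K (Fin.last N, b) (J a α.castSucc) = 0)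
    (h0 : ∀ (β α : Fin N) (b a : ℕ), MvPowerSeries.map ev
      (∑ ν, η ν α • pderiv K (β.castSucc, b) (J a ν.castSucc) -
        ∑ μ, η β μ • pderiv K (α.castSucc, a) (J b μ.castSucc)) = 0)
    (β α : Fin N) (b a : ℕ) : ∑ ν, η ν α • pderiv K (β.castSucc, b) (J a ν.castSucc) -
      ∑ μ, η β μ • pderiv K (α.castSucc, a) (J b μ.castSucc) = 0 := by
  suffices H : ∀ n : ℕ, ∀ (β α : Fin N) (b a B : ℕ) (hb : b < B) (ha : a < B),
      Lvl (1 + b + a + n)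
        (symp η B (act (cvf (β.castSucc, b)) J) (act (cvf (α.castSucc, a)) J)) by
    rw [← hJ.symp_cvf β α b a (b + a + 1) (by omega) (by omega)]
    exact Lvl.eq_zero fun n => H n β α b a _ (by omega) (by omega)
  intro n
  induction n with
  | zero =>
    exact fun β α b a B _ _ => ((h2.act_cvf (β.castSucc, b)).symp (h2.act_cvf (α.castSucc, a))
      B).mono (by simp only; omega)
  | succ n ih =>
    intro β α b a B hb ha
    -- The value is independent of `B`, so the truncation is replaced by one that also accommodates
    -- the tangent vectors arising from the commutators.
    rw [hJ.symp_cvf β α b a B hb ha,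
      ← hJ.symp_cvf β α b a (b + a + n + 10) (by omega) (by omega)]
    refine hc.lvl ?_ (by
      rw [hJ.symp_cvf β α b a _ (by omega) (by omega)]; exact h0 β α b a)
    have hlast0 : ∀ (c : ℕ) (w : LV (N + 1) K) (B : ℕ),
        symp η B (act (cvf (Fin.last N, c)) J) w = 0 ∧
        symp η B w (act (cvf (Fin.last N, c)) J) = 0 := fun c w B => by
      constructor <;>
      · rw [symp_apply]
        refine Finset.sum_eq_zero fun b _ => Finset.sum_eq_zero fun α _ =>
          Finset.sum_eq_zero fun μ _ => ?_
        simp [posC, cvf_apply, hind]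
    have hloop := symp_loop hlast hs (b + a + 2) n (act (cvf (β.castSucc, b)) J)
      (act (cvf (α.castSucc, a)) J) (fun c hc γ => by
        rw [hJ.posC_cvf, if_neg]; simp only [Prod.mk.injEq]; omega) (fun c hc γ => by
        rw [hJ.posC_cvf, if_neg]; simp only [Prod.mk.injEq]; omega) (b + a + n + 10) (by omega)
    have e1 := hfl.lev_lder_cvf hJ (β.castSucc, b) n
    have e2 := hfl.lev_lder_cvf hJ (α.castSucc, a) n
    have f1 := e1.symp (h2.act_cvf (α.castSucc, a)) (η := η) (b + a + n + 10)
    have f2 := (h2.act_cvf (β.castSucc, b)).symp e2 (η := η) (b + a + n + 10)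
    have hV := symp_act (η := η) (b + a + n + 10) (dir (loop n ρ J)) (act (cvf (β.castSucc, b)) J)
      (act (cvf (α.castSucc, a)) J)
    rw [symp_lder _ hη]
    simp only [map_sub, LinearMap.sub_apply, map_sum, LinearMap.sum_apply, map_smul,
      LinearMap.smul_apply] at f1 f2
    have f3 := (f1.mono (k := 1 + b + a + (n + 1 : ℕ)) (by push_cast; omega)).add
      (f2.mono (by push_cast; omega))
    rw [sub_add_sub_comm] at f3
    refine Lvl.of_sub f3 ?_
    set V := dir (loop n ρ J)
    have hS : ∀ x₁ v₁ s₁ x₂ v₂ s₂ : PS (N + 1) K, x₁ + x₂ = 0 →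
        x₁ - v₁ - s₁ + (x₂ - v₂ - s₂) = -(v₁ + v₂) - s₁ - s₂ := fun x₁ v₁ s₁ x₂ v₂ s₂ h => by
      linear_combination h
    rw [hS _ _ _ _ _ _ hloop, ← hV]
    refine (Lvl.neg ?_).sub (Lvl.sum _ fun c hc => Lvl.sum _ fun γ _ => ?_) |>.sub
      (Lvl.sum _ fun c hc => Lvl.sum _ fun γ _ => ?_)
    · exact ((h2.loop n hρ).dir (ih β α b a _ (by omega) (by omega))).mono (by push_cast; omega)
    · have hc := Finset.mem_range.1 hc
      refine Fin.lastCases ?_ (fun γ => ?_) γ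
      · rw [(hlast0 _ _ _).1, smul_zero]
        exact Lvl.zero _
      · exact ((((h2.act_cvf (β.castSucc, b)).loop n hρ).posC (γ.castSucc, c)).mul
          (ih γ α c a _ (by omega) (by omega))).mono (by push_cast; omega)
    · have hc := Finset.mem_range.1 hc
      refine Fin.lastCases ?_ (fun γ => ?_) γ
      · rw [(hlast0 _ _ _).2, smul_zero]
        exact Lvl.zero _
      · exact ((((h2.act_cvf (α.castSucc, a)).loop n hρ).posC (γ.castSucc, c)).mul
          (ih β γ b c _ (by omega) (by omega))).mono (by push_cast; omega)

end OpenClosed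

/-! ### Flat connections in two times -/

section TwoParameters

variable {L : ℕ} {K : Type} [CommRing K] {A : Fin L → K} {J : LV L K}

/-! ### Two commuting derivations of the coefficients -/

/-- The assignment `P ↦ (J ↦ nrm J (P J))` respects brackets of vector fields on the space of cones.
The mixed second derivatives of `J` differ by a tangent vector and disappear under `nrm J`. -/
theorem IsGraph.bracket (hJ : IsGraph A J) (P Q : Module.End (PS L K) (LV L K))
    (hP : ∀ δ w, act δ (P w) = P (act δ w)) (hQ : ∀ δ w, act δ (Q w) = Q (act δ w)) :
    nrm J (P (nrm J (Q J))) - act (dir (P J)) (nrm J (Q J)) -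
      (nrm J (Q (nrm J (P J))) - act (dir (Q J)) (nrm J (P J))) =
        nrm J (P (Q J)) - nrm J (Q (P J)) := by
  set V := dir (P J)
  set U := dir (Q J)
  have h1 : nrm J (P J) = P J - act V J := rfl
  have h2 : nrm J (Q J) = Q J - act U J := rfl
  have h3 : act V (nrm J (Q J)) = nrm J (act V (nrm J (Q J))) :=
    (act_nrm_of_pos V (hJ.nrm_pos _)).symm
  have h4 : act U (nrm J (P J)) = nrm J (act U (nrm J (P J))) :=
    (act_nrm_of_pos U (hJ.nrm_pos _)).symm
  have h5 : nrm J (act V (act U J)) = nrm J (act U (act V J)) := by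
    rw [← sub_eq_zero, ← map_sub, ← act_lie, hJ.nrm_act]
  rw [h3, h4, h1, h2]
  simp only [map_sub, hP, hQ, h5]
  abel

variable {D D' : Derivation ℤ K K} {ρ κ : ℕ → Matrix (Fin L) (Fin L) K}
variable {R : Type} [CommRing R] {ev : K →+* R}

theorem loop_sub (n : ℕ) (r s : ℕ → Matrix (Fin L) (Fin L) K) (w : LV L K) :
    loop n (r - s) w = loop n r w - loop n s w := by
  refine LV.ext fun a α => ?_
  simp only [loop_apply, LV.sub_apply, Pi.sub_apply, Matrix.sub_apply, sub_smul,
    Finset.sum_sub_distrib]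

/-- The derivative of a flow with respect to a parameter. -/
theorem IsFlow.parameter (hfl : IsFlow D ρ J) (hJ : IsGraph A J) (h2 : Lev 2 J)
    (hρ : ρ 0 = 0) (hκ : κ 0 = 0) (hc : IsClock D ev) (hDD : ∀ x, D (D' x) = D' (D x))
    (hflat : ∀ i, (κ i).map D - (ρ i).map D' =
      ∑ p ∈ Finset.HasAntidiagonal.antidiagonal i, (ρ p.1 * κ p.2 - κ p.1 * ρ p.2))
    (h0 : ∀ n, mapLV ev (lder D' J - nrm J (loop n κ J)) = 0) : IsFlow D' κ J := by
  intro n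
  suffices H : ∀ k : ℕ, k ≤ n + 1 → Lev (2 + k) (lder D' J - nrm J (loop n κ J)) by
    exact (H (n + 1) le_rfl).mono (by push_cast; omega)
  intro k
  induction k with
  | zero =>
    intro _
    simp only [Nat.cast_zero, add_zero]
    exact (h2.lder D').sub (((h2.loop n hκ).mono (by omega)).nrm h2)
  | succ k ih =>
    intro hk
    have ih := ih (by omega)
    refine hc.lev ?_ (h0 n)
    set Z := lder D' J - nrm J (loop n κ J) with hZ
    set err := lder D J - nrm J (loop n ρ J) with herr
    have herrl : Lev (3 + n) err := hfl n
    have e1 : lder D' J = Z + nrm J (loop n κ J) := by rw [hZ]; abel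
    have e2 : lder D J = nrm J (loop n ρ J) + err := by rw [herr]; abel
    have e3 : lder D (lder D' J) = lder D' (lder D J) :=
      LV.ext fun a α => by ext m; exact hDD _
    have hb := hJ.bracket (loop n ρ) (loop n κ) (fun δ w => act_loop n ρ δ w)
      (fun δ w => act_loop n κ δ w)
    -- Flatness cancels all terms of degree at most `n`. The products of truncated loops leave only
    -- terms of higher degree.
    have hm : Lev (3 + n) (loop n (fun i => (ρ i).map D') J - loop n (fun i => (κ i).map D) J +
        (loop n ρ (loop n κ J) - loop n κ (loop n ρ J))) := by
      have h := (h2.loop_mul n ρ κ).sub (h2.loop_mul n κ ρ)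
      rw [sub_sub_sub_comm, ← loop_sub] at h
      have h' : (fun i => (ρ i).map D') - (fun i => (κ i).map D) =
          -((fun i => ∑ p ∈ Finset.HasAntidiagonal.antidiagonal i, ρ p.1 * κ p.2) -
            fun i => ∑ p ∈ Finset.HasAntidiagonal.antidiagonal i, κ p.1 * ρ p.2) := by
        funext i
        simp only [Pi.sub_apply, Pi.neg_apply, ← Finset.sum_sub_distrib, ← hflat i]
        abel
      rw [← loop_sub, h', ← zero_sub, loop_sub]
      have h'' : loop n 0 J = 0 := by simp [loop, matL_zero]
      rw [h'']
      refine Lev.mono ?_ (show (3 + n : ℤ) ≤ 2 + n + 1 by omega)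
      convert h using 1
      abel
    -- Together with `IsGraph.bracket` this makes the derivative of the defect `Z` linear in `Z` up
    -- to level `3 + n`, so `Z` gains one level in each step of the induction.
    have key : lder D Z = nrm J (loop n (fun i => (ρ i).map D') J -
        loop n (fun i => (κ i).map D) J + (loop n ρ (loop n κ J) - loop n κ (loop n ρ J))) +
        (nrm J (loop n ρ Z) - act (dir (loop n ρ J)) Z) +
        (lder D' err - nrm J (loop n κ err) + act (dir (loop n κ J)) err) := by
      rw [hZ, map_sub, e3, e2, map_add, lder_nrm, lder_nrm, lder_loop, lder_loop, e1, e2]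
      simp only [map_add, map_sub] at hb ⊢
      rw [← sub_eq_zero] at hb ⊢
      rw [← hb]
      abel
    rw [key]
    refine ((hm.nrm h2).mono ?_).add ((((ih.loop n hρ).nrm h2).mono ?_).sub
      (((h2.loop n hρ).act_dir ih).mono ?_)) |>.add
        ((((herrl.lder D').mono ?_).sub (((herrl.loop n hκ).nrm h2).mono ?_)).add
          (((h2.loop n hκ).act_dir herrl).mono ?_))
    all_goals push_cast; omega

end TwoParameters

section Existence

variable {L : ℕ} {K : Type} [CommRing K]

/-! ### Existence of flows -/

/-- An additive map of the coefficients, applied to Laurent vectors. -/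
def addL (I : K →+ K) (w : LV L K) : LV L K :=
  ⟨fun a μ => fun m => I (coeff m (w a μ)), fun S => by
    obtain ⟨M, hM⟩ := w.2 S
    exact ⟨M, fun a ha μ m hm => by
      change I (coeff m (w a μ)) = 0
      rw [hM a ha μ m hm, map_zero]⟩⟩

theorem coeff_addL (I : K →+ K) (w : LV L K) (a : ℤ) (μ : Fin L) (m : Fin L × ℕ →₀ ℕ) :
    coeff m (addL I w a μ) = I (coeff m (w a μ)) := rfl

theorem addL_sub (I : K →+ K) (v w : LV L K) : addL I (v - w) = addL I v - addL I w :=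
  LV.ext fun a μ => by
    ext m
    simp [coeff_addL]

theorem Lev.addL {n : ℤ} {w : LV L K} (hw : Lev n w) (I : K →+ K) : Lev n (addL I w) :=
  fun a α m hm => by rw [coeff_addL, hw a α m hm, map_zero]

variable {R : Type} [CommRing R] {D : Derivation ℤ K K} {ev : K →+* R}

/-- Successive approximations to the flow of `ρ` that starts at `J₀`. -/
def picard (I : K →+ K) (ρ : ℕ → Matrix (Fin L) (Fin L) K) (J₀ : LV L K) : ℕ → LV L K
  | 0 => J₀
  | n + 1 => J₀ + addL I (nrm (picard I ρ J₀ n) (loop (n + 1) ρ (picard I ρ J₀ n)))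

variable {I : K →+ K} {ρ : ℕ → Matrix (Fin L) (Fin L) K} {J₀ : LV L K} {A : Fin L → K}

theorem IsGraph.picard (hJ : IsGraph A J₀) (n : ℕ) : IsGraph A (picard I ρ J₀ n) := by
  induction n with
  | zero => exact hJ
  | succ n ih =>
    intro j
    have h := ih.nrm_pos (loop (n + 1) ρ (OpenGivental.picard I ρ J₀ n)) j
    rw [posC, neg_one_pow_mul_eq_zero] at h
    rw [OpenGivental.picard, posC_add, hJ j, add_eq_left, posC, neg_one_pow_mul_eq_zero]
    ext m
    rw [coeff_addL, h]
    simp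

theorem Lev.picard (h : Lev 2 J₀) (hρ : ρ 0 = 0) (n : ℕ) :
    Lev 2 (OpenGivental.picard I ρ J₀ n) := by
  induction n with
  | zero => exact h
  | succ n ih => exact h.add (((ih.loop _ hρ).mono (by omega)).nrm ih |>.addL I)

/-- Two contributions appear: the contraction applied to the previous difference, and the one new
term of the truncated loop, whose degree already gives the required level. -/
theorem Lev.picard_succ (h : Lev 2 J₀) (hρ : ρ 0 = 0) (n : ℕ) :
    Lev (3 + n) (OpenGivental.picard I ρ J₀ (n + 1) - OpenGivental.picard I ρ J₀ n) := by
  induction n with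
  | zero =>
    simp only [OpenGivental.picard, add_sub_cancel_left, Nat.cast_zero]
    exact ((h.loop _ hρ).nrm h).addL I
  | succ n ih =>
    have e : OpenGivental.picard I ρ J₀ (n + 1 + 1) - OpenGivental.picard I ρ J₀ (n + 1) =
        OpenGivental.addL I (OpenGivental.nrm (OpenGivental.picard I ρ J₀ (n + 1))
          (OpenGivental.loop (n + 1 + 1) ρ (OpenGivental.picard I ρ J₀ (n + 1))) -
            OpenGivental.nrm (OpenGivental.picard I ρ J₀ n)
              (OpenGivental.loop (n + 1) ρ (OpenGivental.picard I ρ J₀ n))) := by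
      rw [addL_sub]
      exact add_sub_add_left_eq_sub _ _ _
    rw [e, loop_succ (n + 1), map_add, add_sub_right_comm]
    refine Lev.addL (Lev.add ?_ ?_) I
    · exact (Lev.nrm_loop_sub (h.picard hρ (n + 1)) (h.picard hρ n) ih (n + 1) hρ).mono
        (by push_cast; omega)
    · exact ((matL_zL_pow_lev (h.picard hρ (n + 1)) _ _).mono (by push_cast; omega)).nrm
        (h.picard hρ (n + 1))

theorem Lev.picard_sub (h : Lev 2 J₀) (hρ : ρ 0 = 0) {n k : ℕ} (hk : n ≤ k) :
    Lev (3 + n) (OpenGivental.picard I ρ J₀ k - OpenGivental.picard I ρ J₀ n) := by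
  induction k, hk using Nat.le_induction with
  | base => simpa using Lev.zero _
  | succ k hk ih =>
    have := (Lev.picard_succ (I := I) h hρ k).mono (k := 3 + n) (by omega)
    simpa using this.add ih

/-- The limit of the successive approximations. -/
def picardLim (I : K →+ K) (ρ : ℕ → Matrix (Fin L) (Fin L) K) (J₀ : LV L K)
    (hJ : IsGraph A J₀) : LV L K :=
  -- From the iterate with index `wt m - a` on, the coefficient of `m` in the component `a` is
  -- stationary.
  ⟨fun a α m => coeff m (picard I ρ J₀ (wt m - a).toNat a α), fun S => by
    obtain ⟨M, hM⟩ := J₀.2 S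
    refine ⟨min M 0, fun a ha α m hm => ?_⟩
    obtain ⟨b, rfl⟩ : ∃ b, a = Int.negSucc b := Int.eq_negSucc_of_lt_zero (by omega)
    have h1 := (hJ.picard (I := I) (ρ := ρ) (wt m - Int.negSucc b).toNat (α, b)).trans
      (hJ (α, b)).symm
    change coeff m (picard I ρ J₀ _ (Int.negSucc b) α) = 0
    have h2 : picard I ρ J₀ (wt m - Int.negSucc b).toNat (Int.negSucc b) α =
        J₀ (Int.negSucc b) α := by
      simp only [posC] at h1
      rcases neg_one_pow_eq_or (PS L K) b with h | h <;> simpa [h] using h1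
    rw [h2, hM _ (by omega) α m hm]⟩

theorem Lev.picardLim_sub (hJ : IsGraph A J₀) (h : Lev 2 J₀) (hρ : ρ 0 = 0) (n : ℕ) :
    Lev (3 + n) (picardLim I ρ J₀ hJ - OpenGivental.picard I ρ J₀ n) := by
  intro a α m hm
  rw [LV.sub_apply, map_sub, sub_eq_zero]
  change coeff m (OpenGivental.picard I ρ J₀ (wt m - a).toNat a α) = _
  rw [← sub_eq_zero, ← map_sub, ← LV.sub_apply]
  rcases le_total n (wt m - a).toNat with hle | hle
  · exact h.picard_sub hρ hle a α m hm
  · rw [← neg_sub, LV.neg_apply, map_neg, neg_eq_zero]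
    exact h.picard_sub hρ hle a α m (by omega)

/-- The Picard recursion is an integrated form of the flow equation, with `I` as antiderivative.
Modulo level `3 + n` the limit may replace two consecutive iterates, and the truncations of `ρ` at
`n` and `n + 1` act equally. The coordinate components never move because `nrm` has only negative
powers of `z`. -/
theorem exists_flow (hDI : ∀ x, D (I x) = x) (hI : ∀ x, ev (I x) = 0)
    (hJ : IsGraph A J₀) (h : Lev 2 J₀) (hρ : ρ 0 = 0) (hDJ : lder D J₀ = 0) :
    ∃ J : LV L K, IsGraph A J ∧ Lev 2 J ∧ IsFlow D ρ J ∧ mapLV ev J = mapLV ev J₀ := by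
  have hpic : ∀ n, lder D (picard I ρ J₀ (n + 1)) =
      nrm (picard I ρ J₀ n) (loop (n + 1) ρ (picard I ρ J₀ n)) := fun n => by
    rw [picard, map_add, hDJ, zero_add]
    exact LV.ext fun a α => by ext m; exact hDI _
  have hl2 : Lev 2 (picardLim I ρ J₀ hJ) :=
    ((h.picardLim_sub hJ hρ 0).mono (by simp)).of_sub h
  refine ⟨picardLim I ρ J₀ hJ, fun j => ?_, hl2, fun n => ?_, LV.ext fun a α => ?_⟩
  · rw [← hJ j, posC, posC]
    congr 1
    ext m
    have h1 := (hJ.picard (I := I) (ρ := ρ) (wt m - Int.negSucc j.2).toNat j).trans (hJ j).symm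
    change coeff m (picard I ρ J₀ (wt m - Int.negSucc j.2).toNat (Int.negSucc j.2) j.1) = _
    simp only [posC] at h1
    rcases neg_one_pow_eq_or (PS L K) j.2 with h | h <;> simp [h] at h1 <;> rw [h1]
  · set J := picardLim I ρ J₀ hJ
    set P := picard I ρ J₀
    have e : lder D J - nrm J (loop n ρ J) = lder D (J - P (n + 1)) -
        (nrm J (loop (n + 1) ρ J) - nrm (P n) (loop (n + 1) ρ (P n))) +
        nrm J ((matL (ρ (n + 1)) * zL ^ (n + 1) : Module.End _ _) J) := by
      rw [map_sub, hpic, loop_succ n ρ J, map_add]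
      abel
    rw [e]
    refine ((((h.picardLim_sub hJ hρ (n + 1)).lder D).mono (by push_cast; omega)).sub
      ((Lev.nrm_loop_sub hl2 (h.picard hρ n) (h.picardLim_sub hJ hρ n) _ hρ).mono (by omega))).add
      (((matL_zL_pow_lev hl2 _ _).mono (by push_cast; omega)).nrm hl2)
  · ext m
    rw [mapLV_apply, mapLV_apply, coeff_map, coeff_map]
    change ev (coeff m (picard I ρ J₀ (wt m - a).toNat a α)) = _
    cases (wt m - a).toNat with
    | zero => rfl
    | succ n =>
      rw [picard, LV.add_apply, map_add, coeff_addL, map_add, hI, add_zero]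

end Existence

/-! ### Translation between vector potentials and cones -/

section Dictionary

variable {L : ℕ} {A : Fin L → ℂ} {F : VecSeq L}

/-! ### Vector potentials as Laurent vectors -/

theorem ext_negSucc (n : ℕ) (α : Fin L) :
    F.ext A (Int.negSucc n) α = (-1 : ℂ) ^ n • q A α n := rfl

theorem neg_one_pow_smul (n : ℕ) (f : Ser L) : (-1 : ℂ) ^ n • f = (-1 : Ser L) ^ n * f := by
  rw [smul_eq_C_mul, map_pow, map_neg, map_one]

/-- The Laurent vector `∑_a 𝓕^{α,a} (-z)^{-a-1}` of a sequence of vector potentials. -/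
def Jof (A : Fin L → ℂ) (F : VecSeq L) : LV L ℂ :=
  ⟨F.ext A, fun S => by
    classical
    refine ⟨-(2 + ∑ m ∈ S, ∑ j ∈ m.support, (j.2 + 1) : ℕ), fun a ha α m hm => ?_⟩
    obtain ⟨n, rfl⟩ : ∃ n, a = Int.negSucc n := Int.eq_negSucc_of_lt_zero (by omega)
    have hn : 1 + ∑ m ∈ S, ∑ j ∈ m.support, (j.2 + 1) < n := by omega
    have h1 : m ≠ Finsupp.single (α, n) 1 := by
      rintro rfl
      have h2 := Finset.single_le_sum
        (f := fun m : Fin L × ℕ →₀ ℕ => ∑ j ∈ m.support, (j.2 + 1)) (fun _ _ => Nat.zero_le _) hm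
      have h3 := Finset.single_le_sum (f := fun j : Fin L × ℕ => j.2 + 1)
        (fun _ _ => Nat.zero_le _) (show (α, n) ∈ (Finsupp.single (α, n) 1).support by simp)
      simp only at h2 h3
      omega
    rw [ext_negSucc, map_smul, q, if_neg (by omega), map_zero, sub_zero, coeff_X, if_neg h1,
      smul_zero]⟩

theorem Jof_apply (a : ℤ) (α : Fin L) : Jof A F a α = F.ext A a α := rfl

@[simp] theorem Jof_nat (a : ℕ) (α : Fin L) : Jof A F a α = F a α := rfl

theorem isGraph_Jof : IsGraph A (Jof A F) := fun j => by
  rw [posC, Jof_apply, ext_negSucc, neg_one_pow_smul, ← mul_assoc, ← mul_pow]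
  simp [q]

theorem IsGraph.apply_negSucc {J : LV L ℂ} (hJ : IsGraph A J) (n : ℕ) (α : Fin L) :
    J (Int.negSucc n) α = (-1 : ℂ) ^ n • q A α n := by
  rw [q, ← hJ (α, n), posC, neg_one_pow_smul, ← mul_assoc, ← mul_pow]
  simp

theorem IsGraph.eq_Jof {J : LV L ℂ} (hJ : IsGraph A J) : J = Jof A fun a α => J a α :=
  LV.ext fun a α => by
    cases a with
    | ofNat a => rfl
    | negSucc n => rw [hJ.apply_negSucc]; rfl

theorem Jof_injective {F' : VecSeq L} (h : Jof A F = Jof A F') : F = F' := by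
  funext a α
  rw [← Jof_nat (A := A) (F := F), h, Jof_nat]

theorem pderiv_pderiv_comm {K : Type} [CommRing K] (j k : Fin L × ℕ) (g : PS L K) :
    pderiv K j (pderiv K k g) = pderiv K k (pderiv K j g) := by
  classical
  ext m
  simp only [coeff_pderiv, add_right_comm m, Finsupp.add_apply, Finsupp.single_apply]
  by_cases h : j = k
  · subst h; ring
  · simp only [h, Ne.symm h, if_false, add_zero]
    ring

/-- Multiplication by `z` moves `∂/∂t_b` to `∂/∂t_{b+1}`, and the coefficient of `z⁻¹` in `∂_j J`
enters the `z^0` part. The outcome is the vector field of the topological recursion relation. -/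
theorem dir_zL_cvf {K : Type} [CommRing K] {A : Fin L → K} {J : LV L K} (hJ : IsGraph A J)
    (j : Fin L × ℕ) (g : PS L K) :
    dir (zL (act (cvf j) J)) g = pderiv K (j.1, j.2 + 1) g -
      ∑ μ, pderiv K j (J (0 : ℕ) μ) * pderiv K (μ, 0) g := by
  classical
  have hp : ∀ b β, posC (zL (act (cvf j) J)) (β, b + 1) = if (β, b) = j then 1 else 0 :=
    fun b β => by rw [posC_zL_succ, hJ.posC_cvf]
  rw [dir_eq_sum _ (j.2 + 1 + 1), Finset.sum_range_succ']
  · rw [add_comm, sub_eq_add_neg, add_comm, ← Finset.sum_neg_distrib]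
    congr 1
    · rw [Finset.sum_eq_single j.2, Finset.sum_eq_single j.1]
      · rw [hp, if_pos rfl, one_mul]
      · intro β _ hβ
        rw [hp, if_neg (fun h => hβ (congrArg Prod.fst h)), zero_mul]
      · simp
      · intro b _ hb
        refine Finset.sum_eq_zero fun β _ => ?_
        rw [hp, if_neg (fun h => hb (congrArg Prod.snd h)), zero_mul]
      · simp
    · refine Finset.sum_congr rfl fun μ _ => ?_
      rw [posC_zL_zero, act_apply, cvf_apply, neg_mul]
  · intro b hb β
    obtain ⟨b, rfl⟩ : ∃ c, b = c + 1 := ⟨b - 1, by omega⟩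
    rw [hp, if_neg]
    rintro rfl
    simp only at hb
    omega

theorem dir_zL_cvf_cvf {K : Type} [CommRing K] {A : Fin L → K} {J : LV L K} (hJ : IsGraph A J)
    (j k : Fin L × ℕ) (g : PS L K) :
    dir (zL (act (cvf j) (act (cvf k) J))) g =
      -∑ μ, pderiv K j (pderiv K k (J (0 : ℕ) μ)) * pderiv K (μ, 0) g := by
  classical
  rw [dir_eq_sum _ 1, Finset.sum_range_one, ← Finset.sum_neg_distrib]
  · refine Finset.sum_congr rfl fun μ _ => ?_
    rw [posC_zL_zero, act_apply, act_apply, cvf_apply, cvf_apply, neg_mul]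
  · intro b hb β
    obtain ⟨b, rfl⟩ : ∃ c, b = c + 1 := ⟨b - 1, by omega⟩
    rw [posC_zL_succ, act_pos, hJ.posC_cvf]
    split_ifs
    · exact (pderiv K j).map_one_eq_zero
    · exact map_zero _

theorem IsGraph.nrm_eq_zero {K : Type} [CommRing K] {A : Fin L → K} {J : LV L K}
    (hJ : IsGraph A J) {w : LV L K} (h : ∀ (a : ℕ) α, nrm J w a α = 0) : nrm J w = 0 :=
  LV.ext fun a α => by
    cases a with
    | ofNat a => exact h a α
    | negSucc n => simpa [posC, neg_one_pow_mul_eq_zero] using hJ.nrm_pos w (α, n)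

theorem tanDef_eq_zero_iff {K : Type} [CommRing K] {A : Fin L → K} {J : LV L K}
    (hJ : IsGraph A J) (j : Fin L × ℕ) : tanDef J j = 0 ↔ ∀ (a : ℕ) α,
      pderiv K j (J ((a + 1 : ℕ) : ℤ) α) + pderiv K (j.1, j.2 + 1) (J a α) =
        ∑ μ, pderiv K (μ, 0) (J a α) * pderiv K j (J (0 : ℕ) μ) := by
  have e : ∀ (a : ℕ) α, tanDef J j a α = -(pderiv K j (J ((a + 1 : ℕ) : ℤ) α) +
      pderiv K (j.1, j.2 + 1) (J a α)) +
        ∑ μ, pderiv K (μ, 0) (J a α) * pderiv K j (J (0 : ℕ) μ) := fun a α => by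
    simp only [tanDef, nrm_apply, LV.sub_apply, act_apply, dir_zL_cvf hJ, zL_apply, cvf_apply,
      mul_comm (pderiv K (_, 0) _)]
    push_cast
    ring
  constructor
  · intro h a α
    have := e a α
    rw [h, LV.zero_apply] at this
    linear_combination this
  · intro h
    exact hJ.nrm_eq_zero fun a α => (e a α).trans (by rw [h a α]; ring)

theorem rulDef_eq_zero_iff {K : Type} [CommRing K] {A : Fin L → K} {J : LV L K}
    (hJ : IsGraph A J) (j k : Fin L × ℕ) : rulDef J j k = 0 ↔ ∀ (a : ℕ) α,
      pderiv K j (pderiv K k (J ((a + 1 : ℕ) : ℤ) α)) =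
        ∑ μ, pderiv K j (pderiv K k (J (0 : ℕ) μ)) * pderiv K (μ, 0) (J a α) := by
  have e : ∀ (a : ℕ) α, rulDef J j k a α = -pderiv K j (pderiv K k (J ((a + 1 : ℕ) : ℤ) α)) +
        ∑ μ, pderiv K j (pderiv K k (J (0 : ℕ) μ)) * pderiv K (μ, 0) (J a α) := fun a α => by
    simp only [rulDef, nrm_apply, LV.sub_apply, act_apply, dir_zL_cvf_cvf hJ, zL_apply, cvf_apply]
    push_cast
    ring
  constructor
  · intro h a α
    have := e a α
    rw [h, LV.zero_apply] at this
    linear_combination this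
  · intro h
    exact hJ.nrm_eq_zero fun a α => (e a α).trans (by rw [h a α]; ring)

theorem string_iff : nrm (Jof A F) (zInv (Jof A F)) = 0 ↔ ∀ (α : Fin L) (a : ℤ),
    formalSum (fun b : ℕ => ∑ β, q A β (b + 1) * pd β b (F.ext A a α)) = -F.ext A (a - 1) α := by
  have hp : ∀ j : Fin L × ℕ, posC (zInv (Jof A F)) j = q A j.1 (j.2 + 1) := fun j => by
    have h := isGraph_Jof (A := A) (F := F) (j.1, j.2 + 1)
    rw [q, ← h, posC, posC, zInv_apply, pow_succ, show Int.negSucc j.2 - 1 =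
      Int.negSucc (j.2 + 1) by omega]
    ring
  have e : ∀ a α, nrm (Jof A F) (zInv (Jof A F)) a α = -F.ext A (a - 1) α -
      formalSum (fun b : ℕ => ∑ β, q A β (b + 1) * pd β b (F.ext A a α)) := fun a α => by
    rw [nrm_apply, LV.sub_apply, act_apply, dir_apply, zInv_apply, Jof_apply, Jof_apply]
    unfold dirFun formalSum
    simp only [hp]
  constructor
  · intro h α a
    have := e a α
    rw [h, LV.zero_apply] at this
    linear_combination this
  · exact fun h => LV.ext fun a α => (e a α).trans (by rw [h α a, sub_self]; rfl)

theorem dilaton_iff : nrm (Jof A F) (Jof A F) = 0 ↔ ∀ (α : Fin L) (a : ℤ),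
    formalSum (fun b : ℕ => ∑ β, q A β b * pd β b (F.ext A a α)) = F.ext A a α := by
  have e : ∀ a α, nrm (Jof A F) (Jof A F) a α = F.ext A a α -
      formalSum (fun b : ℕ => ∑ β, q A β b * pd β b (F.ext A a α)) := fun a α => by
    rw [nrm_apply, LV.sub_apply, act_apply, dir_apply, Jof_apply]
    unfold dirFun formalSum
    simp only [isGraph_Jof _, q]
  constructor
  · intro h α a
    have := e a α
    rw [h, LV.zero_apply, eq_comm, sub_eq_zero] at this
    exact this.symm
  · exact fun h => LV.ext fun a α => (e a α).trans (by rw [h α a, sub_self]; rfl)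

/-- The topological recursion relations for all `𝓕^{α,a}`. -/
theorem IsDescendant.trr_all (h : IsDescendant A F) (a : ℕ) (α : Fin L) (j k : Fin L × ℕ) :
    pd j.1 (j.2 + 1) (pderiv ℂ k (F a α)) =
      ∑ μ, pderiv ℂ j (F 0 μ) * pd μ 0 (pderiv ℂ k (F a α)) := by
  induction a generalizing α k with
  | zero => exact h.trr α j.1 k.1 j.2 k.2
  | succ a ih =>
    -- The recursion relations say that `X` annihilates all first derivatives of the potentials. By
    -- the shift relation those of `F (a + 1)` are sums of products of first derivatives of `F 0`
    -- and `F a`, minus a first derivative of `F a`, so induction on `a` applies.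
    let X : vf L ℂ := dir (zL (act (cvf j) (Jof A F)))
    have hX : ∀ g, X g = pd j.1 (j.2 + 1) g - ∑ μ, pderiv ℂ j (F 0 μ) * pd μ 0 g :=
      dir_zL_cvf isGraph_Jof j
    have h1 : ∀ k α, X (pderiv ℂ k (F a α)) = 0 := fun k α => by rw [hX, ih, sub_self]
    have h2 : ∀ k α, X (pderiv ℂ k (F 0 α)) = 0 := fun k α => by
      rw [hX]
      exact sub_eq_zero.2 (h.trr α j.1 k.1 j.2 k.2)
    rw [← sub_eq_zero, ← hX]
    have h3 : pderiv ℂ k (F (a + 1) α) = ∑ μ, pd μ 0 (F a α) * pderiv ℂ k (F 0 μ) -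
        pderiv ℂ (k.1, k.2 + 1) (F a α) := eq_sub_of_add_eq (h.shift α k.1 a k.2)
    rw [h3, map_sub, h1, map_sum, sub_zero]
    refine Finset.sum_eq_zero fun μ _ => ?_
    rw [vf_mul, h1 (μ, 0), h2]
    simp

/-- Differentiating the shift relation once more produces an unwanted term with `t_{b+1}`, which
`trr_all` cancels. -/
theorem IsDescendant.hess (h : IsDescendant A F) (a : ℕ) (α : Fin L) (j k : Fin L × ℕ) :
    pderiv ℂ j (pderiv ℂ k (F (a + 1) α)) =
      ∑ μ, pderiv ℂ j (pderiv ℂ k (F 0 μ)) * pd μ 0 (F a α) := by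
  have h3 : pderiv ℂ k (F (a + 1) α) = ∑ μ, pd μ 0 (F a α) * pderiv ℂ k (F 0 μ) -
      pderiv ℂ (k.1, k.2 + 1) (F a α) := eq_sub_of_add_eq (h.shift α k.1 a k.2)
  have h4 : pderiv ℂ (k.1, k.2 + 1) (pderiv ℂ j (F a α)) = _ := h.trr_all a α k j
  rw [h3, map_sub, map_sum, pderiv_pderiv_comm j, h4, ← Finset.sum_sub_distrib]
  refine Finset.sum_congr rfl fun μ _ => ?_
  rw [(pderiv ℂ j).leibniz, pderiv_pderiv_comm j (μ, 0) (F a α)]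
  simp only [smul_eq_mul]
  ring

end Dictionary

section Ancestor

variable {L : ℕ} {A : Fin L → ℂ} {F : VecSeq L}

/-! ### Ancestor potentials as tame cones -/

theorem coeff_pderiv_zero (j : Fin L × ℕ) (g : Ser L) :
    constantCoeff (pderiv ℂ j g) = coeff (Finsupp.single j 1) g := by
  rw [← coeff_zero_eq_constantCoeff_apply, coeff_pderiv]
  simp

/-- The dilaton equation writes each potential as a combination of its own first derivatives, and
these vanish at the origin. -/
theorem constantCoeff_of_dilaton (h : nrm (Jof A F) (Jof A F) = 0)
    (hv : ∀ (α β : Fin L) (a b : ℕ), constantCoeff (pd β b (F a α)) = 0) (a : ℕ) (α : Fin L) :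
    constantCoeff (F a α) = 0 := by
  have h1 : F a α = dir (Jof A F) (F a α) := by
    have := congrArg (fun w : LV L ℂ => w a α) h
    simpa [nrm_apply, sub_eq_zero] using this
  rw [h1, ← coeff_zero_eq_constantCoeff_apply]
  obtain ⟨B, hB⟩ := dir_coeff (Jof A F) 0
  rw [hB B le_rfl, coeff_zero_eq_constantCoeff_apply]
  simp [hv]

theorem exists_eq_add_single {m : Fin L × ℕ →₀ ℕ} (h : m ≠ 0) :
    ∃ m' j, m = m' + Finsupp.single j 1 := by
  obtain ⟨j, hj⟩ := Finsupp.ne_iff.1 h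
  refine ⟨m - Finsupp.single j 1, j, (tsub_add_cancel_of_le ?_).symm⟩
  simpa [Nat.one_le_iff_ne_zero] using hj

theorem coeff_pderiv_eq_zero_iff {m : Fin L × ℕ →₀ ℕ} {j : Fin L × ℕ} {g : Ser L} :
    coeff m (pderiv ℂ j g) = 0 ↔ coeff (m + Finsupp.single j 1) g = 0 := by
  rw [coeff_pderiv]
  simp only [mul_eq_zero, or_iff_left_iff_imp]
  intro h
  exact absurd h (Nat.cast_add_one_ne_zero (m j))

theorem wt_eq_degree {m : Fin L × ℕ →₀ ℕ} (h : ∀ j ∈ m.support, j.2 = 0) :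
    wt m = m.degree := by
  rw [wt, Finsupp.weight_apply, Finsupp.degree_apply, Finsupp.sum]
  push_cast
  exact Finset.sum_congr rfl fun j hj => by simp [h j hj]

/-- This is the dimension bound of genus zero ancestor correlators. Induction on the degree of the
monomial: for positive `a` the formula `hess` reduces to `F (a - 1)` and `F 0`; for `a = 0` a
variable with positive index is lowered by `trr_all`; a monomial in the small variables has weight
equal to its degree, which is at least two. For the coordinate components the bound is attained by
the variable and by the dilaton shift. -/
theorem IsAncestor.lev (h : IsAncestor A F) : Lev 2 (Jof A F) := by
  have hcc := constantCoeff_of_dilaton (dilaton_iff.2 h.descendant.dilaton) h.vanishing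
  have hv : ∀ (j : Fin L × ℕ) a α, coeff (Finsupp.single j 1) (F a α) = 0 := fun j a α => by
    rw [← coeff_pderiv_zero]
    exact h.vanishing α j.1 a j.2
  have key : ∀ (d : ℕ) (m : Fin L × ℕ →₀ ℕ), m.degree = d → ∀ (a : ℕ) α,
      wt m < a + 2 → coeff m (F a α) = 0 := by
    intro d
    induction d using Nat.strong_induction_on with
    | _ d ih =>
    rintro m rfl a α hm
    by_cases h0 : m = 0
    · rw [h0]
      exact hcc a α
    obtain ⟨m₁, k, rfl⟩ := exists_eq_add_single h0
    by_cases h1 : m₁ = 0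
    · rw [h1, zero_add]
      exact hv k a α
    have hdeg : ∀ (m : Fin L × ℕ →₀ ℕ) j, (m + Finsupp.single j 1).degree = m.degree + 1 :=
      fun m j => by rw [map_add, Finsupp.degree_single]
    cases a with
    | succ a =>
      obtain ⟨m', j, rfl⟩ := exists_eq_add_single h1
      rw [← coeff_pderiv_eq_zero_iff, ← coeff_pderiv_eq_zero_iff, h.descendant.hess, map_sum]
      refine Finset.sum_eq_zero fun μ _ => ?_
      classical
      rw [coeff_mul]
      refine Finset.sum_eq_zero fun p hp => ?_
      have hp := Finset.HasAntidiagonal.mem_antidiagonal.1 hp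
      have hd : m'.degree = p.1.degree + p.2.degree := by rw [← hp, map_add]
      have hw : wt m' = wt p.1 + wt p.2 := by rw [← hp, map_add]
      simp only [map_add, wt_single, Nat.cast_add, Nat.cast_one] at hm
      by_contra hne
      have hne1 := left_ne_zero_of_mul hne
      have hne2 := right_ne_zero_of_mul hne
      rw [ne_eq, coeff_pderiv_eq_zero_iff] at hne1 hne2
      rw [coeff_pderiv_eq_zero_iff] at hne1
      -- If `p.2` were zero, the second factor would be a first derivative at the origin, which
      -- vanishes. So the first factor has smaller degree than the original monomial.
      have hp2 : p.2.degree ≠ 0 := fun h0 => by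
        rw [Finsupp.degree_eq_zero_iff] at h0
        rw [h0, zero_add] at hne2
        exact hne2 (hv _ _ _)
      have i1 : ¬ wt (p.1 + Finsupp.single j 1 + Finsupp.single k 1) < (0 : ℕ) + 2 := fun hlt =>
        hne1 (ih _ (by simp only [hdeg]; omega) _ rfl 0 μ hlt)
      have i2 : ¬ wt (p.2 + Finsupp.single (μ, 0) 1) < (a : ℕ) + 2 := fun hlt =>
        hne2 (ih _ (by simp only [hdeg]; omega) _ rfl a α hlt)
      simp only [map_add, wt_single] at i1 i2
      push_cast at i1 i2
      omega
    | zero =>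
      by_cases hsm : ∀ j ∈ (m₁ + Finsupp.single k 1).support, j.2 = 0
      · rw [wt_eq_degree hsm, hdeg] at hm
        have : m₁.degree ≠ 0 := by rwa [ne_eq, Finsupp.degree_eq_zero_iff]
        push_cast at hm
        omega
      · push Not at hsm
        obtain ⟨⟨β, b⟩, hj, hb⟩ := hsm
        obtain ⟨b, rfl⟩ : ∃ c, b = c + 1 := ⟨b - 1, by simp only at hb; omega⟩
        obtain ⟨m₂, hm₂⟩ : ∃ m₂, m₁ + Finsupp.single k 1 = m₂ + Finsupp.single (β, b + 1) 1 :=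
          ⟨_, (tsub_add_cancel_of_le (by
            simpa [Nat.one_le_iff_ne_zero] using Finsupp.mem_support_iff.1 hj)).symm⟩
        have hm₂0 : m₂ ≠ 0 := by
          rintro rfl
          have := congrArg Finsupp.degree hm₂
          rw [hdeg, hdeg] at this
          simp [Finsupp.degree_eq_zero_iff] at this
          exact h1 this
        rw [hm₂] at ih hm ⊢
        obtain ⟨m', l, rfl⟩ := exists_eq_add_single hm₂0
        rw [← coeff_pderiv_eq_zero_iff, ← coeff_pderiv_eq_zero_iff,
          pderiv_pderiv_comm, show pderiv ℂ (β, b + 1) (pderiv ℂ l (F 0 α)) = _ from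
            h.descendant.trr_all 0 α (β, b) l, map_sum]
        refine Finset.sum_eq_zero fun μ _ => ?_
        classical
        rw [coeff_mul]
        refine Finset.sum_eq_zero fun p hp => ?_
        have hp := Finset.HasAntidiagonal.mem_antidiagonal.1 hp
        have hd : m'.degree = p.1.degree + p.2.degree := by rw [← hp, map_add]
        have hw : wt m' = wt p.1 + wt p.2 := by rw [← hp, map_add]
        simp only [map_add, wt_single, Nat.cast_add, Nat.cast_one] at hm
        by_contra hne
        have hne1 := left_ne_zero_of_mul hne
        have hne2 := right_ne_zero_of_mul hne
        rw [ne_eq, coeff_pderiv_eq_zero_iff] at hne1 hne2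
        rw [coeff_pderiv_eq_zero_iff] at hne2
        have hp1 : p.1.degree ≠ 0 := fun h0 => by
          rw [Finsupp.degree_eq_zero_iff] at h0
          rw [h0, zero_add] at hne1
          exact hne1 (hv _ _ _)
        have i1 : ¬ wt (p.1 + Finsupp.single (β, b) 1) < (0 : ℕ) + 2 := fun hlt =>
          hne1 (ih _ (by simp only [hdeg]; omega) _ rfl 0 μ hlt)
        have i2 : ¬ wt (p.2 + Finsupp.single (μ, 0) 1 + Finsupp.single l 1) < (0 : ℕ) + 2 :=
          fun hlt => hne2 (ih _ (by simp only [hdeg]; omega) _ rfl 0 α hlt)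
        simp only [map_add, wt_single] at i1 i2
        push_cast at i1 i2 hm
        omega
  intro a α m hm
  cases a with
  | ofNat a => exact key _ m rfl a α (by simpa using hm)
  | negSucc n =>
    rw [Jof_apply, ext_negSucc, map_smul, q, map_sub, coeff_X, coeff_C]
    rw [if_neg, zero_sub]
    · split_ifs with h1 h2
      · subst h1 h2
        simp at hm
      all_goals simp
    · rintro rfl
      rw [wt_single] at hm
      omega

theorem IsAncestor.tanDef (h : IsAncestor A F) (j : Fin L × ℕ) : tanDef (Jof A F) j = 0 :=
  (tanDef_eq_zero_iff isGraph_Jof j).2 fun a α => h.descendant.shift α j.1 a j.2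

theorem IsAncestor.rulDef (h : IsAncestor A F) (j k : Fin L × ℕ) : rulDef (Jof A F) j k = 0 :=
  (rulDef_eq_zero_iff isGraph_Jof j k).2 fun a α => h.descendant.hess a α j k

/-- Only the recursion relation is not immediate. It follows by differentiating the shift relation
for `F 0` and eliminating the second derivatives of `F 1` by the second-order tangency. -/
theorem isAncestor_of_graph (h2 : Lev 2 (Jof A F)) (ht : ∀ j, tanDef (Jof A F) j = 0)
    (hr : ∀ j k, rulDef (Jof A F) j k = 0) (hs : nrm (Jof A F) (zInv (Jof A F)) = 0)
    (hd : nrm (Jof A F) (Jof A F) = 0) : IsAncestor A F where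
  descendant :=
    { string := string_iff.1 hs
      dilaton := dilaton_iff.1 hd
      trr := fun α β γ b c => by
        have h1 : pderiv ℂ (γ, c) (F 1 α) + pderiv ℂ (γ, c + 1) (F 0 α) =
          ∑ μ, pd μ 0 (F 0 α) * pderiv ℂ (γ, c) (F 0 μ) :=
            (tanDef_eq_zero_iff isGraph_Jof (γ, c)).1 (ht _) 0 α
        have h2 : pderiv ℂ (β, b) (F 1 α) + pderiv ℂ (β, b + 1) (F 0 α) =
          ∑ μ, pd μ 0 (F 0 α) * pderiv ℂ (β, b) (F 0 μ) :=
            (tanDef_eq_zero_iff isGraph_Jof (β, b)).1 (ht _) 0 α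
        have h3 : pderiv ℂ (β, b) (pderiv ℂ (γ, c) (F 1 α)) =
          ∑ μ, pderiv ℂ (β, b) (pderiv ℂ (γ, c) (F 0 μ)) * pd μ 0 (F 0 α) :=
            (rulDef_eq_zero_iff isGraph_Jof _ _).1 (hr (β, b) (γ, c)) 0 α
        have h4 : pderiv ℂ (β, b + 1) (F 0 α) = ∑ μ, pd μ 0 (F 0 α) * pderiv ℂ (β, b) (F 0 μ) -
          pderiv ℂ (β, b) (F 1 α) := eq_sub_of_add_eq' h2
        change pderiv ℂ (β, b + 1) (pderiv ℂ (γ, c) (F 0 α)) = _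
        rw [pderiv_pderiv_comm, h4, map_sub, pderiv_pderiv_comm (γ, c), h3, map_sum,
          ← Finset.sum_sub_distrib]
        refine Finset.sum_congr rfl fun μ _ => ?_
        rw [(pderiv ℂ (γ, c)).leibniz, pderiv_pderiv_comm (γ, c) (β, b),
          pderiv_pderiv_comm (γ, c) (μ, 0)]
        simp only [smul_eq_mul]
        ring
      shift := fun α β a b => (tanDef_eq_zero_iff isGraph_Jof (β, b)).1 (ht _) a α }
  vanishing := fun α β a b => by
    rw [pd, coeff_pderiv_zero]
    exact h2 a α _ (by rw [wt_single]; simp only; omega)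

/-- The coefficients of the infinitesimal action. -/
theorem coeff_infAct (h2 : Lev 2 (Jof A F)) (r : Loop L) (hr : r.coeff 0 = 0) (a : ℕ) (α : Fin L)
    (m : Fin L × ℕ →₀ ℕ) (D : ℕ) (hD : wt m ≤ 2 + a + D) :
    coeff m (infAct A r F a α) = coeff m (nrm (Jof A F) (loop D r.coeff (Jof A F)) a α) := by
  classical
  have e1 : coeff m (formalSum fun i : ℕ => ∑ μ, ((-1) ^ (i + 1) * r.coeff (i + 1) α μ) •
      F (a + (i + 1)) μ) = coeff m (loop D r.coeff (Jof A F) a α) := by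
    rw [loop_apply, Finset.sum_range_succ', hr]
    simp only [Matrix.zero_apply, zero_smul, Finset.sum_const_zero, add_zero, map_sum]
    refine (finsum_eq_sum_of_support_subset (s := Finset.range D) _ fun i hi => ?_).trans ?_
    · by_contra hi'
      refine hi ?_
      simp only [map_sum, map_smul]
      refine Finset.sum_eq_zero fun μ _ => ?_
      rw [← Jof_nat (A := A) (F := F), h2 _ _ m (by push_cast; simp at hi'; omega),
        smul_zero]
    · refine Finset.sum_congr rfl fun i _ => ?_
      rw [map_sum]
      refine Finset.sum_congr rfl fun μ _ => ?_
      rw [← neg_one_pow_smul, smul_smul, mul_comm]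
      rfl
  -- The double sum is minus the derivative along `dir (loop D r.coeff J)`: the degree `i` of the
  -- loop is cut off by weights, the index `j` of the variable by local finiteness of `J`.
  have e2 : coeff m (formalSum (fun p : ℕ × ℕ => ∑ μ, ∑ ν,
      ((-1) ^ (p.1 + p.2) * r.coeff (p.1 + 1) μ ν) •
        (pd μ p.2 (F a α) * F.ext A ((p.1 : ℤ) - (p.2 : ℤ)) ν))) =
      -coeff m (dir (loop D r.coeff (Jof A F)) (F a α)) := by
    obtain ⟨B, hB⟩ := dir_coeff (loop D r.coeff (Jof A F)) m
    obtain ⟨M, hM⟩ := (Jof A F).2 ((Finset.HasAntidiagonal.antidiagonal m).image Prod.snd)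
    rw [hB (B + (D - M).toNat) (by omega)]
    refine (finsum_eq_sum_of_support_subset
      (s := Finset.range D ×ˢ Finset.range (B + (D - M).toNat)) _ fun p hp => ?_).trans ?_
    · by_contra hp'
      refine hp ?_
      simp only [map_sum, map_smul]
      refine Finset.sum_eq_zero fun μ _ => Finset.sum_eq_zero fun ν _ => ?_
      by_cases hpD : p.1 < D
      · have hpB : B + (D - M).toNat ≤ p.2 := by
          by_contra hlt
          exact hp' (by simp [hpD]; omega)
        rw [coeff_mul, Finset.sum_eq_zero, smul_zero]
        intro x hx
        rw [show coeff x.2 (F.ext A ((p.1 : ℤ) - (p.2 : ℤ)) ν) = 0 from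
          hM _ (by omega) ν _ (Finset.mem_image_of_mem _ hx), mul_zero]
      · have h3 : Lvl (a + 2 - 1 + p.2 + (p.1 - p.2 + 2))
            (pd μ p.2 (F a α) * F.ext A ((p.1 : ℤ) - (p.2 : ℤ)) ν) :=
          Lvl.mul ((h2 a α).pderiv (μ, p.2)) (h2 _ ν)
        rw [h3 m (by omega), smul_zero]
    · rw [Finset.sum_product, Finset.sum_comm, ← map_neg, ← Finset.sum_neg_distrib, map_sum]
      refine Finset.sum_congr rfl fun b _ => ?_
      rw [← map_sum]
      congr 1
      rw [Finset.sum_comm, ← Finset.sum_neg_distrib]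
      refine Finset.sum_congr rfl fun μ _ => ?_
      rw [posC, loop_apply, Finset.sum_range_succ', hr]
      simp only [Matrix.zero_apply, zero_smul, Finset.sum_const_zero, add_zero]
      rw [← neg_mul, ← mul_neg, ← Finset.sum_neg_distrib, Finset.mul_sum, Finset.sum_mul]
      refine Finset.sum_congr rfl fun i _ => ?_
      rw [← Finset.sum_neg_distrib, Finset.mul_sum, Finset.sum_mul]
      refine Finset.sum_congr rfl fun ν _ => ?_
      rw [← neg_one_pow_smul, ← neg_one_pow_smul, Jof_apply,
        show Int.negSucc b + ((i + 1 : ℕ) : ℤ) = (i : ℤ) - b by omega, ← smul_neg, ← smul_neg,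
        mul_comm (pd μ b (F a α))]
      simp only [smul_smul, smul_mul_assoc]
      rw [neg_mul, smul_neg, ← neg_smul]
      congr 1
      ring
  rw [infAct, map_add, e1, e2, nrm_apply, LV.sub_apply, map_sub, act_apply, Jof_nat]
  ring

end Ancestor

section OpenClosed

variable {N : ℕ} {A : Fin (N + 1) → ℂ} {η : Matrix (Fin N) (Fin N) ℂ}

/-! ### Power series that do not depend on the last group of variables -/

theorem incl_injective : Function.Injective (incl (N := N)) := rename_injective (closedVar N)

theorem closedVar_apply (j : Fin N × ℕ) : closedVar N j = (j.1.castSucc, j.2) := rfl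

theorem coeff_incl_embDomain (f : Ser N) (m : Fin N × ℕ →₀ ℕ) :
    coeff (Finsupp.embDomain (closedVar N) m) (incl f) = coeff m f :=
  coeff_embDomain_rename (closedVar N) f m

theorem coeff_incl_of_last (f : Ser N) {m : Fin (N + 1) × ℕ →₀ ℕ} {b : ℕ}
    (h : m (Fin.last N, b) ≠ 0) : coeff m (incl f) = 0 := by
  refine coeff_rename_eq_zero _ _ ?_
  rintro ⟨m', rfl⟩
  rw [← Finsupp.embDomain_eq_mapDomain, Finsupp.embDomain_of_notMem_range] at h
  · exact h rfl
  · rintro ⟨j, hj⟩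
    exact (Fin.castSucc_lt_last j.1).ne (congrArg Prod.fst hj)

theorem mem_range_or_last (m : Fin (N + 1) × ℕ →₀ ℕ) :
    (∃ m', m = Finsupp.embDomain (closedVar N) m') ∨ ∃ b, m (Fin.last N, b) ≠ 0 := by
  by_cases h : ∃ b, m (Fin.last N, b) ≠ 0
  · exact Or.inr h
  · push Not at h
    left
    have : m ∈ Set.range (Finsupp.embDomain (closedVar N) (M := ℕ)) := by
      rw [Finsupp.mem_range_embDomain_iff]
      intro j hj
      obtain ⟨α, b⟩ := j
      cases α using Fin.lastCases with
      | last => exact absurd (h b) (by simpa using hj)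
      | cast α => exact ⟨(α, b), rfl⟩
    obtain ⟨m', h'⟩ := this
    exact ⟨m', h'.symm⟩

theorem embDomain_add_single (m : Fin N × ℕ →₀ ℕ) (j : Fin N × ℕ) :
    Finsupp.embDomain (closedVar N) m + Finsupp.single (j.1.castSucc, j.2) 1 =
      Finsupp.embDomain (closedVar N) (m + Finsupp.single j 1) := by
  rw [Finsupp.embDomain_add, Finsupp.embDomain_single, closedVar_apply]

theorem pderiv_incl (j : Fin N × ℕ) (f : Ser N) :
    pderiv ℂ (j.1.castSucc, j.2) (incl f) = incl (pderiv ℂ j f) := by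
  ext m
  rcases mem_range_or_last m with ⟨m, rfl⟩ | ⟨b, hb⟩
  · rw [coeff_pderiv, embDomain_add_single, coeff_incl_embDomain, coeff_incl_embDomain,
      coeff_pderiv]
    congr 3
    exact Finsupp.embDomain_apply_self (closedVar N) m j
  · rw [coeff_pderiv, coeff_incl_of_last _ hb, coeff_incl_of_last (b := b), zero_mul]
    simp [hb]

theorem pderiv_last_incl (b : ℕ) (f : Ser N) : pderiv ℂ (Fin.last N, b) (incl f) = 0 := by
  ext m
  rw [coeff_pderiv, coeff_incl_of_last (b := b), zero_mul, map_zero]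
  simp

theorem exists_incl {f : Ser (N + 1)} (h : ∀ b, pderiv ℂ (Fin.last N, b) f = 0) :
    incl (killCompl (closedVar N) f) = f := by
  ext m
  rcases mem_range_or_last m with ⟨m, rfl⟩ | ⟨b, hb⟩
  · rw [coeff_incl_embDomain, coeff_killCompl]
  · rw [coeff_incl_of_last _ hb]
    have h1 : m = m - Finsupp.single (Fin.last N, b) 1 + Finsupp.single (Fin.last N, b) 1 :=
      (tsub_add_cancel_of_le (by simpa [Nat.one_le_iff_ne_zero] using hb)).symm
    rw [h1, eq_comm, ← coeff_pderiv_eq_zero_iff, h, map_zero]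

theorem incl_add (f g : Ser N) : incl (f + g) = incl f + incl g := map_add _ _ _

theorem incl_mul (f g : Ser N) : incl (f * g) = incl f * incl g := map_mul _ _ _

theorem incl_smul (c : ℂ) (f : Ser N) : incl (c • f) = c • incl f := map_smul _ _ _

theorem incl_neg (f : Ser N) : incl (-f) = -incl f := map_neg _ _

theorem incl_sum {ι : Type} (s : Finset ι) (f : ι → Ser N) :
    incl (∑ i ∈ s, f i) = ∑ i ∈ s, incl (f i) := map_sum _ _ _

theorem incl_q (α : Fin N) (b : ℕ) : incl (q (proj A) α b) = q A α.castSucc b := by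
  unfold q incl proj
  rw [map_sub, rename_X, rename_C]
  rfl

theorem incl_ext {F : VecSeq (N + 1)} {G : VecSeq N}
    (hG : ∀ (a : ℕ) (α : Fin N), F a α.castSucc = incl (G a α)) (a : ℤ) (α : Fin N) :
    F.ext A a α.castSucc = incl (G.ext (proj A) a α) := by
  cases a with
  | ofNat a => exact hG a α
  | negSucc n => rw [ext_negSucc, ext_negSucc, incl_smul, incl_q]

theorem formalSum_incl {f : ℕ → Ser N} {g : ℕ → Ser (N + 1)} (h : ∀ b, g b = incl (f b))
    {x : Ser N} (hx : formalSum g = incl x) : formalSum f = x := by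
  ext m
  rw [← coeff_incl_embDomain x m, ← hx]
  refine finsum_congr fun b => ?_
  rw [h, coeff_incl_embDomain]

theorem IsAncestor.isDescendant_closed {F : VecSeq (N + 1)} (h : IsAncestor A F) {G : VecSeq N}
    (hG : ∀ (a : ℕ) (α : Fin N), F a α.castSucc = incl (G a α)) : IsDescendant (proj A) G where
  string := fun α a => by
    refine formalSum_incl (g := fun b => ∑ β, q A β (b + 1) * pd β b (F.ext A a α.castSucc))
      (fun b => ?_) ?_
    · rw [Fin.sum_univ_castSucc, incl_ext hG]
      simp only [pd]
      rw [pderiv_last_incl, mul_zero, add_zero, incl_sum]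
      refine Finset.sum_congr rfl fun β _ => ?_
      rw [incl_mul, incl_q, ← pderiv_incl]
    · rw [h.descendant.string, incl_ext hG, incl_neg]
  dilaton := fun α a => by
    refine formalSum_incl (g := fun b => ∑ β, q A β b * pd β b (F.ext A a α.castSucc))
      (fun b => ?_) ?_
    · rw [Fin.sum_univ_castSucc, incl_ext hG]
      simp only [pd]
      rw [pderiv_last_incl, mul_zero, add_zero, incl_sum]
      refine Finset.sum_congr rfl fun β _ => ?_
      rw [incl_mul, incl_q, ← pderiv_incl]
    · rw [h.descendant.dilaton, incl_ext hG]
  trr := fun α β γ b c => by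
    have := h.descendant.trr α.castSucc β.castSucc γ.castSucc b c
    refine incl_injective ?_
    simp only [pd, hG, Fin.sum_univ_castSucc] at this ⊢
    rw [pderiv_incl (γ, c), pderiv_incl (β, b + 1), pderiv_last_incl, mul_zero, add_zero] at this
    rw [this, incl_sum]
    refine Finset.sum_congr rfl fun μ _ => ?_
    rw [incl_mul, ← pderiv_incl (β, b), ← pderiv_incl (μ, 0)]
  shift := fun α β a b => by
    have := h.descendant.shift α.castSucc β.castSucc a b
    refine incl_injective ?_
    simp only [pd, hG, Fin.sum_univ_castSucc] at this ⊢
    rw [pderiv_last_incl, zero_mul, add_zero, pderiv_incl (β, b), pderiv_incl (β, b + 1)] at this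
    rw [incl_add, this, incl_sum]
    refine Finset.sum_congr rfl fun μ _ => ?_
    rw [incl_mul, ← pderiv_incl, ← pderiv_incl]

/-! ### Open-closed type -/

/-- The sequence `F` is of open-closed type, in terms of all variables. -/
structure IsOpenClosed (η : Matrix (Fin N) (Fin N) ℂ) (F : VecSeq (N + 1)) : Prop where
  indep : ∀ (b a : ℕ) (α : Fin N), pderiv ℂ (Fin.last N, b) (F a α.castSucc) = 0
  closed : ∀ (α β : Fin N) (a b : ℕ),
    ∑ μ, η α μ • pderiv ℂ (β.castSucc, b) (F a μ.castSucc) =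
      ∑ μ, η β μ • pderiv ℂ (α.castSucc, a) (F b μ.castSucc)

/-- The closed sector of a sequence of open-closed type. -/
def closedSector (F : VecSeq (N + 1)) : VecSeq N :=
  fun a α => killCompl (closedVar N) (F a α.castSucc)

theorem IsOpenClosed.incl_closedSector {F : VecSeq (N + 1)} (h : IsOpenClosed η F) (a : ℕ)
    (α : Fin N) : F a α.castSucc = incl (closedSector F a α) :=
  (exists_incl fun b => h.indep b a α).symm

theorem closedSector_eq {F : VecSeq (N + 1)} {G : VecSeq N}
    (hG : ∀ (a : ℕ) (α : Fin N), F a α.castSucc = incl (G a α)) : closedSector F = G :=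
  funext fun a => funext fun α => by
    rw [closedSector, hG]
    exact killCompl_rename_app _

theorem isClosedType_iff {F : VecSeq (N + 1)} {G : VecSeq N}
    (hG : ∀ (a : ℕ) (α : Fin N), F a α.castSucc = incl (G a α)) :
    IsClosedType η G ↔ ∀ (α β : Fin N) (a b : ℕ),
      ∑ μ, η α μ • pderiv ℂ (β.castSucc, b) (F a μ.castSucc) =
        ∑ μ, η β μ • pderiv ℂ (α.castSucc, a) (F b μ.castSucc) := by
  refine forall_congr' fun α => forall_congr' fun β => forall_congr' fun a =>
    forall_congr' fun b => ?_
  rw [← incl_injective.eq_iff]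
  simp only [pd, map_sum, incl_sum, hG, pderiv_incl (α, a), pderiv_incl (β, b),
    Derivation.map_smul, incl_smul]

/-- The descendant equations of the closed sector need no separate statement: they are the closed
components of the equations for `F`, in which the derivatives in the last variables drop out. -/
theorem hasPotentials_iff {F : VecSeq (N + 1)} {Fc : Ser N} {Fo : Ser (N + 1)} :
    HasPotentials η A F Fc Fo ↔ IsAncestor A F ∧ IsOpenClosed η F ∧
      Fc = closedPotential η (proj A) (closedSector F) ∧ Fo = F 0 (Fin.last N) := by
  constructor
  · rintro ⟨h1, ⟨G, hG, -, h3, rfl⟩, rfl⟩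
    refine ⟨h1, ⟨fun b a α => ?_, (isClosedType_iff hG).1 h3⟩, ?_, rfl⟩
    · rw [hG, pderiv_last_incl]
    · rw [closedSector_eq hG]
  · rintro ⟨h1, h2, rfl, rfl⟩
    exact ⟨h1, ⟨_, h2.incl_closedSector, h1.isDescendant_closed h2.incl_closedSector,
      (isClosedType_iff h2.incl_closedSector).2 h2.closed, rfl⟩, rfl⟩

/-- Differentiating `q` in the defining sum gives the right-hand side once. Differentiating the
potentials gives it a second time, by closedness followed by the dilaton equation; the factor one
half compensates. -/
theorem pd_closedPotential {B : Fin N → ℂ} {G : VecSeq N} (h : IsDescendant B G)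
    (hc : IsClosedType η G) (β : Fin N) (b : ℕ) :
    pd β b (closedPotential η B G) = ∑ μ, η β μ • G b μ := by
  classical
  have hq : ∀ (α : Fin N) (a : ℕ), pd β b (q B α a) = if (a, α) = (b, β) then 1 else 0 :=
    fun α a => by
      rw [q, pd, map_sub, pderiv_C, sub_zero, pderiv_X, Pi.single_apply]
      simp only [Prod.mk.injEq, and_comm]
  set H : Ser N := ∑ μ, η β μ • G b μ with hH
  have h1 : ∀ a, pd β b (∑ α, ∑ μ, η α μ • (q B α a * G a μ)) =
      (if a = b then H else 0) + ∑ α, q B α a * pd α a H := fun a => by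
    have e : ∀ α, ∑ μ, η α μ • (q B α a * G a μ) = q B α a * ∑ μ, η α μ • G a μ := fun α => by
      rw [Finset.mul_sum]
      exact Finset.sum_congr rfl fun μ _ => (mul_smul_comm _ _ _).symm
    simp only [e]
    rw [pd, map_sum]
    have e2 : ∀ α, pderiv ℂ (β, b) (q B α a * ∑ μ, η α μ • G a μ) =
        (if (a, α) = (b, β) then H else 0) + q B α a * pd α a H := fun α => by
      rw [(pderiv ℂ (β, b)).leibniz, smul_eq_mul, smul_eq_mul,
        show pderiv ℂ (β, b) (∑ μ, η α μ • G a μ) = _ from hc α β a b,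
        show pderiv ℂ (β, b) (q B α a) = _ from hq α a, add_comm]
      split_ifs with h
      · obtain ⟨rfl, rfl⟩ := Prod.mk.inj h
        rw [mul_one]
      · rw [mul_zero]
    simp only [e2, Finset.sum_add_distrib]
    congr 1
    by_cases hab : a = b <;> simp [hab]
  have h2 : formalSum (fun a : ℕ => ∑ α, q B α a * pd α a H) = H := by
    have h3 : ∀ α, dir (Jof B G) (G b α) = G b α := fun α => by
      have := congrArg (fun w : LV N ℂ => w b α) (dilaton_iff.2 h.dilaton)
      rw [nrm_apply, LV.sub_apply, act_apply, LV.zero_apply, sub_eq_zero, Jof_nat] at this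
      exact this.symm
    have h4 : dir (Jof B G) H = H := by
      rw [hH, map_sum]
      exact Finset.sum_congr rfl fun μ _ => by rw [vf_smul, h3]
    conv_rhs => rw [← h4]
    rw [dir_apply]
    unfold dirFun formalSum
    simp only [isGraph_Jof _, q]
    rfl
  have h5 : pd β b (formalSum fun a : ℕ => ∑ α, ∑ μ, η α μ • (q B α a * G a μ)) = H + H := by
    ext m
    rw [pd, coeff_pderiv]
    have e1 : coeff (m + Finsupp.single (β, b) 1)
        (formalSum fun a : ℕ => ∑ α, ∑ μ, η α μ • (q B α a * G a μ)) * ((m (β, b) : ℂ) + 1) =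
        ∑ᶠ a : ℕ, (coeff m (if a = b then H else 0) + coeff m (∑ α, q B α a * pd α a H)) := by
      have : ∀ a, coeff m (if a = b then H else 0) + coeff m (∑ α, q B α a * pd α a H) =
          coeff (m + Finsupp.single (β, b) 1) (∑ α, ∑ μ, η α μ • (q B α a * G a μ)) *
            ((m (β, b) : ℂ) + 1) := fun a => by
        rw [← map_add, ← h1, pd, coeff_pderiv]
      simp only [this]
      exact finsum_mul _ _
    rw [e1, finsum_add_distrib, map_add]
    · congr 1
      · rw [finsum_eq_single _ b fun a ha => by rw [if_neg ha, map_zero], if_pos rfl]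
      · exact congrArg (coeff m) h2
    · refine (Set.finite_singleton b).subset fun a ha => ?_
      by_contra hab
      exact ha (by simp [show a ≠ b from hab])
    · obtain ⟨B₀, hB⟩ := dirFun_bound (Jof B G) m
      refine (Set.finite_lt_nat B₀).subset fun a ha => ?_
      by_contra hab
      refine ha ?_
      rw [← hB H a (by simpa using hab)]
      simp only [isGraph_Jof _, q]
  rw [closedPotential, pd, Derivation.map_smul, show pderiv ℂ (β, b) _ = _ from h5, smul_add, ← add_smul]
  norm_num

theorem HasPotentials.pderiv_closed {F : VecSeq (N + 1)} {Fc : Ser N} {Fo : Ser (N + 1)}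
    (h : HasPotentials η A F Fc Fo) (β : Fin N) (b : ℕ) :
    pderiv ℂ (β.castSucc, b) (incl Fc) = ∑ μ, η β μ • F b μ.castSucc := by
  obtain ⟨-, ⟨G, hG, h2, h3, rfl⟩, -⟩ := h
  rw [pderiv_incl (β, b), show pderiv ℂ (β, b) _ = _ from pd_closedPotential h2 h3 β b, incl_sum]
  exact Finset.sum_congr rfl fun μ _ => by rw [incl_smul, hG]

theorem HasPotentials.apply_castSucc (hη : IsUnit η.det) {F : VecSeq (N + 1)} {Fc : Ser N}
    {Fo : Ser (N + 1)} (h : HasPotentials η A F Fc Fo) (b : ℕ) (α : Fin N) :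
    F b α.castSucc = ∑ μ, η⁻¹ α μ • pderiv ℂ (μ.castSucc, b) (incl Fc) := by
  simp only [h.pderiv_closed, Finset.smul_sum, smul_smul]
  rw [Finset.sum_comm]
  simp only [← Finset.sum_smul, ← Matrix.mul_apply, Matrix.nonsing_inv_mul η hη]
  simp [Matrix.one_apply]

theorem HasPotentials.structConst_eq (hη : IsUnit η.det) {F : VecSeq (N + 1)} {Fc : Ser N}
    {Fo : Ser (N + 1)} (h : HasPotentials η A F Fc Fo) (α β γ : Fin (N + 1)) :
    structConst η Fc Fo α β γ = constantCoeff (pd β 0 (pd γ 0 (F 0 α))) := by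
  cases α using Fin.lastCases with
  | last => rw [structConst, Fin.lastCases_last, h.2.2]
  | cast α =>
    rw [structConst, Fin.lastCases_castSucc, h.apply_castSucc hη]
    simp only [pd, map_sum, Derivation.map_smul]
    refine Finset.sum_congr rfl fun μ _ => ?_
    rw [pderiv_pderiv_comm (γ, 0) _ (incl Fc), pderiv_pderiv_comm (β, 0) (μ.castSucc, 0),
      ← coeff_zero_eq_constantCoeff_apply, ← coeff_zero_eq_constantCoeff_apply, map_smul,
      smul_eq_mul]

/-- The pair determines `F 0` through the inverse metric. The shift relation then gives all first
derivatives of `F (a + 1)` from `F a` and `F 0`, and the constant terms vanish for ancestor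
sequences. -/
theorem HasPotentials.unique (hη : IsUnit η.det) {F F' : VecSeq (N + 1)} {Fc : Ser N}
    {Fo : Ser (N + 1)} (h : HasPotentials η A F Fc Fo) (h' : HasPotentials η A F' Fc Fo) :
    F = F' := by
  have hcc : ∀ {F : VecSeq (N + 1)}, IsAncestor A F → ∀ a α, constantCoeff (F a α) = 0 :=
    fun h => constantCoeff_of_dilaton (dilaton_iff.2 h.descendant.dilaton) h.vanishing
  have h0 : F 0 = F' 0 := by
    funext α
    cases α using Fin.lastCases with
    | last => rw [← h.2.2, ← h'.2.2]
    | cast α => rw [h.apply_castSucc hη, h'.apply_castSucc hη]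
  funext a
  induction a with
  | zero => exact h0
  | succ a ih =>
    funext α
    refine pderiv.ext (fun j => ?_) (by rw [hcc h.1, hcc h'.1])
    rw [eq_sub_of_add_eq (show pderiv ℂ j (F (a + 1) α) + _ = _ from
      h.1.descendant.shift α j.1 a j.2), eq_sub_of_add_eq (show pderiv ℂ j (F' (a + 1) α) + _ = _
        from h'.1.descendant.shift α j.1 a j.2), h0, ih]

end OpenClosed

/-! ### Exponential and logarithm of loops -/

section LoopAlgebra

variable {L : ℕ} {K : Type} [CommRing K]

/-- A derivation over `ℤ` from an additive map that satisfies the Leibniz rule. -/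
def mkDer (f : K →+ K) (h : ∀ x y, f (x * y) = x * f y + y * f x) : Derivation ℤ K K :=
  Derivation.mk' f.toIntLinearMap h

/-- The derivations of a ring, over the integers. -/
abbrev Der (K : Type) [CommRing K] : Type := Derivation ℤ K K

/-- The derivative of polynomials. -/
def polyDer (R : Type) [CommRing R] : Der (Polynomial R) :=
  mkDer (Polynomial.derivative : Polynomial R →ₗ[R] Polynomial R).toAddMonoidHom fun x y => by
    change Polynomial.derivative (x * y) = _
    rw [Polynomial.derivative_mul]
    change _ = x * Polynomial.derivative y + y * Polynomial.derivative x
    ring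

theorem polyDer_apply {R : Type} [CommRing R] (p : Polynomial R) :
    polyDer R p = Polynomial.derivative p := rfl

/-! ### Power series with matrix coefficients -/

/-- The coefficient of `z^i`, over any ring of coefficients. -/
def lc (M : Matrix (Fin L) (Fin L) K⟦X⟧) (i : ℕ) : Matrix (Fin L) (Fin L) K :=
  M.map (PowerSeries.coeff i)

/-- The matrix of power series with given coefficients. -/
def mkL (f : ℕ → Matrix (Fin L) (Fin L) K) : Matrix (Fin L) (Fin L) K⟦X⟧ :=
  Matrix.of fun α β => PowerSeries.mk fun i => f i α β

theorem lc_mkL (f : ℕ → Matrix (Fin L) (Fin L) K) (i : ℕ) : lc (mkL f) i = f i := by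
  ext α β
  simp [lc, mkL]

theorem lc_ext {M M' : Matrix (Fin L) (Fin L) K⟦X⟧} (h : ∀ i, lc M i = lc M' i) : M = M' := by
  ext α β i
  exact congrFun (congrFun (h i) α) β

theorem lc_mul (M M' : Matrix (Fin L) (Fin L) K⟦X⟧) (i : ℕ) : lc (M * M') i =
    ∑ p ∈ Finset.HasAntidiagonal.antidiagonal i, lc M p.1 * lc M' p.2 := by
  ext α β
  simp only [lc, Matrix.map_apply, Matrix.mul_apply, map_sum, PowerSeries.coeff_mul,
    Matrix.sum_apply]
  exact Finset.sum_comm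

theorem lc_add (M M' : Matrix (Fin L) (Fin L) K⟦X⟧) (i : ℕ) : lc (M + M') i = lc M i + lc M' i := by
  ext; simp [lc]

theorem lc_sub (M M' : Matrix (Fin L) (Fin L) K⟦X⟧) (i : ℕ) : lc (M - M') i = lc M i - lc M' i := by
  ext; simp [lc]

theorem lc_neg (M : Matrix (Fin L) (Fin L) K⟦X⟧) (i : ℕ) : lc (-M) i = -lc M i := by
  ext; simp [lc]

theorem lc_zero (i : ℕ) : lc (0 : Matrix (Fin L) (Fin L) K⟦X⟧) i = 0 := by
  ext; simp [lc]

theorem lc_smul (c : K) (M : Matrix (Fin L) (Fin L) K⟦X⟧) (i : ℕ) : lc (c • M) i = c • lc M i := by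
  ext; simp [lc]

theorem lc_one (i : ℕ) : lc (1 : Matrix (Fin L) (Fin L) K⟦X⟧) i = if i = 0 then 1 else 0 := by
  ext α β
  by_cases h : α = β <;> by_cases hi : i = 0 <;>
    simp [lc, Matrix.one_apply, PowerSeries.coeff_one, h, hi]

theorem isUnit_of_lc_zero {M : Matrix (Fin L) (Fin L) K⟦X⟧} (h : lc M 0 = 1) : IsUnit M := by
  rw [Matrix.isUnit_iff_isUnit_det, PowerSeries.isUnit_iff_constantCoeff]
  have : PowerSeries.constantCoeff M.det = (lc M 0).det := by
    rw [RingHom.map_det]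
    congr 1
    ext α β
    simp [lc]
  rw [this, h, Matrix.det_one]
  exact isUnit_one

/-- The coefficients of `z^i` vanish for `i < n`. -/
def Ord (n : ℕ) (M : Matrix (Fin L) (Fin L) K⟦X⟧) : Prop := ∀ i < n, lc M i = 0

theorem Ord.mul {a b : ℕ} {M M' : Matrix (Fin L) (Fin L) K⟦X⟧} (h : Ord a M) (h' : Ord b M') :
    Ord (a + b) (M * M') := fun i hi => by
  rw [lc_mul]
  refine Finset.sum_eq_zero fun p hp => ?_
  have := Finset.HasAntidiagonal.mem_antidiagonal.1 hp
  by_cases h1 : p.1 < a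
  · rw [h _ h1, zero_mul]
  · rw [h' _ (by omega), mul_zero]

theorem Ord.pow {M : Matrix (Fin L) (Fin L) K⟦X⟧} (h : Ord 1 M) (k : ℕ) : Ord k (M ^ k) := by
  induction k with
  | zero => exact fun i hi => absurd hi (by omega)
  | succ k ih => rw [pow_succ]; exact ih.mul h

theorem Ord.mono {a b : ℕ} {M : Matrix (Fin L) (Fin L) K⟦X⟧} (h : Ord b M) (hab : a ≤ b) :
    Ord a M := fun i hi => h i (by omega)

theorem Ord.add {a : ℕ} {M M' : Matrix (Fin L) (Fin L) K⟦X⟧} (h : Ord a M) (h' : Ord a M') :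
    Ord a (M + M') := fun i hi => by rw [lc_add, h i hi, h' i hi, add_zero]

theorem ord_one_iff {M : Matrix (Fin L) (Fin L) K⟦X⟧} : Ord 1 M ↔ lc M 0 = 0 :=
  ⟨fun h => h 0 one_pos, fun h i hi => by rwa [Nat.lt_one_iff.1 hi]⟩

theorem Ord.eq {M M' : Matrix (Fin L) (Fin L) K⟦X⟧} (h : ∀ n, Ord n (M - M')) : M = M' :=
  lc_ext fun i => by
    have := h (i + 1) i (Nat.lt_succ_self i)
    rwa [lc_sub, sub_eq_zero] at this

theorem Ord.pow_sub {M M' : Matrix (Fin L) (Fin L) K⟦X⟧} (h : Ord 1 M) (h' : Ord 1 M') {n : ℕ}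
    (hn : Ord n (M - M')) (k : ℕ) : Ord (n + k) (M ^ (k + 1) - M' ^ (k + 1)) := by
  induction k with
  | zero => simpa using hn
  | succ k ih =>
    have e : M ^ (k + 1 + 1) - M' ^ (k + 1 + 1) = M ^ (k + 1) * (M - M') +
        (M ^ (k + 1) - M' ^ (k + 1)) * M' := by
      rw [pow_succ, pow_succ M']
      noncomm_ring
    rw [e]
    exact (((h.pow (k + 1)).mul hn).mono (by omega)).add ((ih.mul h').mono (by omega))

/-- Coefficientwise application of a derivation. -/
def derL (D : Derivation ℤ K K) (M : Matrix (Fin L) (Fin L) K⟦X⟧) : Matrix (Fin L) (Fin L) K⟦X⟧ :=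
  mkL fun i => (lc M i).map D

variable (D : Derivation ℤ K K)

theorem lc_derL (M : Matrix (Fin L) (Fin L) K⟦X⟧) (i : ℕ) : lc (derL D M) i = (lc M i).map D :=
  lc_mkL _ _

theorem derL_add (M M' : Matrix (Fin L) (Fin L) K⟦X⟧) : derL D (M + M') = derL D M + derL D M' :=
  lc_ext fun i => by ext; simp [lc_derL, lc_add]

theorem derL_sub (M M' : Matrix (Fin L) (Fin L) K⟦X⟧) : derL D (M - M') = derL D M - derL D M' :=
  lc_ext fun i => by ext; simp [lc_derL, lc_sub]

theorem derL_smul (c : K) (M : Matrix (Fin L) (Fin L) K⟦X⟧) :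
    derL D (c • M) = D c • M + c • derL D M :=
  lc_ext fun i => by
    ext
    simp [lc_derL, lc_add, lc_smul]
    ring

theorem derL_mul (M M' : Matrix (Fin L) (Fin L) K⟦X⟧) :
    derL D (M * M') = derL D M * M' + M * derL D M' :=
  lc_ext fun i => by
    ext α β
    simp only [lc_derL, lc_add, lc_mul, Matrix.map_apply, Matrix.add_apply, Matrix.sum_apply,
      Matrix.mul_apply, map_sum, Derivation.leibniz, smul_eq_mul, ← Finset.sum_add_distrib]
    refine Finset.sum_congr rfl fun p _ => Finset.sum_congr rfl fun j _ => ?_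
    ring

theorem derL_one : derL D (1 : Matrix (Fin L) (Fin L) K⟦X⟧) = 0 :=
  lc_ext fun i => by
    ext α β
    rw [lc_derL, lc_one, lc_zero, Matrix.map_apply]
    by_cases h : α = β <;> by_cases hi : i = 0 <;> simp [Matrix.one_apply, h, hi]

/-! ### Exponentials -/

section Exp

variable [Algebra ℂ K]

/-- The exponential of `x M(z)` for `M(0) = 0`. -/
def expL (x : K) (M : Matrix (Fin L) (Fin L) K⟦X⟧) : Matrix (Fin L) (Fin L) K⟦X⟧ :=
  mkL fun n => ∑ k ∈ Finset.range (n + 1),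
    (algebraMap ℂ K (k.factorial : ℂ)⁻¹ * x ^ k) • lc (M ^ k) n

theorem lc_expL (x : K) {M : Matrix (Fin L) (Fin L) K⟦X⟧} (hM : Ord 1 M) {n B : ℕ} (h : n < B) :
    lc (expL x M) n = ∑ k ∈ Finset.range B,
      (algebraMap ℂ K (k.factorial : ℂ)⁻¹ * x ^ k) • lc (M ^ k) n := by
  rw [expL, lc_mkL]
  refine Finset.sum_subset (fun k hk => ?_) fun k _ hk => ?_
  · simp only [Finset.mem_range] at hk ⊢
    omega
  · rw [hM.pow k n (by simpa using hk), smul_zero]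

theorem exp_eq_expL (r : Loop L) : r.exp = expL (1 : ℂ) r :=
  lc_ext fun n => by
    ext α β
    rw [expL, lc_mkL]
    simp [Loop.exp, lc, Matrix.sum_apply]

theorem lc_mul_expL (x : K) {M : Matrix (Fin L) (Fin L) K⟦X⟧} (hM : Ord 1 M)
    (P : Matrix (Fin L) (Fin L) K⟦X⟧) (n : ℕ) : lc (P * expL x M) n = ∑ k ∈ Finset.range (n + 1),
      (algebraMap ℂ K (k.factorial : ℂ)⁻¹ * x ^ k) • lc (P * M ^ k) n := by
  simp only [lc_mul, Finset.smul_sum]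
  rw [Finset.sum_comm]
  refine Finset.sum_congr rfl fun p hp => ?_
  have := Finset.HasAntidiagonal.mem_antidiagonal.1 hp
  rw [lc_expL x hM (B := n + 1) (by omega), Finset.mul_sum]
  exact Finset.sum_congr rfl fun k _ => Matrix.mul_smul _ _ _

theorem lc_expL_mul (x : K) {M : Matrix (Fin L) (Fin L) K⟦X⟧} (hM : Ord 1 M)
    (P : Matrix (Fin L) (Fin L) K⟦X⟧) (n : ℕ) : lc (expL x M * P) n = ∑ k ∈ Finset.range (n + 1),
      (algebraMap ℂ K (k.factorial : ℂ)⁻¹ * x ^ k) • lc (M ^ k * P) n := by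
  simp only [lc_mul, Finset.smul_sum]
  rw [Finset.sum_comm]
  refine Finset.sum_congr rfl fun p hp => ?_
  have := Finset.HasAntidiagonal.mem_antidiagonal.1 hp
  rw [lc_expL x hM (B := n + 1) (by omega), Finset.sum_mul]
  exact Finset.sum_congr rfl fun k _ => Matrix.smul_mul _ _ _

theorem expL_commute (x : K) {M : Matrix (Fin L) (Fin L) K⟦X⟧} (hM : Ord 1 M) :
    M * expL x M = expL x M * M :=
  lc_ext fun n => by
    rw [lc_mul_expL x hM, lc_expL_mul x hM]
    exact Finset.sum_congr rfl fun k _ => by rw [← pow_succ, ← pow_succ']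

theorem lc_expL_zero (x : K) (M : Matrix (Fin L) (Fin L) K⟦X⟧) : lc (expL x M) 0 = 1 := by
  rw [expL, lc_mkL]
  simp [lc_one]

theorem expL_zero (M : Matrix (Fin L) (Fin L) K⟦X⟧) : expL 0 M = 1 :=
  lc_ext fun n => by
    rw [expL, lc_mkL, Finset.sum_range_succ']
    simp

theorem expL_neg (x : K) (M : Matrix (Fin L) (Fin L) K⟦X⟧) : expL x (-M) = expL (-x) M :=
  lc_ext fun n => by
    rw [expL, expL, lc_mkL, lc_mkL]
    refine Finset.sum_congr rfl fun k _ => ?_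
    rw [neg_pow x, neg_pow M]
    rcases neg_one_pow_eq_or K k with h | h <;>
    rcases Nat.even_or_odd k with h' | h' <;> simp [h'.neg_one_pow, lc_neg]

theorem derL_expL (hD : ∀ c : ℂ, D (algebraMap ℂ K c) = 0) (x : K)
    {M : Matrix (Fin L) (Fin L) K⟦X⟧} (hM : Ord 1 M) (hDM : derL D M = 0) :
    derL D (expL x M) = D x • (M * expL x M) := by
  have hpow : ∀ k, derL D (M ^ k) = 0 := fun k => by
    induction k with
    | zero => rw [pow_zero, derL_one]
    | succ k ih => rw [pow_succ, derL_mul, ih, hDM, zero_mul, mul_zero, add_zero]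
  refine lc_ext fun n => ?_
  rw [lc_derL, lc_expL x hM (B := n + 2) (by omega), lc_smul, lc_mul_expL x hM, Finset.smul_sum]
  have h1 : ∀ (k : ℕ) α β, D (lc (M ^ k) n α β) = 0 := fun k α β => by
    have := lc_derL D (M ^ k) n
    rw [hpow, lc_zero] at this
    exact (congrFun (congrFun this α) β).symm
  ext α β
  have h0 : D (lc (1 : Matrix (Fin L) (Fin L) K⟦X⟧) n α β) = 0 := by
    rw [← h1 0 α β, pow_zero]
  rw [Matrix.map_apply, Finset.sum_range_succ' (n := n + 1)]
  simp only [Matrix.add_apply, Matrix.sum_apply, Matrix.smul_apply, smul_eq_mul, map_add, map_sum,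
    Derivation.leibniz, h1, h0, hD, pow_zero, Derivation.map_one_eq_zero, mul_zero, add_zero,
    Derivation.leibniz_pow, zero_add]
  refine Finset.sum_congr rfl fun k _ => ?_
  have h2 : algebraMap ℂ K (k.factorial : ℂ)⁻¹ =
      algebraMap ℂ K ((k + 1).factorial : ℂ)⁻¹ * ((k + 1 : ℕ) : K) := by
    rw [← map_natCast (algebraMap ℂ K), ← map_mul, Nat.factorial_succ]
    congr 1
    have h3 : ((k + 1 : ℕ) : ℂ) ≠ 0 := Nat.cast_ne_zero.2 k.succ_ne_zero
    have h4 : (k.factorial : ℂ) ≠ 0 := Nat.cast_ne_zero.2 k.factorial_ne_zero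
    push_cast at h3 ⊢
    field_simp
  rw [h2, Nat.add_sub_cancel, pow_succ' M]
  simp only [nsmul_eq_mul]
  ring

end Exp

/-- Change of the coefficients. -/
def mapL {K' : Type} [CommRing K'] (φ : K →+* K') :
    Matrix (Fin L) (Fin L) K⟦X⟧ →+* Matrix (Fin L) (Fin L) K'⟦X⟧ :=
  (PowerSeries.map φ).mapMatrix

theorem lc_mapL {K' : Type} [CommRing K'] (φ : K →+* K') (M : Matrix (Fin L) (Fin L) K⟦X⟧) (i : ℕ) :
    lc (mapL φ M) i = (lc M i).map φ := by
  ext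
  simp [lc, mapL]

theorem mapL_smul {K' : Type} [CommRing K'] (φ : K →+* K') (c : K)
    (M : Matrix (Fin L) (Fin L) K⟦X⟧) : mapL φ (c • M) = φ c • mapL φ M :=
  lc_ext fun i => by
    ext
    simp [lc_mapL, lc_smul]

theorem Ord.mapL {n : ℕ} {K' : Type} [CommRing K'] {M : Matrix (Fin L) (Fin L) K⟦X⟧} (h : Ord n M)
    (φ : K →+* K') : Ord n (mapL φ M) := fun i hi => by
  rw [lc_mapL, h i hi]
  ext
  simp

section Exp

variable [Algebra ℂ K]

theorem mapL_expL {K' : Type} [CommRing K'] [Algebra ℂ K'] (φ : K →+* K')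
    (hφ : ∀ c, φ (algebraMap ℂ K c) = algebraMap ℂ K' c) (x : K)
    (M : Matrix (Fin L) (Fin L) K⟦X⟧) : mapL φ (expL x M) = expL (φ x) (mapL φ M) :=
  lc_ext fun i => by
    ext α β
    simp [lc_mapL, expL, lc_mkL, Matrix.sum_apply, hφ, ← map_pow]

theorem derL_mapL_algebraMap (hD : ∀ c : ℂ, D (algebraMap ℂ K c) = 0)
    (M : Matrix (Fin L) (Fin L) ℂ⟦X⟧) : derL D (mapL (algebraMap ℂ K) M) = 0 :=
  lc_ext fun i => by
    ext α β
    simp [lc_derL, lc_mapL, hD, lc_zero]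

end Exp

end LoopAlgebra

section Logarithm

variable {L : ℕ}

/-- Over `ℂ[x]` the product `exp (x r) exp (-x r)` has zero derivative in `x`, so its values at `x =
1` and `x = 0` agree. -/
theorem exp_mul_exp_neg {r : Loop L} (hr : Ord 1 r) : r.exp * (-r).exp = 1 := by
  let D := polyDer ℂ
  have hDX : D Polynomial.X = 1 := Polynomial.derivative_X
  have hDC : ∀ c : ℂ, D (algebraMap ℂ _ c) = 0 := fun c => Polynomial.derivative_C
  set M := mapL (algebraMap ℂ (Polynomial ℂ)) r with hM
  have hM1 : Ord 1 M := hr.mapL _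
  set Z := expL Polynomial.X M * expL (-Polynomial.X) M with hZ
  have h1 : derL D Z = 0 := by
    rw [hZ, derL_mul, derL_expL D hDC _ hM1 (derL_mapL_algebraMap D hDC r),
      derL_expL D hDC _ hM1 (derL_mapL_algebraMap D hDC r), map_neg, hDX, expL_commute _ hM1,
      one_smul, neg_smul, one_smul, mul_neg, mul_assoc, add_neg_cancel]
  have hev : ∀ (c : ℂ) (x : Polynomial ℂ), mapL (Polynomial.evalRingHom c) (expL x M) =
      expL (x.eval c) r := fun c x => by
    rw [mapL_expL _ (fun c => by simp)]
    congr 1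
    exact lc_ext fun i => by ext; simp [hM, lc_mapL]
  have h2 : ∀ c : ℂ, mapL (Polynomial.evalRingHom c) Z = mapL (Polynomial.evalRingHom 0) Z :=
    fun c => lc_ext fun i => by
      ext α β
      have h3 : D (lc Z i α β) = 0 := by
        have := lc_derL D Z i
        rw [h1, lc_zero] at this
        exact (congrFun (congrFun this α) β).symm
      have h4 := Polynomial.derivative_eq_zero.1 h3
      rw [Polynomial.natDegree_eq_zero] at h4
      obtain ⟨y, hy⟩ := h4
      rw [lc_mapL, lc_mapL, Matrix.map_apply, Matrix.map_apply, ← hy]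
      simp
  have h3 := h2 1
  rw [hZ, map_mul, map_mul, hev, hev, hev, hev] at h3
  simpa [expL_zero, exp_eq_expL, expL_neg] using h3

/-- The quadratic and higher terms of the exponential gain an order on differences. To leading order
`exp` is therefore the identity, which gives both injectivity and the construction of logarithms. -/
theorem exp_congr {r r' : Loop L} (h : Ord 1 r) (h' : Ord 1 r') {n : ℕ} (hn : Ord n (r - r')) :
    Ord (n + 1) (r.exp - r'.exp - (r - r')) := by
  intro i hi
  rw [exp_eq_expL, exp_eq_expL, lc_sub, lc_sub, lc_expL _ h (B := i + 2) (by omega),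
    lc_expL _ h' (B := i + 2) (by omega), ← Finset.sum_sub_distrib, Finset.sum_range_succ',
    Finset.sum_range_succ', Finset.sum_eq_zero]
  · simp [lc_sub]
  · intro k _
    rw [← smul_sub, ← lc_sub, (h.pow_sub h' hn (k + 1)) i (by omega), smul_zero]

theorem exp_injective {r r' : Loop L} (h : Ord 1 r) (h' : Ord 1 r') (he : r.exp = r'.exp) :
    r = r' :=
  Ord.eq fun n => by
    induction n with
    | zero => exact fun i hi => absurd hi (by omega)
    | succ n ih =>
      have := exp_congr h h' ih
      rw [he, sub_self, zero_sub] at this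
      intro i hi
      have := this i hi
      rwa [lc_neg, neg_eq_zero] at this

/-- The truncations of a power series that is built order by order. -/
def approxL (step : ℕ → Loop L → Matrix (Fin L) (Fin L) ℂ) : ℕ → Loop L
  | 0 => 0
  | n + 1 => approxL step n + mkL fun i => if i = n + 1 then step n (approxL step n) else 0

/-- A power series that is built order by order. -/
def limL (step : ℕ → Loop L → Matrix (Fin L) (Fin L) ℂ) : Loop L :=
  mkL fun i => lc (approxL step i) i

theorem lc_approxL_of_lt (step : ℕ → Loop L → Matrix (Fin L) (Fin L) ℂ) {n i : ℕ} (h : n < i) :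
    lc (approxL step n) i = 0 := by
  induction n with
  | zero => rw [approxL, lc_zero]
  | succ n ih => rw [approxL, lc_add, ih (by omega), lc_mkL, if_neg (by omega), add_zero]

theorem lc_approxL_of_le (step : ℕ → Loop L → Matrix (Fin L) (Fin L) ℂ) {n i : ℕ} (h : i ≤ n) :
    lc (approxL step n) i = lc (limL step) i := by
  induction n, h using Nat.le_induction with
  | base => rw [limL, lc_mkL]
  | succ n hn ih => rw [approxL, lc_add, ih, lc_mkL, if_neg (by omega), add_zero]

theorem lc_limL_zero (step : ℕ → Loop L → Matrix (Fin L) (Fin L) ℂ) : lc (limL step) 0 = 0 := by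
  rw [limL, lc_mkL, approxL, lc_zero]

theorem lc_limL_succ (step : ℕ → Loop L → Matrix (Fin L) (Fin L) ℂ) (n : ℕ) :
    lc (limL step) (n + 1) = step n (approxL step n) := by
  rw [limL, lc_mkL, approxL, lc_add, lc_approxL_of_lt step (Nat.lt_succ_self n), lc_mkL, if_pos rfl,
    zero_add]

theorem ord_limL_sub (step : ℕ → Loop L → Matrix (Fin L) (Fin L) ℂ) (n : ℕ) :
    Ord (n + 1) (limL step - approxL step n) := fun i hi => by
  rw [lc_sub, lc_approxL_of_le step (by omega), sub_self]

/-- The next coefficient of the logarithm is the discrepancy of the exponential of the current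
truncation. By `exp_congr` adding it corrects exactly this order. -/
theorem exists_log {R : Loop L} (hR : R.coeff 0 = 1) : ∃ r : Loop L, r.coeff 0 = 0 ∧ r.exp = R := by
  let step : ℕ → Loop L → Matrix (Fin L) (Fin L) ℂ := fun n f => lc R (n + 1) - lc f.exp (n + 1)
  refine ⟨limL step, lc_limL_zero step, lc_ext fun n => ?_⟩
  have h1 : Ord 1 (limL step) := ord_one_iff.2 (lc_limL_zero step)
  have h2 : ∀ n, Ord 1 (approxL step n) := fun n =>
    ord_one_iff.2 (by rw [lc_approxL_of_le step (Nat.zero_le n), lc_limL_zero])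
  cases n with
  | zero => rw [exp_eq_expL, lc_expL_zero]; exact hR.symm
  | succ n =>
    have := exp_congr h1 (h2 n) (ord_limL_sub step n) (n + 1) (Nat.lt_succ_self _)
    rw [lc_sub, lc_sub, lc_sub, lc_limL_succ, lc_approxL_of_lt step (Nat.lt_succ_self n),
      sub_zero, sub_sub, sub_eq_zero] at this
    rw [this]
    exact add_sub_cancel _ _

end Logarithm

section TimeRing

/-! ### Polynomials in two times -/

/-- The ring `ℂ[s][θ]`. -/
abbrev TT : Type := Polynomial (Polynomial ℂ)

/-- The derivative with respect to `θ`. -/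
abbrev dθ : Der TT := polyDer (Polynomial ℂ)

/-- Coefficientwise application of an additive map. -/
def coeffMap {R : Type} [CommRing R] (f : R →+ R) : Polynomial R →+ Polynomial R where
  toFun p := p.sum fun n a => Polynomial.monomial n (f a)
  map_zero' := Polynomial.sum_zero_index _
  map_add' p p' := Polynomial.sum_add_index p p' _ (by simp) (by simp)

theorem coeff_coeffMap {R : Type} [CommRing R] (f : R →+ R) (p : Polynomial R) (n : ℕ) :
    (coeffMap f p).coeff n = f (p.coeff n) := by
  change (p.sum fun n a => Polynomial.monomial n (f a)).coeff n = _
  rw [Polynomial.sum_def, Polynomial.finsetSum_coeff]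
  simp only [Polynomial.coeff_monomial]
  rw [Finset.sum_ite_eq']
  split_ifs with h
  · rfl
  · rw [Polynomial.notMem_support_iff.1 h, map_zero]

/-- The derivative with respect to `s`. -/
def ds : Der TT := mkDer (coeffMap (Polynomial.derivative : Polynomial ℂ →ₗ[ℂ] _).toAddMonoidHom)
  fun x y => by
    ext1 n
    rw [coeff_coeffMap, Polynomial.coeff_add, Polynomial.coeff_mul, Polynomial.coeff_mul,
      mul_comm y, Polynomial.coeff_mul, map_sum, ← Finset.sum_add_distrib]
    refine Finset.sum_congr rfl fun p _ => ?_
    rw [coeff_coeffMap, coeff_coeffMap]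
    change Polynomial.derivative _ = _ * Polynomial.derivative _ + Polynomial.derivative _ * _
    rw [Polynomial.derivative_mul]
    ring

theorem coeff_ds (p : TT) (n : ℕ) : (ds p).coeff n = Polynomial.derivative (p.coeff n) :=
  coeff_coeffMap _ _ _

theorem dθ_ds (p : TT) : dθ (ds p) = ds (dθ p) := by
  ext1 n
  rw [polyDer_apply, polyDer_apply, Polynomial.coeff_derivative, coeff_ds, coeff_ds,
    Polynomial.coeff_derivative, Polynomial.derivative_mul]
  simp

/-- The antiderivative with respect to `θ`. -/
def intθ : TT →+ TT :=
  (AddMonoidHom.mulRight Polynomial.X).comp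
    { toFun := fun p => p.sum fun n a => Polynomial.monomial n (a * Polynomial.C ((n : ℂ) + 1)⁻¹)
      map_zero' := Polynomial.sum_zero_index _
      map_add' := fun p p' => Polynomial.sum_add_index p p' _ (by simp)
        (by simp [add_mul]) }

theorem coeff_intθ (p : TT) (n : ℕ) :
    (intθ p).coeff (n + 1) = p.coeff n * Polynomial.C ((n : ℂ) + 1)⁻¹ := by
  change ((p.sum fun n a => Polynomial.monomial n (a * Polynomial.C ((n : ℂ) + 1)⁻¹)) *
    Polynomial.X).coeff (n + 1) = _
  rw [Polynomial.coeff_mul_X, Polynomial.sum_def, Polynomial.finsetSum_coeff]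
  simp only [Polynomial.coeff_monomial]
  rw [Finset.sum_ite_eq']
  split_ifs with h
  · rfl
  · rw [Polynomial.notMem_support_iff.1 h, zero_mul]

theorem dθ_intθ (p : TT) : dθ (intθ p) = p := by
  ext1 n
  rw [polyDer_apply, Polynomial.coeff_derivative, coeff_intθ, mul_assoc]
  have h : (Polynomial.C ((n : ℂ) + 1)⁻¹ * ((n : Polynomial ℂ) + 1)) = 1 := by
    rw [← Polynomial.C_eq_natCast, ← Polynomial.C_1, ← Polynomial.C_add, ← Polynomial.C_mul,
      inv_mul_cancel₀ (Nat.cast_add_one_ne_zero n)]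
  rw [h, mul_one]

/-- Evaluation at `θ = 0`. -/
abbrev evθ : TT →+* Polynomial ℂ := Polynomial.constantCoeff

theorem evθ_intθ (p : TT) : evθ (intθ p) = 0 := by
  change (_ * Polynomial.X : TT).coeff 0 = 0
  simp

theorem isClock_dθ : IsClock dθ evθ := by
  intro p h h0
  have h1 := Polynomial.derivative_eq_zero.1 h
  rw [Polynomial.natDegree_eq_zero] at h1
  obtain ⟨c, rfl⟩ := h1
  simpa using h0

/-- Evaluation at a point of the plane of times. -/
def evK (θ s : ℂ) : TT →+* ℂ :=
  (Polynomial.evalRingHom s).comp (Polynomial.evalRingHom (Polynomial.C θ))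

theorem evK_algebraMap (θ s c : ℂ) : evK θ s (algebraMap ℂ TT c) = c := by
  simp [evK, Polynomial.algebraMap_apply]

theorem evK_X (θ s : ℂ) : evK θ s Polynomial.X = θ := by simp [evK]

theorem evK_C_X (θ s : ℂ) : evK θ s (Polynomial.C Polynomial.X) = s := by simp [evK]

theorem evK_eq (θ s : ℂ) (p : TT) :
    evK θ s p = (p.map (Polynomial.evalRingHom s)).eval θ := by
  induction p using Polynomial.induction_on' with
  | add p p' h h' => simp only [map_add, Polynomial.map_add, Polynomial.eval_add, h, h']
  | monomial n a => simp [evK]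

theorem evK_zero (s : ℂ) (p : TT) : evK 0 s p = (evθ p).eval s := by
  simp [evK, Polynomial.coeff_zero_eq_eval_zero]

theorem hasDerivAt_evK_left (s : ℂ) (p : TT) (t : ℝ) :
    HasDerivAt (fun t : ℝ => evK t s p) (evK t s (dθ p)) t := by
  simp only [evK_eq]
  rw [polyDer_apply, ← Polynomial.derivative_map]
  exact (Polynomial.hasDerivAt _ _).comp_ofReal

theorem eval_ds (θ : ℂ) (p : TT) : (ds p).eval (Polynomial.C θ) =
    Polynomial.derivative (p.eval (Polynomial.C θ)) := by
  induction p using Polynomial.induction_on' with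
  | add p p' h h' => simp only [map_add, Polynomial.eval_add, h, h']
  | monomial n a =>
    have : ds (Polynomial.monomial n a) = Polynomial.monomial n (Polynomial.derivative a) := by
      ext1 k
      rw [coeff_ds, Polynomial.coeff_monomial, Polynomial.coeff_monomial]
      split_ifs <;> simp
    rw [this, Polynomial.eval_monomial, Polynomial.eval_monomial, Polynomial.derivative_mul,
      ← Polynomial.C_pow, Polynomial.derivative_C, mul_zero, add_zero]

theorem hasDerivAt_evK_right (θ : ℂ) (p : TT) (t : ℝ) :
    HasDerivAt (fun t : ℝ => evK θ t p) (evK θ t (ds p)) t := by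
  have h : ∀ (s : ℂ) (p : TT), evK θ s p = (p.eval (Polynomial.C θ)).eval s := fun s p => rfl
  simp only [h]
  rw [eval_ds]
  exact (Polynomial.hasDerivAt _ _).comp_ofReal

theorem dθ_algebraMap (c : ℂ) : dθ (algebraMap ℂ TT c) = 0 := by
  rw [polyDer_apply, Polynomial.algebraMap_apply, Polynomial.derivative_C]

theorem ds_algebraMap (c : ℂ) : ds (algebraMap ℂ TT c) = 0 := by
  ext1 n
  rw [coeff_ds, Polynomial.algebraMap_apply, Polynomial.coeff_C]
  split_ifs <;> simp

end TimeRing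

section Cones

variable {L : ℕ} {K : Type} [CommRing K]

/-! ### Cones of ancestor potentials over a ring -/

/-- The equations that characterize ancestor vector potentials. -/
structure IsCone (A : Fin L → K) (J : LV L K) : Prop where
  graph : IsGraph A J
  lev : Lev 2 J
  tan : ∀ j, tanDef J j = 0
  rul : ∀ j k, rulDef J j k = 0
  string : nrm J (zInv J) = 0
  dilaton : nrm J J = 0

theorem mapLV_zero {K' : Type} [CommRing K'] (φ : K →+* K') : mapLV φ (0 : LV L K) = 0 :=
  LV.ext fun a α => by simp

theorem mapLV_tanDef {K' : Type} [CommRing K'] (φ : K →+* K') (J : LV L K) (j : Fin L × ℕ) :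
    mapLV φ (tanDef J j) = tanDef (mapLV φ J) j := by
  rw [tanDef, tanDef, mapLV_nrm, mapLV_zL, mapLV_act_cvf]

theorem mapLV_rulDef {K' : Type} [CommRing K'] (φ : K →+* K') (J : LV L K) (j k : Fin L × ℕ) :
    mapLV φ (rulDef J j k) = rulDef (mapLV φ J) j k := by
  rw [rulDef, rulDef, mapLV_nrm, mapLV_zL, mapLV_act_cvf, mapLV_act_cvf]

theorem IsCone.mapLV {A : Fin L → K} {J : LV L K} (h : IsCone A J) {K' : Type} [CommRing K']
    (φ : K →+* K') : IsCone (fun α => φ (A α)) (mapLV φ J) where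
  graph := h.graph.mapLV φ
  lev := h.lev.mapLV φ
  tan j := by rw [← mapLV_tanDef, h.tan, mapLV_zero]
  rul j k := by rw [← mapLV_rulDef, h.rul, mapLV_zero]
  string := by rw [← mapLV_zInv, ← mapLV_nrm, h.string, mapLV_zero]
  dilaton := by rw [← mapLV_nrm, h.dilaton, mapLV_zero]

theorem IsAncestor.isCone {A : Fin L → ℂ} {F : VecSeq L} (h : IsAncestor A F) :
    IsCone A (Jof A F) where
  graph := isGraph_Jof
  lev := h.lev
  tan := h.tanDef
  rul := h.rulDef
  string := string_iff.2 h.descendant.string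
  dilaton := dilaton_iff.2 h.descendant.dilaton

theorem IsCone.isAncestor {A : Fin L → ℂ} {J : LV L ℂ} (h : IsCone A J) :
    IsAncestor A fun a α => J a α := by
  have e := h.graph.eq_Jof
  exact isAncestor_of_graph (e ▸ h.lev) (fun j => by rw [← e, h.tan]) (fun j k => by
    rw [← e, h.rul]) (by rw [← e, h.string]) (by rw [← e, h.dilaton])

theorem IsFlow.isCone {R : Type} [CommRing R] {D : Derivation ℤ K K} {ev : K →+* R}
    {ρ : ℕ → Matrix (Fin L) (Fin L) K} {A : Fin L → K} {J : LV L K} (hfl : IsFlow D ρ J)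
    (hJ : IsGraph A J) (h2 : Lev 2 J) (hρ : ρ 0 = 0) (hc : IsClock D ev) {A' : Fin L → R}
    (h0 : IsCone A' (OpenGivental.mapLV ev J)) : IsCone A J := by
  have ht : ∀ j, tanDef J j = 0 := hfl.tanDef_eq_zero hJ h2 hρ hc fun j => by
    rw [mapLV_tanDef, h0.tan]
  refine ⟨hJ, h2, ht, hfl.rulDef_eq_zero hJ h2 hρ hc ht fun j k => by
    rw [mapLV_rulDef, h0.rul], ?_, ?_⟩
  · refine hfl.defect_central hJ h2 hρ hc zInv.toAddMonoidHom (fun n w => ?_)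
      (fun δ w => (act_zInv δ w).symm) (lder_zInv D) (-1) (fun m w hw => hw.zInv) ?_
    · exact (LinearMap.congr_fun (loop_zInv n ρ) w).symm
    · rw [mapLV_nrm]
      exact (congrArg _ (mapLV_zInv ev J)).trans h0.string
  · refine hfl.defect_central hJ h2 hρ hc (AddMonoidHom.id _) (fun n w => rfl)
      (fun δ w => rfl) (fun w => rfl) 0 (fun m w hw => by simpa using hw) ?_
    rw [mapLV_nrm]
    exact h0.dilaton

end Cones

/-! ### Integral curves and the group law -/

section Curves

variable {L : ℕ} {A : Fin L → ℂ}

/-! ### Integral curves of the infinitesimal action -/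

/-- A curve of ancestor vector potentials that integrates the infinitesimal action of `r`. -/
structure IsCurve (A : Fin L → ℂ) (r : Loop L) (Φ : ℝ → VecSeq L) : Prop where
  ancestor : ∀ θ, IsAncestor A (Φ θ)
  deriv : ∀ (θ : ℝ) (a : ℕ) (α : Fin L) (m : Fin L × ℕ →₀ ℕ),
    HasDerivAt (fun s : ℝ => MvPowerSeries.coeff m (Φ s a α))
      (MvPowerSeries.coeff m (infAct A r (Φ θ) a α)) θ

theorem actsTo_iff {R : Loop L} {F F' : VecSeq L} : ActsTo A R F F' ↔
    ∃ (r : Loop L) (Φ : ℝ → VecSeq L), Ord 1 r ∧ r.exp = R ∧ IsCurve A r Φ ∧ Φ 0 = F ∧ Φ 1 = F' := by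
  constructor
  · rintro ⟨r, Φ, h0, h1, h2, h3, h4, h5⟩
    exact ⟨r, Φ, ord_one_iff.2 h0, h1, ⟨h2, h5⟩, h3, h4⟩
  · rintro ⟨r, Φ, h0, h1, ⟨h2, h5⟩, h3, h4⟩
    exact ⟨r, Φ, ord_one_iff.1 h0, h1, h2, h3, h4, h5⟩

theorem eq_of_hasDerivAt_zero {f : ℝ → ℂ} (h : ∀ t, HasDerivAt f 0 t) (t : ℝ) : f t = f 0 :=
  is_const_of_deriv_eq_zero (fun t => (h t).differentiableAt) (fun t => (h t).deriv) t 0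

theorem sub_eq_of_hasDerivAt_const {f : ℝ → ℂ} {c : ℂ} (h : ∀ t, HasDerivAt f c t) :
    f 1 - f 0 = c := by
  have h1 : ∀ t, HasDerivAt (fun t : ℝ => f t - t * c) 0 t := fun t => by
    have h2 : HasDerivAt (fun t : ℝ => (t : ℂ) * c) (1 * c) t :=
      ((hasDerivAt_id (t : ℂ)).comp_ofReal).mul_const c
    simpa using (h t).fun_sub h2
  have := eq_of_hasDerivAt_zero h1 1
  simp at this
  linear_combination this

theorem lev_sub_iff {F F' : VecSeq L} {n : ℤ} : Lev n (Jof A F - Jof A F') ↔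
    ∀ (a : ℕ) α m, wt m < a + n → coeff m (F a α) = coeff m (F' a α) := by
  constructor
  · intro h a α m hm
    have := h a α m hm
    rwa [LV.sub_apply, map_sub, sub_eq_zero] at this
  · intro h a α m hm
    rw [LV.sub_apply, map_sub, sub_eq_zero]
    cases a with
    | ofNat a => exact h a α m hm
    | negSucc n => rfl

theorem IsCurve.hasDerivAt {r : Loop L} (hr : Ord 1 r) {Φ : ℝ → VecSeq L} (h : IsCurve A r Φ)
    (a : ℕ) (α : Fin L) (m : Fin L × ℕ →₀ ℕ) (D : ℕ) (hD : wt m ≤ 2 + a + D) (θ : ℝ) :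
    HasDerivAt (fun s : ℝ => MvPowerSeries.coeff m (Φ s a α))
      (coeff m (nrm (Jof A (Φ θ)) (loop D r.coeff (Jof A (Φ θ))) a α)) θ := by
  rw [← coeff_infAct (h.ancestor θ).lev r (ord_one_iff.1 hr) a α m D hD]
  exact h.deriv θ a α m

/-- If two curves agree up to some level for all times, their velocities agree up to the next level.
The difference of the coefficients there is constant in time and zero initially. -/
theorem IsCurve.unique {r : Loop L} (hr : Ord 1 r) {Φ Ψ : ℝ → VecSeq L} (h : IsCurve A r Φ)
    (h' : IsCurve A r Ψ) (h0 : Φ 0 = Ψ 0) : Φ = Ψ := by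
  have key : ∀ n : ℕ, ∀ θ, Lev (2 + n) (Jof A (Φ θ) - Jof A (Ψ θ)) := by
    intro n
    induction n with
    | zero => exact fun θ => by simpa using (h.ancestor θ).lev.sub (h'.ancestor θ).lev
    | succ n ih =>
      intro θ
      rw [lev_sub_iff]
      intro a α m hm
      have h1 : ∀ t, HasDerivAt (fun s : ℝ => coeff m (Φ s a α) - coeff m (Ψ s a α)) 0 t := by
        intro t
        have h2 := (h.hasDerivAt hr a α m n (by push_cast at hm; omega) t).fun_sub
          (h'.hasDerivAt hr a α m n (by push_cast at hm; omega) t)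
        rwa [← map_sub, ← LV.sub_apply, Lev.nrm_loop_sub (h.ancestor t).lev (h'.ancestor t).lev
          (ih t) n (r := r.coeff) (ord_one_iff.1 hr) a α m (by push_cast at hm; omega)] at h2
      have h3 := eq_of_hasDerivAt_zero h1 θ
      rwa [h0, sub_self, sub_eq_zero] at h3
  funext θ
  refine Jof_injective (A := A) (sub_eq_zero.1 ?_)
  exact Lev.eq_zero (c := 2) fun n => key n θ

theorem ActsTo.unique {R : Loop L} {F F' F'' : VecSeq L} (h : ActsTo A R F F')
    (h' : ActsTo A R F F'') : F' = F'' := by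
  obtain ⟨r, Φ, h0, h1, h2, h3, h4⟩ := actsTo_iff.1 h
  obtain ⟨r', Φ', h0', h1', h2', h3', h4'⟩ := actsTo_iff.1 h'
  obtain rfl := exp_injective h0 h0' (h1.trans h1'.symm)
  obtain rfl := h2.unique h0 h2' (h3.trans h3'.symm)
  exact h4.symm.trans h4'

/-- The leading term of the change of a sequence of vector potentials under `exp r`. -/
theorem IsCurve.lev_sub {r : Loop L} {n : ℕ} (hn : 1 ≤ n) (hr : Ord n r) {Φ : ℝ → VecSeq L}
    (h : IsCurve A r Φ) : Lev (3 + n) (Jof A (Φ 1) - Jof A (Φ 0) -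
      nrm (Jof A (Φ 0)) (loop n r.coeff (Jof A (Φ 0)))) := by
  have hr1 : Ord 1 r := hr.mono hn
  -- Up to level `2 + n` the curve does not move, hence its velocity is constant up to level `3 +
  -- n`, and the increment over unit time is the initial velocity.
  have h1 : ∀ t, Lev (2 + n) (Jof A (Φ t) - Jof A (Φ 0)) := fun t => by
    rw [lev_sub_iff]
    intro a α m hm
    refine eq_of_hasDerivAt_zero (f := fun s => coeff m (Φ s a α)) (fun t => ?_) t
    have h2 := h.hasDerivAt hr1 a α m n (by omega) t
    rwa [(h.ancestor t).lev.nrm_loop_of n n (r := r.coeff) hr a α m (by omega)] at h2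
  intro a α m hm
  cases a with
  | negSucc k =>
    rw [LV.sub_apply, LV.sub_apply]
    have h2 := isGraph_Jof.nrm_pos (J := Jof A (Φ 0)) (A := A)
      (loop n r.coeff (Jof A (Φ 0))) (α, k)
    rw [posC, neg_one_pow_mul_eq_zero] at h2
    rw [h2, sub_zero]
    simp [Jof_apply, ext_negSucc]
  | ofNat a =>
    rw [LV.sub_apply, map_sub, LV.sub_apply, map_sub, sub_eq_zero]
    refine sub_eq_of_hasDerivAt_const (f := fun s => coeff m (Φ s a α)) fun t => ?_
    have hm' : wt m < a + (3 + n) := hm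
    have h2 := h.hasDerivAt hr1 a α m n (by omega) t
    have h3 := Lev.nrm_loop_sub (h.ancestor t).lev (h.ancestor 0).lev (h1 t) n
      (r := r.coeff) (ord_one_iff.1 hr1) a α m (by omega)
    rw [LV.sub_apply, map_sub, sub_eq_zero] at h3
    rwa [h3] at h2

end Curves

section Flows

variable {L : ℕ} {A : Fin L → ℂ}

/-! ### Flows over the ring of times -/

/-- The sequence of vector potentials at a point of the plane of times. -/
def seqAt (J : LV L TT) (θ s : ℂ) : VecSeq L := fun a α => mapLV (evK θ s) J a α

theorem isCone_mapLV_evK {J : LV L TT} (h : IsCone (fun α => algebraMap ℂ TT (A α)) J) (θ s : ℂ) :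
    IsCone A (mapLV (evK θ s) J) := by
  have := h.mapLV (evK θ s)
  simpa only [evK_algebraMap] using this

theorem Jof_seqAt {J : LV L TT} (h : IsCone (fun α => algebraMap ℂ TT (A α)) J) (θ s : ℂ) :
    Jof A (seqAt J θ s) = mapLV (evK θ s) J :=
  ((isCone_mapLV_evK h θ s).graph.eq_Jof).symm

theorem mapLV_comp {K K' K'' : Type} [CommRing K] [CommRing K'] [CommRing K''] (φ : K →+* K')
    (ψ : K' →+* K'') (w : LV L K) : mapLV ψ (mapLV φ w) = mapLV (ψ.comp φ) w :=
  LV.ext fun a α => by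
    ext m
    simp

theorem exists_cone_flow {F : VecSeq L} (hF : IsAncestor A F) {ρ : ℕ → Matrix (Fin L) (Fin L) TT}
    (hρ : ρ 0 = 0) : ∃ J : LV L TT, IsCone (fun α => algebraMap ℂ TT (A α)) J ∧
      IsFlow dθ ρ J ∧ mapLV evθ J = mapLV Polynomial.C (Jof A F) := by
  have h0 := hF.isCone.mapLV (algebraMap ℂ TT)
  obtain ⟨J, h1, h2, h3, h4⟩ := exists_flow (D := dθ) (ev := evθ) dθ_intθ evθ_intθ h0.graph h0.lev
    hρ (LV.ext fun a α => by
      ext m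
      rw [lder_apply, coeff_cder, mapLV_apply, coeff_map, dθ_algebraMap]
      simp)
  have h5 : mapLV evθ J = mapLV Polynomial.C (Jof A F) := by
    rw [h4, mapLV_comp]
    congr 1
    ext1 x
    simp [Polynomial.algebraMap_apply]
  exact ⟨J, h3.isCone h1 h2 hρ isClock_dθ (h5 ▸ hF.isCone.mapLV Polynomial.C), h3, h5⟩

theorem IsFlow.isCurve {D : Derivation ℤ TT TT} {ρ : ℕ → Matrix (Fin L) (Fin L) TT} {J : LV L TT}
    (hfl : IsFlow D ρ J) (hJ : IsCone (fun α => algebraMap ℂ TT (A α)) J) (θ s : ℝ → ℂ)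
    (hD : ∀ p t, HasDerivAt (fun t : ℝ => evK (θ t) (s t) p) (evK (θ t) (s t) (D p)) t)
    {r : Loop L} (hr : Ord 1 r) (hρ : ∀ t i, (ρ i).map (evK (θ t) (s t)) = r.coeff i) :
    IsCurve A r fun t => seqAt J (θ t) (s t) where
  ancestor t := (isCone_mapLV_evK hJ _ _).isAncestor
  deriv t a α m := by
    set n := (wt m).toNat
    rw [coeff_infAct (by rw [Jof_seqAt hJ]; exact (isCone_mapLV_evK hJ _ _).lev) r
      (ord_one_iff.1 hr) a α m n (by omega), Jof_seqAt hJ]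
    have h1 : (fun i => (ρ i).map (evK (θ t) (s t))) = r.coeff := funext (hρ t)
    rw [← h1, ← mapLV_loop, ← mapLV_nrm, mapLV_apply, coeff_map]
    have h2 := hfl n a α m (by omega)
    rw [LV.sub_apply, map_sub, sub_eq_zero] at h2
    rw [← h2]
    have h3 : ∀ t, coeff m (seqAt J (θ t) (s t) a α) = evK (θ t) (s t) (coeff m (J a α)) :=
      fun t => coeff_map _ _ _
    simp only [h3]
    exact hD _ t

theorem seqAt_zero {J : LV L TT} {F : VecSeq L} (h : mapLV evθ J = mapLV Polynomial.C (Jof A F))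
    (s : ℂ) : seqAt J 0 s = F := by
  funext a α
  ext m
  have h1 := congrArg (fun w : LV L (Polynomial ℂ) => coeff m (w a α)) h
  simp only [mapLV_apply, coeff_map, Jof_nat] at h1
  rw [seqAt, mapLV_apply, coeff_map, evK_zero, h1, Polynomial.eval_C]

/-- The coefficients of a power series, as constants in the ring of times. -/
def constTT (r : Loop L) (i : ℕ) : Matrix (Fin L) (Fin L) TT := (r.coeff i).map (algebraMap ℂ TT)

theorem constTT_evK (r : Loop L) (θ s : ℂ) (i : ℕ) : (constTT r i).map (evK θ s) = r.coeff i := by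
  ext
  simp only [constTT, Matrix.map_apply, evK_algebraMap]

theorem constTT_zero {r : Loop L} (hr : Ord 1 r) : constTT r 0 = 0 := by
  ext α β
  have : r.coeff 0 = 0 := ord_one_iff.1 hr
  simp [constTT, this]

theorem exists_flow_const {F : VecSeq L} (hF : IsAncestor A F) {r : Loop L} (hr : Ord 1 r) :
    ∃ J : LV L TT, IsCone (fun α => algebraMap ℂ TT (A α)) J ∧ IsFlow dθ (constTT r) J ∧
      mapLV evθ J = mapLV Polynomial.C (Jof A F) ∧ ActsTo A r.exp F (seqAt J 1 0) := by
  obtain ⟨J, h1, h2, h3⟩ := exists_cone_flow hF (constTT_zero hr)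
  refine ⟨J, h1, h2, h3, actsTo_iff.2 ⟨r, fun t => seqAt J t 0, hr, rfl, ?_, ?_, ?_⟩⟩
  · exact h2.isCurve h1 (fun t => t) (fun _ => 0) (fun p t => hasDerivAt_evK_left 0 p t) hr
      fun t i => constTT_evK r _ _ i
  · simpa using seqAt_zero h3 0
  · simp

theorem ActsTo.exists {F : VecSeq L} (hF : IsAncestor A F) {R : Loop L} (hR : R.coeff 0 = 1) :
    ∃ F', ActsTo A R F F' := by
  obtain ⟨r, h0, rfl⟩ := exists_log hR
  obtain ⟨J, -, -, -, h⟩ := exists_flow_const hF (ord_one_iff.2 h0)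
  exact ⟨_, h⟩

theorem ActsTo.ancestor_left {F F' : VecSeq L} {R : Loop L} (h : ActsTo A R F F') :
    IsAncestor A F := by
  obtain ⟨r, Φ, -, -, hΦ, rfl, -⟩ := actsTo_iff.1 h
  exact hΦ.ancestor 0

theorem ActsTo.ancestor_right {F F' : VecSeq L} {R : Loop L} (h : ActsTo A R F F') :
    IsAncestor A F' := by
  obtain ⟨r, Φ, -, -, hΦ, -, rfl⟩ := actsTo_iff.1 h
  exact hΦ.ancestor 1

theorem ActsTo.coeff_zero {F F' : VecSeq L} {R : Loop L} (h : ActsTo A R F F') :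
    R.coeff 0 = 1 := by
  obtain ⟨r, Φ, -, rfl, -⟩ := actsTo_iff.1 h
  rw [exp_eq_expL]
  exact lc_expL_zero _ _

theorem ActsTo.lev_sub {F F' : VecSeq L} {r : Loop L} {n : ℕ} (hn : 1 ≤ n) (hr : Ord n r)
    (h : ActsTo A r.exp F F') :
    Lev (3 + n) (Jof A F' - Jof A F - nrm (Jof A F) (loop n r.coeff (Jof A F))) := by
  obtain ⟨r', Φ, h0, h1, h2, rfl, rfl⟩ := actsTo_iff.1 h
  obtain rfl := exp_injective h0 (hr.mono hn) h1
  exact h2.lev_sub hn hr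

/-- The generator starts in degree one, so the action does not affect level two. In particular the
second derivatives of `F 0` at the origin, that is, the tangent algebra, are preserved. -/
theorem ActsTo.lev_sub_three {F F' : VecSeq L} {R : Loop L} (h : ActsTo A R F F') :
    Lev 3 (Jof A F' - Jof A F) := by
  obtain ⟨r, h0, rfl⟩ := exists_log h.coeff_zero
  have h1 := h.lev_sub le_rfl (ord_one_iff.2 h0)
  refine (h1.mono (k := 3) (by simp)).of_sub ?_
  exact ((h.ancestor_left.lev.loop 1 h0).nrm h.ancestor_left.lev)

/-! ### The group law -/

theorem mapL_mapL_algebraMap {K K' : Type} [CommRing K] [CommRing K'] [Algebra ℂ K] [Algebra ℂ K']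
    (φ : K →+* K') (hφ : ∀ c, φ (algebraMap ℂ K c) = algebraMap ℂ K' c) (r : Loop L) :
    mapL φ (mapL (algebraMap ℂ K) r) = mapL (algebraMap ℂ K') r :=
  lc_ext fun i => by
    ext
    simp only [lc_mapL, Matrix.map_apply, hφ]

/-- A flat connection in two times that joins two one-parameter groups to their product. -/
theorem exists_homotopy {K : Type} [CommRing K] [Algebra ℂ K] {Dθ Ds : Derivation ℤ K K}
    (hθ : ∀ c : ℂ, Dθ (algebraMap ℂ K c) = 0) (hs : ∀ c : ℂ, Ds (algebraMap ℂ K c) = 0)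
    (hcomm : ∀ x, Dθ (Ds x) = Ds (Dθ x)) {θ s : K} (hθθ : Dθ θ = 1) (hθs : Dθ s = 0)
    (hsθ : Ds θ = 0) (hss : Ds s = 1) {r₁ r₂ r₃ : Loop L} (h01 : Ord 1 r₁) (h02 : Ord 1 r₂)
    (h03 : Ord 1 r₃) (h3 : r₃.exp = r₁.exp * r₂.exp) :
    ∃ ρ κ : Matrix (Fin L) (Fin L) K⟦X⟧, lc ρ 0 = 0 ∧ lc κ 0 = 0 ∧
      derL Dθ κ - derL Ds ρ = ρ * κ - κ * ρ ∧
      ∀ (K' : Type) [CommRing K'] [Algebra ℂ K'] (φ : K →+* K'),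
        (∀ c, φ (algebraMap ℂ K c) = algebraMap ℂ K' c) →
        (φ s = 0 → mapL φ ρ = mapL (algebraMap ℂ K') r₂) ∧
        (φ s = 1 → mapL φ ρ = mapL (algebraMap ℂ K') r₃) ∧
        (φ θ = 1 → mapL φ κ = mapL (algebraMap ℂ K') r₁) ∧
        (φ θ = 0 → mapL φ κ = 0) := by
  let c := mapL (L := L) (algebraMap ℂ K)
  let E₁ := expL s (c r₁)
  let E₂ := expL θ (c r₂)
  let E₃ := expL θ (c r₃)
  -- On the edges of the square, `U` is `exp (θ r₂)` at `s = 0`, `exp (θ r₃)` at `s = 1`, `exp (s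
  -- r₁) exp r₂` at `θ = 1` and the identity at `θ = 0`. The connection forms `U_θ U⁻¹` and `U_s
  -- U⁻¹` are flat and restrict to the prescribed generators.
  let U := (1 - s) • E₂ + s • E₃ + θ • (E₁ * c r₂.exp - (1 - s) • c r₂.exp - s • c r₃.exp)
  have hcθ : ∀ r, derL Dθ (c r) = 0 := derL_mapL_algebraMap Dθ hθ
  have hcs : ∀ r, derL Ds (c r) = 0 := derL_mapL_algebraMap Ds hs
  have hc1 : ∀ {r : Loop L}, Ord 1 r → Ord 1 (c r) := fun h => h.mapL _
  have hE₁θ : derL Dθ E₁ = 0 := by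
    rw [derL_expL Dθ hθ _ (hc1 h01) (hcθ _), hθs, zero_smul]
  have hE₂θ : derL Dθ E₂ = c r₂ * E₂ := by
    rw [derL_expL Dθ hθ _ (hc1 h02) (hcθ _), hθθ, one_smul]
  have hE₃θ : derL Dθ E₃ = c r₃ * E₃ := by
    rw [derL_expL Dθ hθ _ (hc1 h03) (hcθ _), hθθ, one_smul]
  have hE₁s : derL Ds E₁ = c r₁ * E₁ := by
    rw [derL_expL Ds hs _ (hc1 h01) (hcs _), hss, one_smul]
  have hE₂s : derL Ds E₂ = 0 := by
    rw [derL_expL Ds hs _ (hc1 h02) (hcs _), hsθ, zero_smul]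
  have hE₃s : derL Ds E₃ = 0 := by
    rw [derL_expL Ds hs _ (hc1 h03) (hcs _), hsθ, zero_smul]
  have hUθ : derL Dθ U = (1 - s) • (c r₂ * E₂) + s • (c r₃ * E₃) +
      (E₁ * c r₂.exp - (1 - s) • c r₂.exp - s • c r₃.exp) := by
    simp only [U, derL_add, derL_sub, derL_smul, derL_mul, hE₁θ, hE₂θ, hE₃θ, hcθ, map_sub, hθs,
      hθθ, Derivation.map_one_eq_zero, sub_zero, zero_smul, smul_zero, zero_add, add_zero, one_smul,
      zero_mul, mul_zero]
  have hUs : derL Ds U = -E₂ + E₃ + θ • (c r₁ * E₁ * c r₂.exp + c r₂.exp - c r₃.exp) := by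
    simp only [U, derL_add, derL_sub, derL_smul, derL_mul, hE₁s, hE₂s, hE₃s, hcs, map_sub, hsθ,
      hss, Derivation.map_one_eq_zero, smul_zero, zero_add, add_zero, one_smul,
      zero_sub, neg_smul, mul_zero, zero_smul, sub_neg_eq_add]
  have hU0 : lc U 0 = 1 := by
    have hc0 : ∀ r : Loop L, lc (c r.exp) 0 = 1 := fun r => by
      rw [lc_mapL, exp_eq_expL, lc_expL_zero]
      simp
    have hE0 : ∀ (x : K) (M), lc (expL x M : Matrix (Fin L) (Fin L) K⟦X⟧) 0 = 1 :=
      fun x M => lc_expL_zero x M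
    have hmul : lc (E₁ * c r₂.exp) 0 = 1 := by
      rw [lc_mul]
      simp [hE0, hc0, E₁]
    simp only [U, lc_add, lc_smul, lc_sub, hmul, hc0, E₂, E₃, hE0]
    module
  obtain ⟨V, hUV, hVU⟩ : ∃ V, U * V = 1 ∧ V * U = 1 :=
    isUnit_iff_exists.1 (isUnit_of_lc_zero hU0)
  have hD0 : ∀ D : Derivation ℤ K K, lc (derL D U * V) 0 = 0 := fun D => by
    have h1 : Ord 1 (derL D U) := ord_one_iff.2 (by
      rw [lc_derL, hU0, ← lc_one (K := K) 0 |>.trans (if_pos rfl), ← lc_derL, derL_one, lc_zero])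
    have h2 := h1.mul (b := 0) (M' := V) fun i hi => absurd hi (by omega)
    exact ord_one_iff.1 h2
  have hVD : ∀ D : Derivation ℤ K K, derL D V = -(V * derL D U * V) := fun D => by
    have h1 := congrArg (derL D) hVU
    rw [derL_one, derL_mul] at h1
    have h2 := congrArg (· * V) (eq_neg_of_add_eq_zero_left h1)
    simpa only [mul_assoc, hUV, mul_one, neg_mul] using h2
  refine ⟨derL Dθ U * V, derL Ds U * V, hD0 Dθ, hD0 Ds, ?_, fun K' _ _ φ hφ => ?_⟩
  · have h1 : derL Dθ (derL Ds U) = derL Ds (derL Dθ U) := lc_ext fun i => by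
      ext
      simp only [lc_derL, Matrix.map_apply, hcomm]
    rw [derL_mul, derL_mul, hVD, hVD, h1]
    noncomm_ring
  · have hcancel : ∀ (M : Matrix (Fin L) (Fin L) K⟦X⟧) (Q : Matrix (Fin L) (Fin L) K'⟦X⟧),
        mapL φ M = Q * mapL φ U → mapL φ (M * V) = Q := fun M Q h => by
      have h2 : mapL φ U * mapL φ V = 1 := by rw [← map_mul, hUV, map_one]
      rw [map_mul, h, mul_assoc, h2, mul_one]
    have hφc : ∀ r, mapL φ (c r) = mapL (algebraMap ℂ K') r := mapL_mapL_algebraMap φ hφ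
    have hφE : ∀ x r, mapL φ (expL x (c r)) = expL (φ x) (mapL (algebraMap ℂ K') r) :=
      fun x r => by rw [mapL_expL φ hφ, hφc]
    have hE0 : ∀ r : Loop L, expL (0 : K') (mapL (algebraMap ℂ K') r) = 1 := fun r => expL_zero _
    have hE1 : ∀ r : Loop L, expL (1 : K') (mapL (algebraMap ℂ K') r) =
        mapL (algebraMap ℂ K') r.exp := fun r => by
      rw [exp_eq_expL, mapL_expL _ (fun c => rfl), map_one]
    refine ⟨fun h => hcancel _ _ ?_, fun h => hcancel _ _ ?_, fun h => hcancel _ _ ?_,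
      fun h => hcancel _ _ ?_⟩
    · rw [hUθ]
      simp only [U, E₁, E₂, E₃, map_add, map_sub, mapL_smul, map_mul, hφE, hφc, h, map_one, hE0,
        sub_zero, one_smul, zero_smul, add_zero, one_mul, sub_self, smul_zero]
    · rw [hUθ]
      simp only [U, E₁, E₂, E₃, map_add, map_sub, mapL_smul, map_mul, hφE, hφc, h, map_one, hE1,
        sub_zero, one_smul, zero_smul, add_zero, sub_self, smul_zero, zero_add, h3]
    · rw [hUs]
      simp only [U, E₁, E₂, E₃, map_add, map_sub, map_neg, mapL_smul, map_mul, hφE, hφc, h, map_one,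
        hE1, one_smul]
      rw [mul_assoc, sub_sub, add_sub_cancel]
      abel
    · rw [hUs]
      simp only [U, E₁, E₂, E₃, map_add, map_sub, map_neg, mapL_smul, map_mul, hφE, hφc, h, map_one,
        hE0, zero_smul, add_zero, zero_mul, neg_add_cancel]

/-- The edge `s = 0` of the square leads from `F` to `F'` by `r₂`, and the edge `θ = 1` from `F'` to
`F''` by `r₁`. The edge `θ = 0` is constant, and the edge `s = 1` is the curve of `r₃`, which hence
joins `F` to `F''`. -/
theorem ActsTo.mul {F F' F'' : VecSeq L} {R S : Loop L} (hS : ActsTo A S F F')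
    (hR : ActsTo A R F' F'') : ActsTo A (R * S) F F'' := by
  have hF := hS.ancestor_left
  obtain ⟨r₁, Φ₁, h01, rfl, hΦ₁, rfl, rfl⟩ := actsTo_iff.1 hR
  obtain ⟨r₂, Φ₂, h02, rfl, hΦ₂, rfl, he⟩ := actsTo_iff.1 hS
  obtain ⟨r₃, h03', h3⟩ := exists_log (R := r₁.exp * r₂.exp)
    (by rw [Loop.coeff_zero_mul, hR.coeff_zero, hS.coeff_zero, one_mul])
  have h03 : Ord 1 r₃ := ord_one_iff.2 h03'
  obtain ⟨ρ, κ, hρ0, hκ0, hflat, hev⟩ := exists_homotopy (θ := (Polynomial.X : TT))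
    (s := Polynomial.C Polynomial.X) dθ_algebraMap ds_algebraMap dθ_ds Polynomial.derivative_X
    Polynomial.derivative_C (by
      ext1 n
      rw [coeff_ds, Polynomial.coeff_X]
      split_ifs <;> simp) (by
      ext1 n
      rw [coeff_ds, Polynomial.coeff_C, Polynomial.coeff_one]
      split_ifs <;> simp) h01 h02 h03 h3
  obtain ⟨J, hJ, hfl, h0⟩ := exists_cone_flow hF (ρ := lc ρ) hρ0
  have hpar : IsFlow ds (lc κ) J := by
    refine hfl.parameter hJ.graph hJ.lev hρ0 hκ0 isClock_dθ dθ_ds (fun i => ?_) fun n => ?_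
    · have := congrArg (fun M => lc M i) hflat
      simp only [lc_sub, lc_derL, lc_mul] at this
      rw [Finset.sum_sub_distrib]
      exact this
    -- At `θ = 0` the sequence does not depend on `s` and `κ` vanishes, so the `s`-flow equation
    -- holds initially.
    · have h4 := ((hev _ evθ fun c => by simp [Polynomial.algebraMap_apply]).2.2.2 (by simp))
      have h5 : (fun i => (lc κ i).map evθ) = 0 := funext fun i => by
        rw [← lc_mapL, h4, lc_zero]
        rfl
      rw [mapLV_sub, mapLV_nrm, mapLV_loop, h5]
      have h6 : mapLV evθ (lder ds J) = 0 := LV.ext fun a α => by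
        refine MvPowerSeries.ext fun m => ?_
        rw [mapLV_apply, coeff_map, lder_apply, coeff_cder]
        change (ds (coeff m (J a α))).coeff 0 = _
        have h7 := congrArg (fun w : LV L (Polynomial ℂ) => coeff m (w a α)) h0
        simp only [mapLV_apply, coeff_map] at h7
        rw [coeff_ds, show (coeff m (J a α)).coeff 0 = _ from h7, Polynomial.derivative_C]
        simp
      have h8 : loop n (0 : ℕ → Matrix (Fin L) (Fin L) (Polynomial ℂ)) = 0 := by
        simp [loop, matL_zero]
      rw [h6, h8]
      simp
  have hat : ∀ (φ : TT →+* ℂ) (M : Matrix (Fin L) (Fin L) TT⟦X⟧) (r : Loop L),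
      mapL φ M = mapL (algebraMap ℂ ℂ) r → ∀ i, (lc M i).map φ = r.coeff i := fun φ M r h i => by
    rw [← lc_mapL, h, lc_mapL]
    ext
    rfl
  have c2 : IsCurve A r₂ fun t => seqAt J (t : ℂ) 0 :=
    hfl.isCurve hJ (fun t => t) (fun _ => 0) (fun p t => hasDerivAt_evK_left 0 p t) h02
      fun t => hat _ _ _ ((hev ℂ (evK t 0) (evK_algebraMap _ _)).1 (evK_C_X _ _))
  have c3 : IsCurve A r₃ fun t => seqAt J (t : ℂ) 1 :=
    hfl.isCurve hJ (fun t => t) (fun _ => 1) (fun p t => hasDerivAt_evK_left 1 p t) h03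
      fun t => hat _ _ _ ((hev ℂ (evK t 1) (evK_algebraMap _ _)).2.1 (evK_C_X _ _))
  have c1 : IsCurve A r₁ fun t => seqAt J 1 (t : ℂ) :=
    hpar.isCurve hJ (fun _ => 1) (fun t => t) (fun p t => hasDerivAt_evK_right 1 p t) h01
      fun t => hat _ _ _ ((hev ℂ (evK 1 t) (evK_algebraMap _ _)).2.2.1 (evK_X _ _))
  have e2 := c2.unique h02 hΦ₂ (by simpa using seqAt_zero h0 0)
  have e1 := c1.unique h01 hΦ₁ (by
    have := congrFun e2 1
    simp only [Complex.ofReal_one, Complex.ofReal_zero] at this ⊢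
    rw [this, he])
  refine actsTo_iff.2 ⟨r₃, _, h03, h3, c3, by simpa using seqAt_zero h0 1, ?_⟩
  have := congrFun e1 1
  simpa using this

theorem ActsTo.one {F : VecSeq L} (hF : IsAncestor A F) : ActsTo A 1 F F := by
  refine actsTo_iff.2 ⟨0, fun _ => F, ord_one_iff.2 (lc_zero 0), ?_, ⟨fun _ => hF, ?_⟩, rfl, rfl⟩
  · refine lc_ext fun n => ?_
    rw [exp_eq_expL, expL, lc_mkL, Finset.sum_range_succ']
    simp [lc_zero]
  · intro θ a α m
    have h0 : Loop.coeff (0 : Loop L) = 0 := funext fun i => lc_zero i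
    rw [coeff_infAct hF.lev 0 (lc_zero 0) a α m (wt m).toNat (by omega), h0]
    have h8 : loop (wt m).toNat (0 : ℕ → Matrix (Fin L) (Fin L) ℂ) = 0 := by
      simp [loop, matL_zero]
    rw [h8]
    simpa using hasDerivAt_const θ _

end Flows

/-! ### The open loop group, its Lie algebra, and invariance of open-closed type -/

section LieAlgebra

variable {L N : ℕ}

/-! ### The Lie algebra of the group of open loops -/

theorem lc_exp {r : Loop L} (hr : Ord 1 r) {n B : ℕ} (h : n < B) :
    lc r.exp n = ∑ k ∈ Finset.range B, ((k.factorial : ℂ)⁻¹) • lc (r ^ k) n := by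
  rw [exp_eq_expL, lc_expL _ hr h]
  simp

theorem exp_conj {r s P : Loop L} (hr : Ord 1 r) (hs : Ord 1 s) (h : r * P = P * s) :
    r.exp * P = P * s.exp := by
  have hk : ∀ k, r ^ k * P = P * s ^ k := fun k => by
    induction k with
    | zero => simp
    | succ k ih => rw [pow_succ, mul_assoc, h, ← mul_assoc, ih, mul_assoc, pow_succ]
  refine lc_ext fun n => ?_
  rw [exp_eq_expL, exp_eq_expL, lc_mul_expL _ hs, lc_expL_mul _ hr]
  simp only [hk]

theorem lc_adj (M : Loop L) (i : ℕ) : lc M.adj i = (-1 : ℂ) ^ i • (lc M i).transpose := by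
  ext α β
  simp [lc, Loop.adj, PowerSeries.evalNegHom]

theorem adj_exp {r : Loop L} (hr : Ord 1 r) : r.exp.adj = Loop.exp r.adj := by
  have hk : ∀ k, Loop.adj (r ^ k) = r.adj ^ k := fun k => by
    induction k with
    | zero => exact Loop.adj_one
    | succ k ih => rw [pow_succ, Loop.adj_mul, ih, pow_succ']
  have hr' : Ord 1 r.adj := fun i hi => by rw [lc_adj, hr i hi]; simp
  refine lc_ext fun n => ?_
  rw [lc_adj, lc_exp hr (Nat.lt_succ_self n), lc_exp hr' (Nat.lt_succ_self n), Matrix.transpose_sum,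
    Finset.smul_sum]
  refine Finset.sum_congr rfl fun k _ => ?_
  rw [← hk, lc_adj, Matrix.transpose_smul, smul_comm]

theorem corner_exp {r : Loop (N + 1)} (hr : Ord 1 r)
    (hc : ∀ α : Fin N, r α.castSucc (Fin.last N) = 0) : r.exp.corner = Loop.exp r.corner := by
  have hk : ∀ k, Loop.corner (r ^ k) = r.corner ^ k := fun k => by
    induction k with
    | zero => exact Loop.corner_one
    | succ k ih =>
      rw [pow_succ', pow_succ', ← ih]
      ext1 α β
      simp only [Loop.corner, Matrix.submatrix_apply, Matrix.mul_apply, Fin.sum_univ_castSucc, hc,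
        zero_mul, add_zero]
  have hl : ∀ (M : Loop (N + 1)) i, lc M.corner i = (lc M i).submatrix Fin.castSucc Fin.castSucc :=
    fun M i => rfl
  have hr' : Ord 1 r.corner := fun i hi => by rw [hl, hr i hi]; rfl
  refine lc_ext fun n => ?_
  rw [hl, lc_exp hr (Nat.lt_succ_self n), lc_exp hr' (Nat.lt_succ_self n)]
  ext α β
  simp only [Matrix.submatrix_apply, Matrix.sum_apply, Matrix.smul_apply, ← hk, hl]

/-- The Lie algebra of the group of open loops. -/
structure IsOpenLie (η : Matrix (Fin N) (Fin N) ℂ) (r : Loop (N + 1)) : Prop where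
  ord : Ord 1 r
  last_col : ∀ i α, r.coeff i α (Fin.last N) = 0
  symp : IsSympLoop η r.coeff

theorem isSympLoop_iff {η : Matrix (Fin N) (Fin N) ℂ} {r : Loop (N + 1)} : IsSympLoop η r.coeff ↔
    r.corner.adj * η.map PowerSeries.C = η.map PowerSeries.C * -r.corner := by
  have h1 : ∀ i α μ, lc (r.corner.adj * η.map PowerSeries.C) i α μ =
      (-1) ^ i * ∑ κ, r.coeff i κ.castSucc α.castSucc * η κ μ := fun i α μ => by
    simp only [lc, Matrix.map_apply, Matrix.mul_apply, map_sum, PowerSeries.coeff_mul_C,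
      Finset.mul_sum]
    refine Finset.sum_congr rfl fun κ _ => ?_
    have := congrFun (congrFun (lc_adj r.corner i) α) κ
    rw [show PowerSeries.coeff i (r.corner.adj α κ) = _ from this, ← mul_assoc]
    rfl
  have h2 : ∀ i α μ, lc (η.map PowerSeries.C * -r.corner) i α μ =
      -∑ κ, η α κ * r.coeff i κ.castSucc μ.castSucc := fun i α μ => by
    simp only [lc, Matrix.map_apply, Matrix.mul_apply, map_sum, PowerSeries.coeff_C_mul,
      ← Finset.sum_neg_distrib]
    refine Finset.sum_congr rfl fun κ _ => ?_
    rw [Matrix.neg_apply, map_neg, mul_neg]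
    rfl
  have h3 : ∀ (i : ℕ) (x y : ℂ), (-1) ^ i * x = -y ↔ x + (-1) ^ i * y = 0 := fun i x y => by
    rcases neg_one_pow_eq_or ℂ i with h | h <;> rw [h] <;> constructor <;> intro h <;>
      first | linear_combination h | linear_combination -h
  constructor
  · intro h
    refine lc_ext fun i => ?_
    ext α μ
    rw [h1, h2, h3]
    exact h i α μ
  · intro h i α μ
    rw [← h3, ← h1, ← h2, h]

theorem IsOpenLie.openLoop {η : Matrix (Fin N) (Fin N) ℂ} {r : Loop (N + 1)} (h : IsOpenLie η r) :
    IsOpenLoop η r.exp := by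
  have hcol : ∀ α, r α (Fin.last N) = 0 := fun α => by
    ext i
    exact h.last_col i α
  have hcc : Ord 1 r.corner := fun i hi => by
    ext α β
    exact congrFun (congrFun (h.ord i hi) α.castSucc) β.castSucc
  have hca : Ord 1 r.corner.adj := fun i hi => by rw [lc_adj, hcc i hi]; simp
  have hcn : Ord 1 (-r.corner) := fun i hi => by rw [lc_neg, hcc i hi, neg_zero]
  refine ⟨?_, ?_, fun i α hi => ?_⟩
  · rw [exp_eq_expL]
    exact lc_expL_zero _ _
  · rw [IsSymplectic, corner_exp h.ord fun α => hcol _, adj_exp hcc,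
      exp_conj hca hcn (isSympLoop_iff.1 h.symp), mul_assoc]
    have := exp_mul_exp_neg hcn
    rw [neg_neg] at this
    rw [this, mul_one]
  · change lc r.exp i α (Fin.last N) = 0
    rw [lc_exp h.ord (Nat.lt_succ_self i), Matrix.sum_apply]
    refine Finset.sum_eq_zero fun k _ => ?_
    rw [Matrix.smul_apply]
    cases k with
    | zero => rw [pow_zero, lc_one, if_neg (by omega)]; simp
    | succ k =>
      have : (r ^ (k + 1)) α (Fin.last N) = 0 := by
        rw [pow_succ, Matrix.mul_apply]
        exact Finset.sum_eq_zero fun β _ => by rw [hcol, mul_zero]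
      simp [lc, this]

/-- For the last column, induct on the order: in `exp r` the powers beyond the first contribute to
order `n` only through last columns of lower coefficients. For the metric, the symplectic condition
equates the exponentials of `-r` and of the `η`-adjoint of `r` on the corner, and `exp_injective`
removes the exponentials. -/
theorem isOpenLie_of_exp {η : Matrix (Fin N) (Fin N) ℂ} (hη : IsUnit η.det) {r : Loop (N + 1)}
    (hr : Ord 1 r) (h : IsOpenLoop η r.exp) : IsOpenLie η r := by
  have hlast : ∀ i α, lc r i α (Fin.last N) = 0 := fun i => by
    induction i using Nat.strong_induction_on with
    | _ n ih =>
      intro α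
      rcases Nat.eq_zero_or_pos n with rfl | hn
      · rw [ord_one_iff.1 hr]
        rfl
      have h1 : lc r.exp n α (Fin.last N) = 0 := h.last_col n α hn
      rw [lc_exp hr (B := n + 2) (by omega), Finset.sum_range_succ', Finset.sum_range_succ',
        pow_zero, lc_one, if_neg hn.ne', Matrix.add_apply, Matrix.add_apply, Matrix.sum_apply,
        Finset.sum_eq_zero] at h1
      · simpa using h1
      intro k _
      rw [Matrix.smul_apply, pow_succ, lc_mul, Matrix.sum_apply, Finset.sum_eq_zero, smul_zero]
      intro p hp
      have hp := Finset.HasAntidiagonal.mem_antidiagonal.1 hp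
      rcases Nat.eq_zero_or_pos p.1 with h0 | h0
      · rw [h0, (hr.pow (k + 1)) 0 (by omega), zero_mul]
        rfl
      · rw [Matrix.mul_apply]
        exact Finset.sum_eq_zero fun β _ => by rw [ih p.2 (by omega), mul_zero]
  refine ⟨hr, hlast, isSympLoop_iff.2 ?_⟩
  have hcol : ∀ α, r α (Fin.last N) = 0 := fun α => by
    ext i
    exact hlast i α
  have hcc : Ord 1 r.corner := fun i hi => by
    ext α β
    exact congrFun (congrFun (hr i hi) α.castSucc) β.castSucc
  have hca : Ord 1 r.corner.adj := fun i hi => by rw [lc_adj, hcc i hi]; simp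
  have hcn : Ord 1 (-r.corner) := fun i hi => by rw [lc_neg, hcc i hi, neg_zero]
  have hs := h.symplectic
  rw [IsSymplectic, corner_exp hr fun α => hcol _, adj_exp hcc] at hs
  set H : Loop N := η.map PowerSeries.C with hH
  have hu : IsUnit H := by
    rw [Matrix.isUnit_iff_isUnit_det]
    have h1 : PowerSeries.C η.det = H.det := RingHom.map_det PowerSeries.C η
    rw [← h1]
    exact hη.map _
  obtain ⟨P, hP, hP'⟩ := isUnit_iff_exists.1 hu
  have h1 : Loop.exp r.corner.adj * H = H * Loop.exp (-r.corner) := by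
    have := exp_mul_exp_neg hcc
    calc _ = Loop.exp r.corner.adj * H * (Loop.exp r.corner * Loop.exp (-r.corner)) := by
          rw [this, mul_one]
      _ = _ := by rw [← mul_assoc, hs]
  have hord : Ord 1 (P * r.corner.adj * H) := by
    have := ((show Ord 0 P from fun i hi => absurd hi (by omega)).mul hca).mul
      (show Ord 0 H from fun i hi => absurd hi (by omega))
    exact this
  have h2 := exp_conj hca hord (P := H) (by rw [← mul_assoc, ← mul_assoc, hP, one_mul])
  rw [h1] at h2
  have h3 : Loop.exp (-r.corner) = Loop.exp (P * r.corner.adj * H) := by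
    have := congrArg (P * ·) h2
    simpa only [← mul_assoc, hP', one_mul] using this
  rw [exp_injective hcn hord h3, ← mul_assoc, ← mul_assoc, hP, one_mul]

end LieAlgebra

section Preservation

variable {N : ℕ} {A : Fin (N + 1) → ℂ} {η : Matrix (Fin N) (Fin N) ℂ}

/-! ### Open-closed sequences are preserved by open loops -/

theorem mapLV_const_nat {J : LV (N + 1) TT} {F : VecSeq (N + 1)}
    (h : mapLV evθ J = mapLV Polynomial.C (Jof A F)) (a : ℤ) (α : Fin (N + 1)) :
    MvPowerSeries.map evθ (J a α) = MvPowerSeries.map Polynomial.C (Jof A F a α) := by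
  have := congrArg (fun w : LV (N + 1) (Polynomial ℂ) => w a α) h
  simpa only [mapLV_apply] using this

theorem IsOpenClosed.seqAt (hη : η.IsSymm) {F : VecSeq (N + 1)} (hoc : IsOpenClosed η F)
    {r : Loop (N + 1)} (hr : IsOpenLie η r) {J : LV (N + 1) TT}
    (hJ : IsCone (fun α => algebraMap ℂ TT (A α)) J) (hfl : IsFlow dθ (constTT r) J)
    (h0 : mapLV evθ J = mapLV Polynomial.C (Jof A F)) (θ s : ℂ) :
    IsOpenClosed η (OpenGivental.seqAt J θ s) := by
  have hρ0 := constTT_zero hr.ord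
  have hlast : ∀ i (α : Fin N), constTT r i α.castSucc (Fin.last N) = 0 := fun i α => by
    rw [constTT, Matrix.map_apply, hr.last_col, map_zero]
  have hind : ∀ (b : ℕ) (a : ℤ) (α : Fin N), pderiv TT (Fin.last N, b) (J a α.castSucc) = 0 := by
    refine hfl.indep hJ.graph hJ.lev hρ0 isClock_dθ hlast fun b a α => ?_
    rw [map_pderiv', mapLV_const_nat h0, ← map_pderiv']
    cases a with
    | ofNat a =>
      rw [show Jof A F (Int.ofNat a) α.castSucc = _ from Jof_nat .., hoc.indep, map_zero]
    | negSucc n =>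
      have h1 : pderiv ℂ (Fin.last N, b) (Jof A F (Int.negSucc n) α.castSucc) = 0 := by
        rw [Jof_apply, ext_negSucc, q, Derivation.map_smul, map_sub, pderiv_C, sub_zero,
          pderiv_X_of_ne, smul_zero]
        exact fun h => (Fin.castSucc_lt_last α).ne (congrArg Prod.fst h)
      rw [h1, map_zero]
  have hs : IsSympLoop (η.map (algebraMap ℂ TT)) (constTT r) := fun i α μ => by
    have := congrArg (algebraMap ℂ TT) (hr.symp i α μ)
    simp only [map_add, map_mul, map_sum, map_pow, map_neg, map_one, map_zero] at this
    exact this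
  have hcl := hfl.closed (η := η.map (algebraMap ℂ TT)) hJ.graph hJ.lev hρ0 isClock_dθ
    (fun α μ => dθ_algebraMap _) hlast hs hind fun β α b a => by
      have h1 := congrArg (MvPowerSeries.map Polynomial.C) (hoc.closed α β a b)
      rw [← sub_eq_zero]  at h1
      simp only [map_sum, map_smul', map_pderiv'] at h1
      simp only [map_sub, map_sum, map_smul', map_pderiv', mapLV_const_nat h0, Jof_nat, Matrix.map_apply]
      rw [← h1]
      have h2 : ∀ c : ℂ, evθ (algebraMap ℂ TT c) = Polynomial.C c := fun c => by
        simp [Polynomial.algebraMap_apply]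
      simp only [h2]
      congr 1
      exact Finset.sum_congr rfl fun μ _ => by rw [hη.apply]
  constructor
  · intro b a α
    rw [OpenGivental.seqAt, mapLV_apply, ← map_pderiv', hind, map_zero]
  · intro α β a b
    have := congrArg (MvPowerSeries.map (evK θ s)) (hcl β α b a)
    simp only [map_sub, map_sum, map_smul', map_pderiv', Matrix.map_apply, evK_algebraMap, map_zero] at this
    rw [sub_eq_zero] at this
    simp only [OpenGivental.seqAt, mapLV_apply]
    rw [← this]
    exact Finset.sum_congr rfl fun μ _ => by rw [hη.apply]

theorem ActsTo.isOpenClosed (hη : η.IsSymm) (hη' : IsUnit η.det) {F F' : VecSeq (N + 1)}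
    {R : Loop (N + 1)} (h : ActsTo A R F F') (hR : IsOpenLoop η R) (hoc : IsOpenClosed η F) :
    IsOpenClosed η F' := by
  obtain ⟨r, hr, rfl⟩ := exists_log hR.coeff_zero
  have hr1 : Ord 1 r := ord_one_iff.2 hr
  obtain ⟨J, h1, h2, h3, h4⟩ := exists_flow_const h.ancestor_left hr1
  rw [h.unique h4]
  exact hoc.seqAt hη (isOpenLie_of_exp hη' hr1 hR) h1 h2 h3 1 0

theorem Lev.constantCoeff_pd_pd {L : ℕ} {A : Fin L → ℂ} {F F' : VecSeq L}
    (h : Lev 3 (Jof A F' - Jof A F)) (α β γ : Fin L) :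
    constantCoeff (pd β 0 (pd γ 0 (F' 0 α))) = constantCoeff (pd β 0 (pd γ 0 (F 0 α))) := by
  simp only [← coeff_zero_eq_constantCoeff_apply, coeff_pderiv]
  rw [lev_sub_iff.1 h 0 α _ (by
    rw [map_add, map_add, map_zero, wt_single, wt_single]
    norm_num)]

end Preservation

/-! ### Small phase space and semisimple tangent algebra -/

section SmallPhase

variable {L : ℕ}

/-! ### Derivatives along the small phase space -/

/-- The derivative along a constant vector field on the small phase space. -/
def sd (v : Fin L → ℂ) : Derivation ℂ (Ser L) (Ser L) := ∑ β, v β • pderiv ℂ (β, 0)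

theorem sd_apply (v : Fin L → ℂ) (g : Ser L) : sd v g = ∑ β, v β • pd β 0 g := by
  rw [sd]
  change (Derivation.coeFnAddMonoidHom (∑ β, v β • pderiv ℂ (β, 0))) g = _
  rw [map_sum, Finset.sum_apply]
  rfl

theorem sd_mul (v : Fin L → ℂ) (f g : Ser L) : sd v (f * g) = sd v f * g + f * sd v g := by
  rw [Derivation.leibniz, smul_eq_mul, smul_eq_mul]
  ring

theorem sd_add_left (u v : Fin L → ℂ) (g : Ser L) : sd (u + v) g = sd u g + sd v g := by
  simp only [sd_apply, Pi.add_apply, add_smul, Finset.sum_add_distrib]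

theorem sd_smul_left (c : ℂ) (v : Fin L → ℂ) (g : Ser L) : sd (c • v) g = c • sd v g := by
  simp only [sd_apply, Pi.smul_apply, smul_eq_mul, mul_smul, Finset.smul_sum]

theorem sd_zero_left (g : Ser L) : sd (0 : Fin L → ℂ) g = 0 := by
  simp [sd_apply]

theorem sd_sum_left {ι : Type} (s : Finset ι) (v : ι → Fin L → ℂ) (g : Ser L) :
    sd (∑ i ∈ s, v i) g = ∑ i ∈ s, sd (v i) g := by
  simp only [sd_apply, Finset.sum_apply, Finset.sum_smul]
  rw [Finset.sum_comm]

theorem sd_single [DecidableEq (Fin L)] (β : Fin L) (g : Ser L) :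
    sd (Pi.single β 1) g = pd β 0 g := by
  rw [sd_apply, Finset.sum_eq_single β]
  · simp
  · intro γ _ h
    simp [h]
  · simp

theorem sd_pderiv (v : Fin L → ℂ) (j : Fin L × ℕ) (g : Ser L) :
    sd v (pderiv ℂ j g) = pderiv ℂ j (sd v g) := by
  simp only [sd_apply, map_sum, Derivation.map_smul, pderiv_pderiv_comm j]

theorem sd_sd (u v : Fin L → ℂ) (g : Ser L) : sd u (sd v g) = sd v (sd u g) := by
  rw [sd_apply u, sd_apply u, map_sum]
  simp only [Derivation.map_smul, sd_pderiv]

/-- The iterated derivative along a list of vectors. -/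
def sds : List (Fin L → ℂ) → Ser L →ₗ[ℂ] Ser L
  | [] => LinearMap.id
  | v :: l => sds l ∘ₗ (sd v).toLinearMap

@[simp] theorem sds_nil (g : Ser L) : sds [] g = g := rfl

theorem sds_cons (v : Fin L → ℂ) (l : List (Fin L → ℂ)) (g : Ser L) :
    sds (v :: l) g = sds l (sd v g) := rfl

theorem sds_sd (l : List (Fin L → ℂ)) (v : Fin L → ℂ) (g : Ser L) :
    sds l (sd v g) = sd v (sds l g) := by
  induction l generalizing g with
  | nil => rfl
  | cons u l ih => rw [sds_cons, sds_cons, sd_sd, ih]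

theorem sds_pderiv (l : List (Fin L → ℂ)) (j : Fin L × ℕ) (g : Ser L) :
    sds l (pderiv ℂ j g) = pderiv ℂ j (sds l g) := by
  induction l generalizing g with
  | nil => rfl
  | cons u l ih => rw [sds_cons, sds_cons, sd_pderiv, ih]

theorem sds_perm {l l' : List (Fin L → ℂ)} (h : l.Perm l') (g : Ser L) : sds l g = sds l' g := by
  induction h generalizing g with
  | nil => rfl
  | cons v _ ih => rw [sds_cons, sds_cons, ih]
  | swap u v l => rw [sds_cons, sds_cons, sds_cons, sds_cons, sd_sd]
  | trans _ _ ih ih' => rw [ih, ih']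

theorem Lvl.sd {n : ℤ} {g : Ser L} (h : Lvl n g) (v : Fin L → ℂ) :
    Lvl (n - 1) (OpenGivental.sd v g) := by
  rw [sd_apply]
  exact Lvl.sum _ fun β _ => ((h.pderiv (β, 0)).mono (by simp)).smul _

theorem Lvl.sds {n : ℤ} {g : Ser L} (h : Lvl n g) (l : List (Fin L → ℂ)) :
    Lvl (n - l.length) (OpenGivental.sds l g) := by
  induction l generalizing n g with
  | nil => simpa using h
  | cons v l ih =>
    rw [sds_cons]
    exact (ih (h.sd v)).mono (by rw [List.length_cons]; omega)

theorem Lvl.constantCoeff {n : ℤ} {g : Ser L} (h : Lvl n g) (hn : 0 < n) :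
    MvPowerSeries.constantCoeff g = 0 := by
  rw [← coeff_zero_eq_constantCoeff_apply]
  exact h 0 (by simpa using hn)

/-- Power series whose derivatives of order less than `n` along vectors in `V` vanish at the
origin. -/
def Sm (V : Set (Fin L → ℂ)) (n : ℕ) (g : Ser L) : Prop :=
  ∀ l : List (Fin L → ℂ), (∀ v ∈ l, v ∈ V) → l.length < n → constantCoeff (sds l g) = 0

variable {V : Set (Fin L → ℂ)}

theorem Lvl.sm {n : ℤ} {k : ℕ} {g : Ser L} (h : Lvl n g) (hk : k ≤ n) : Sm V k g := fun l _ hl =>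
  (h.sds l).constantCoeff (by omega)

theorem Sm.mono {n k : ℕ} {g : Ser L} (h : Sm V n g) (hk : k ≤ n) : Sm V k g :=
  fun l hl hln => h l hl (by omega)

theorem Sm.sd {n : ℕ} {g : Ser L} (h : Sm V n g) {v : Fin L → ℂ} (hv : v ∈ V) :
    Sm V (n - 1) (OpenGivental.sd v g) := fun l hl hln =>
  h (v :: l) (by simpa [hv] using hl) (by rw [List.length_cons]; omega)

theorem Sm.mul {a b : ℕ} {f g : Ser L} (hf : Sm V a f) (hg : Sm V b g) : Sm V (a + b) (f * g) := by
  intro l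
  induction l generalizing a b f g with
  | nil =>
    intro _ hl
    rw [sds_nil, map_mul]
    rcases Nat.eq_zero_or_pos a with rfl | ha
    · have := hg [] (by simp) (by simpa using hl)
      rw [sds_nil] at this
      rw [this, mul_zero]
    · have := hf [] (by simp) ha
      rw [sds_nil] at this
      rw [this, zero_mul]
  | cons v l ih =>
    intro hv hl
    rw [List.length_cons] at hl
    have hv' : ∀ v ∈ l, v ∈ V := fun u hu => hv u (List.mem_cons_of_mem v hu)
    have hvV := hv v List.mem_cons_self
    rw [sds_cons, sd_mul, map_add, map_add, ih (hf.sd hvV) hg hv' (by omega),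
      ih hf (hg.sd hvV) hv' (by omega), add_zero]

/-- Since `g` vanishes to order `n`, a product rule term in which any of the `n` derivatives falls
on `f` vanishes at the origin. -/
theorem Sm.constantCoeff_mul {n : ℕ} {g : Ser L} (h : Sm V n g) (f : Ser L)
    {l : List (Fin L → ℂ)} (hl : ∀ v ∈ l, v ∈ V) (hn : l.length = n) :
    constantCoeff (sds l (g * f)) = constantCoeff (sds l g) * constantCoeff f := by
  induction l generalizing n g with
  | nil => rw [sds_nil, sds_nil, map_mul]
  | cons v l ih =>
    rw [List.length_cons] at hn
    have hv' : ∀ v ∈ l, v ∈ V := fun u hu => hl u (List.mem_cons_of_mem v hu)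
    have h0 : Sm V n (g * OpenGivental.sd v f) :=
      h.mul (b := 0) fun _ _ h => absurd h (by omega)
    rw [sds_cons, sd_mul, map_add, map_add, ih (h.sd (hl v List.mem_cons_self)) hv' (by omega),
      h0 l hv' (by omega), add_zero, sds_cons]

theorem Sm.constantCoeff_mul' {n : ℕ} {g : Ser L} (h : Sm V n g) (f : Ser L)
    {l : List (Fin L → ℂ)} (hl : ∀ v ∈ l, v ∈ V) (hn : l.length = n) :
    constantCoeff (sds l (f * g)) = constantCoeff f * constantCoeff (sds l g) := by
  rw [mul_comm, h.constantCoeff_mul f hl hn, mul_comm]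

/-- Derivatives along arbitrary vectors are determined by those along a spanning family. -/
theorem apply_sds_of_span {ι : Type} [Fintype ι] {e : ι → Fin L → ℂ}
    {χ : ι → (Fin L → ℂ) → ℂ} (he : ∀ v, v = ∑ i, χ i v • e i) (φ : Ser L →ₗ[ℂ] ℂ) (n : ℕ) (f : Ser L)
    (h : ∀ l : List ι, l.length = n → φ (sds (l.map e) f) = 0) (l : List (Fin L → ℂ))
    (hl : l.length = n) : φ (sds l f) = 0 := by
  induction n generalizing f l with
  | zero =>
    obtain rfl := List.length_eq_zero_iff.1 hl
    exact h [] rfl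
  | succ n ih =>
    obtain ⟨v, l, rfl⟩ := List.exists_cons_of_length_eq_add_one hl
    rw [sds_cons, he v, sd_sum_left, map_sum, map_sum]
    refine Finset.sum_eq_zero fun i _ => ?_
    rw [sd_smul_left, map_smul, map_smul, ih (sd (e i) f) (fun l' hl' => h (i :: l') (by simp [hl'])) l
      (by simpa using hl), smul_zero]

end SmallPhase

section SmallEquations

variable {L : ℕ} {A : Fin L → ℂ} {F : VecSeq L}

/-! ### The equations along the small phase space -/

theorem IsDescendant.hess_sd (h : IsDescendant A F) (a : ℕ) (α : Fin L) (u v : Fin L → ℂ) :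
    sd u (sd v (F (a + 1) α)) = ∑ μ, sd u (sd v (F 0 μ)) * pd μ 0 (F a α) := by
  have e : ∀ g : Ser L, sd u (sd v g) = ∑ β, ∑ γ, (u β * v γ) • pd β 0 (pd γ 0 g) := fun g => by
    rw [sd_apply, sd_apply]
    simp only [pd, map_sum, Derivation.map_smul, Finset.smul_sum, smul_smul]
  simp only [e, pd, h.hess, Finset.sum_mul, Finset.smul_sum, smul_mul_assoc]
  conv_rhs => rw [Finset.sum_comm]
  exact Finset.sum_congr rfl fun β _ => Finset.sum_comm

/-- Compute a third derivative of `F 1` by `hess_sd` in two orders. The terms with third derivatives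
of `F 0` coincide, and the remaining ones form the associativity equation. -/
theorem IsDescendant.assoc_sd (h : IsDescendant A F) (α : Fin L) (u v w : Fin L → ℂ) :
    ∑ μ, sd u (sd v (F 0 μ)) * pd μ 0 (sd w (F 0 α)) =
      ∑ μ, sd w (sd v (F 0 μ)) * pd μ 0 (sd u (F 0 α)) := by
  have h1 : ∀ u w, sd w (sd u (sd v (F 1 α))) = ∑ μ, sd w (sd u (sd v (F 0 μ))) * pd μ 0 (F 0 α) +
      ∑ μ, sd u (sd v (F 0 μ)) * pd μ 0 (sd w (F 0 α)) := fun u w => by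
    rw [h.hess_sd, map_sum, ← Finset.sum_add_distrib]
    exact Finset.sum_congr rfl fun μ _ => by rw [sd_mul, sd_pderiv]
  have h2 := sd_sd w u (sd v (F 1 α))
  rw [h1, h1] at h2
  simp only [sd_sd w u] at h2
  exact add_left_cancel h2

theorem IsDescendant.trr_sd (h : IsDescendant A F) (α β : Fin L) (b : ℕ) (w : Fin L → ℂ) :
    pd β (b + 1) (sd w (F 0 α)) = ∑ μ, pd β b (F 0 μ) * pd μ 0 (sd w (F 0 α)) := by
  simp only [sd_apply w, pd, map_sum, Derivation.map_smul, Finset.mul_sum, mul_smul_comm]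
  rw [Finset.sum_comm]
  refine Finset.sum_congr rfl fun γ _ => ?_
  have := h.trr_all 0 α (β, b) (γ, 0)
  simp only [pd] at this
  rw [this, Finset.smul_sum]

/-- The string equation along the small phase space. -/
theorem IsDescendant.string_sd (h : IsDescendant A F) (α : Fin L) (l : List (Fin L → ℂ)) :
    constantCoeff (sds l (sd A (F 0 α))) = constantCoeff (sds l (X (α, 0) : Ser L)) := by
  set J := Jof A F with hJ
  have hp : ∀ j : Fin L × ℕ, posC (zInv J) j = q A j.1 (j.2 + 1) := fun j => by
    have h := isGraph_Jof (A := A) (F := F) (j.1, j.2 + 1)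
    rw [q, ← h, posC, posC, zInv_apply, pow_succ, show Int.negSucc j.2 - 1 =
      Int.negSucc (j.2 + 1) by omega]
    ring
  have h1 : dir (zInv J) (F 0 α) = -X (α, 0) := by
    have := congrArg (fun w : LV L ℂ => w (0 : ℕ) α) (string_iff.2 h.string)
    simp only [nrm_apply, LV.sub_apply, LV.zero_apply, act_apply, sub_eq_zero] at this
    rw [Jof_nat] at this
    rw [← this, zInv_apply, Jof_apply]
    change -VecSeq.ext A F (Int.negSucc 0) α = _
    rw [ext_negSucc, q]
    simp
  -- The components `q_{b+1}` of the string vector field do not involve the small variables, so it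
  -- commutes with small derivatives.
  have h2 : ∀ β g, dir (zInv J) (pd β 0 g) = pd β 0 (dir (zInv J) g) := fun β g => by
    have : ⁅dir (zInv J), cvf (β, 0)⁆ = 0 := vf_ext fun j => by
      rw [vf_lie, cvf_apply, cvf_apply, pderiv_X, dir_X, hp, q, map_sub, pderiv_C, pderiv_X_of_ne,
        sub_zero, sub_zero]
      · rw [Pi.single_apply]
        split_ifs
        · rw [← map_one (C (σ := Fin L × ℕ) (R := ℂ)), vf_C]
          rfl
        · rw [map_zero]
          rfl
      · exact fun h => absurd (congrArg Prod.snd h) (by simp)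
    have h3 := congrArg (fun δ : vf L ℂ => δ g) this
    rw [vf_lie, cvf_apply, cvf_apply] at h3
    exact sub_eq_zero.1 h3
  have h3 : ∀ v g, dir (zInv J) (sd v g) = sd v (dir (zInv J) g) := fun v g => by
    rw [sd_apply, sd_apply, map_sum]
    exact Finset.sum_congr rfl fun β _ => by rw [vf_smul, h2]
  have h4 : ∀ g, dir (zInv J) (sds l g) = sds l (dir (zInv J) g) := by
    induction l with
    | nil => exact fun g => rfl
    | cons v l ih => exact fun g => by rw [sds_cons, ih, h3, sds_cons]
  -- At the origin the only nonzero components are `q_1 = -A`, in front of the small derivatives.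
  have h5 : ∀ g, constantCoeff (dir (zInv J) g) = -constantCoeff (sd A g) := fun g => by
    rw [← coeff_zero_eq_constantCoeff_apply]
    obtain ⟨B, hB⟩ := dir_coeff (zInv J) 0
    rw [hB (B + 1) (by omega), Finset.sum_range_succ', coeff_zero_eq_constantCoeff_apply, map_add,
      map_sum, Finset.sum_eq_zero, zero_add, sd_apply, map_sum, map_sum, ← Finset.sum_neg_distrib]
    · refine Finset.sum_congr rfl fun β _ => ?_
      rw [hp, q]
      simp
    · intro b _
      rw [map_sum]
      refine Finset.sum_eq_zero fun β _ => ?_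
      rw [hp, q]
      simp
  rw [sds_sd, ← neg_inj, ← h5, h4, h1, map_neg, map_neg]

/-- The product on the tangent space at the origin. -/
def tmul (F : VecSeq L) (u v : Fin L → ℂ) : Fin L → ℂ :=
  fun α => constantCoeff (sd u (sd v (F 0 α)))

theorem tmul_comm (u v : Fin L → ℂ) : tmul F u v = tmul F v u :=
  funext fun α => by rw [tmul, sd_sd]; rfl

theorem tmul_eq_algMul (u v : Fin L → ℂ) : tmul F u v =
    algMul (fun α β γ => constantCoeff (pd β 0 (pd γ 0 (F 0 α)))) u v := by
  funext α
  rw [tmul, algMul, sd_apply, map_sum]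
  refine Finset.sum_congr rfl fun β _ => ?_
  rw [sd_apply, pd, map_sum, Finset.smul_sum, map_sum]
  refine Finset.sum_congr rfl fun γ _ => ?_
  rw [Derivation.map_smul, constantCoeff_smul, constantCoeff_smul, smul_eq_mul, smul_eq_mul]
  ring

theorem sum_mul_constantCoeff_pd (v : Fin L → ℂ) (g : Ser L) :
    ∑ μ, v μ * constantCoeff (pd μ 0 g) = constantCoeff (sd v g) := by
  rw [sd_apply, map_sum]
  exact Finset.sum_congr rfl fun μ _ => by rw [constantCoeff_smul, smul_eq_mul]

end SmallEquations

section Semisimple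

/-! ### Semisimple algebras -/

/-- A reduced Artinian ring is the product of its residue fields, and a finite extension of the
algebraically closed field `ℂ` is trivial. -/
theorem exists_algEquiv_pi (V : Type) [CommRing V] [Algebra ℂ V] [Module.Finite ℂ V]
    [IsReduced V] : ∃ (ι : Type) (_ : Fintype ι), Nonempty (V ≃ₐ[ℂ] (ι → ℂ)) := by
  have : IsArtinianRing V := IsArtinianRing.of_finite ℂ V
  have : Finite (MaximalSpectrum V) := inferInstance
  let _ := Fintype.ofFinite (MaximalSpectrum V)
  refine ⟨MaximalSpectrum V, inferInstance, ⟨((IsArtinianRing.equivPi V).restrictScalars ℂ).trans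
    (AlgEquiv.piCongrRight fun I => ?_)⟩⟩
  have := Ideal.Quotient.isDomain I.asIdeal
  exact (AlgEquiv.ofBijective (Algebra.ofId ℂ (V ⧸ I.asIdeal))
    IsAlgClosed.algebraMap_bijective_of_isIntegral).symm

variable {L : ℕ}

/-- A commutative, associative and unital product on `ℂ^L`. -/
structure TangentProduct (L : ℕ) where
  /-- The product. -/
  mul : (Fin L → ℂ) →ₗ[ℂ] (Fin L → ℂ) →ₗ[ℂ] (Fin L → ℂ)
  /-- The unit. -/
  one : Fin L → ℂ
  comm : ∀ u v, mul u v = mul v u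
  assoc : ∀ u v w, mul (mul u v) w = mul u (mul v w)
  one_mul : ∀ v, mul one v = v

/-- The space `ℂ^L` with the given product. -/
def TangentProduct.Carrier (_ : TangentProduct L) : Type := Fin L → ℂ

instance (d : TangentProduct L) : AddCommGroup d.Carrier :=
  inferInstanceAs (AddCommGroup (Fin L → ℂ))

instance (d : TangentProduct L) : Module ℂ d.Carrier := inferInstanceAs (Module ℂ (Fin L → ℂ))

instance (d : TangentProduct L) : Module.Finite ℂ d.Carrier :=
  inferInstanceAs (Module.Finite ℂ (Fin L → ℂ))

instance (d : TangentProduct L) : CommRing d.Carrier where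
  mul u v := d.mul u v
  one := d.one
  left_distrib u v w := (d.mul u).map_add v w
  right_distrib u v w := d.mul.map_add₂ u v w
  zero_mul v := d.mul.map_zero₂ v
  mul_zero v := (d.mul v).map_zero
  mul_assoc := d.assoc
  one_mul := d.one_mul
  mul_one v := (d.comm v d.one).trans (d.one_mul v)
  mul_comm := d.comm
  zsmul := fun n v => n • v
  zsmul_zero' := fun v => zero_zsmul v
  zsmul_succ' := fun n v => SubNegMonoid.zsmul_succ' n v
  zsmul_neg' := fun n v => SubNegMonoid.zsmul_neg' n v
  nsmul := fun n v => n • v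
  nsmul_zero := fun v => zero_nsmul v
  nsmul_succ := fun n v => succ_nsmul v n
  sub_eq_add_neg := sub_eq_add_neg
  neg_add_cancel := neg_add_cancel

instance (d : TangentProduct L) : Algebra ℂ d.Carrier :=
  Algebra.ofModule (fun c u v => d.mul.map_smul₂ c u v) fun c u v => (d.mul u).map_smul c v

theorem TangentProduct.isReduced (d : TangentProduct L)
    (h : ∀ (v : Fin L → ℂ) (k : ℕ), (d.mul v)^[k] v = 0 → v = 0) : IsReduced d.Carrier where
  eq_zero v := by
    rintro ⟨k, hk⟩
    have h1 : ∀ (v : Fin L → ℂ) (k : ℕ), @Eq d.Carrier ((d.mul v)^[k] v)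
        (@HPow.hPow d.Carrier ℕ d.Carrier _ v (k + 1)) := fun v k => by
      induction k with
      | zero => exact (pow_one (M := d.Carrier) v).symm
      | succ k ih =>
        exact (Function.iterate_succ_apply' (d.mul v) k v).trans
          ((congrArg (d.mul v) ih).trans (pow_succ' (M := d.Carrier) v (k + 1)).symm)
    have h2 : v ^ (k + 1) = 0 := by rw [pow_succ, hk, zero_mul]
    exact h v k ((h1 v k).trans h2)

/-- A basis of orthogonal idempotents for a product with unit `A`, with the dual characters. -/
structure IsIdempotentBasis {ι : Type} [Fintype ι] [DecidableEq ι]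
    (m : (Fin L → ℂ) → (Fin L → ℂ) → Fin L → ℂ) (A : Fin L → ℂ) (e : ι → Fin L → ℂ)
    (χ : ι → (Fin L → ℂ) →ₗ[ℂ] ℂ) : Prop where
  char_idem : ∀ k i, χ k (e i) = if k = i then 1 else 0
  sum : ∀ v, v = ∑ i, χ i v • e i
  mul : ∀ k u v, χ k (m u v) = χ k u * χ k v
  one : ∀ k, χ k A = 1

theorem TangentProduct.exists_basis (d : TangentProduct L)
    (h : ∀ (v : Fin L → ℂ) (k : ℕ), (d.mul v)^[k] v = 0 → v = 0) :
    ∃ (ι : Type) (_ : Fintype ι) (_ : DecidableEq ι) (e : ι → Fin L → ℂ)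
      (χ : ι → (Fin L → ℂ) →ₗ[ℂ] ℂ), IsIdempotentBasis (fun u v => d.mul u v) d.one e χ := by
  classical
  have := d.isReduced h
  obtain ⟨ι, hι, ⟨Φ⟩⟩ := exists_algEquiv_pi d.Carrier
  let χ : ι → d.Carrier →ₗ[ℂ] ℂ := fun k => LinearMap.proj k ∘ₗ Φ.toLinearMap
  refine ⟨ι, hι, inferInstance, fun i => Φ.symm (Pi.single i 1), χ, ?_, ?_, ?_, ?_⟩
  · intro k i
    change Φ (Φ.symm (Pi.single i 1)) k = _
    rw [AlgEquiv.apply_symm_apply, Pi.single_apply]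
  · intro v
    apply Φ.injective
    change Φ v = Φ (∑ i, χ i v • Φ.symm (Pi.single i 1) : d.Carrier)
    rw [map_sum]
    funext k
    simp only [map_smul, AlgEquiv.apply_symm_apply, Finset.sum_apply, Pi.smul_apply,
      Pi.single_apply, smul_eq_mul, mul_ite, mul_one, mul_zero, Finset.sum_ite_eq,
      Finset.mem_univ, if_true]
    rfl
  · intro k u v
    have := congrFun (map_mul Φ (show d.Carrier from u) v) k
    exact this
  · intro k
    have := congrFun (map_one Φ) k
    exact this

variable {ι : Type} [Fintype ι] [DecidableEq ι] {m : (Fin L → ℂ) → (Fin L → ℂ) → Fin L → ℂ}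
  {A : Fin L → ℂ} {e : ι → Fin L → ℂ} {χ : ι → (Fin L → ℂ) →ₗ[ℂ] ℂ}

theorem IsIdempotentBasis.ext (h : IsIdempotentBasis m A e χ) {u v : Fin L → ℂ}
    (huv : ∀ k, χ k u = χ k v) : u = v := by
  rw [h.sum u, h.sum v]
  exact Finset.sum_congr rfl fun i _ => by rw [huv]

theorem IsIdempotentBasis.idem_mul (h : IsIdempotentBasis m A e χ) (i : ι) (v : Fin L → ℂ) :
    m (e i) v = χ i v • e i :=
  h.ext fun k => by
    rw [h.mul, map_smul, h.char_idem, smul_eq_mul]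
    split_ifs with hk
    · rw [hk, one_mul, mul_one]
    · rw [zero_mul, mul_zero]

theorem IsIdempotentBasis.idem_mul_idem (h : IsIdempotentBasis m A e χ) {i j : ι} (hij : i ≠ j) :
    m (e i) (e j) = 0 := by
  rw [h.idem_mul, h.char_idem, if_neg hij, zero_smul]

theorem IsIdempotentBasis.idem_mul_self (h : IsIdempotentBasis m A e χ) (i : ι) :
    m (e i) (e i) = e i := by
  rw [h.idem_mul, h.char_idem, if_pos rfl, one_smul]

theorem IsIdempotentBasis.unit_eq (h : IsIdempotentBasis m A e χ) : A = ∑ i, e i := by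
  rw [h.sum A]
  exact Finset.sum_congr rfl fun i _ => by rw [h.one, one_smul]

end Semisimple

section TangentAlgebra

variable {L : ℕ} {A : Fin L → ℂ} {F : VecSeq L}

/-! ### The tangent algebra of an ancestor sequence -/

theorem IsDescendant.tmul_assoc (h : IsDescendant A F) (u v w : Fin L → ℂ) :
    tmul F (tmul F u v) w = tmul F u (tmul F v w) := by
  have e : ∀ u v w : Fin L → ℂ, ∀ α, constantCoeff
      (∑ μ, sd u (sd v (F 0 μ)) * pd μ 0 (sd w (F 0 α))) = tmul F (tmul F u v) w α :=
    fun u v w α => by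
      rw [map_sum, tmul, ← sum_mul_constantCoeff_pd]
      exact Finset.sum_congr rfl fun μ _ => by rw [map_mul]; rfl
  rw [tmul_comm u (tmul F v w), tmul_comm v w]
  funext α
  rw [← e, ← e, h.assoc_sd]

theorem IsDescendant.one_tmul (h : IsDescendant A F) (v : Fin L → ℂ) : tmul F A v = v := by
  classical
  funext α
  have := h.string_sd α [v]
  rw [sds_cons, sds_nil, sd_sd, sds_cons, sds_nil] at this
  rw [tmul, this, sd_apply, map_sum, Finset.sum_eq_single α]
  · rw [constantCoeff_smul, pd, pderiv_X_self, map_one, smul_eq_mul, mul_one]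
  · intro β _ hβ
    rw [constantCoeff_smul, pd, pderiv_X_of_ne, map_zero, smul_zero]
    exact fun h => hβ (congrArg Prod.fst h).symm
  · simp

/-- The product on the tangent space at the origin. -/
def IsDescendant.tangentProduct (h : IsDescendant A F) : TangentProduct L where
  mul := LinearMap.mk₂ ℂ (tmul F)
    (fun u u' v => funext fun α => by simp only [tmul, sd_add_left, map_add, Pi.add_apply])
    (fun c u v => funext fun α => by
      simp only [tmul, sd_smul_left, constantCoeff_smul, Pi.smul_apply])
    (fun u v v' => funext fun α => by simp only [tmul, sd_add_left, map_add, Pi.add_apply])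
    (fun c u v => funext fun α => by
      simp only [tmul, sd_smul_left, Derivation.map_smul, constantCoeff_smul, Pi.smul_apply])
  one := A
  comm := tmul_comm
  assoc := h.tmul_assoc
  one_mul := h.one_tmul

theorem IsDescendant.exists_idempotents (h : IsDescendant A F)
    (hs : IsSemisimple fun α β γ => constantCoeff (pd β 0 (pd γ 0 (F 0 α)))) :
    ∃ (ι : Type) (_ : Fintype ι) (_ : DecidableEq ι) (e : ι → Fin L → ℂ)
      (χ : ι → (Fin L → ℂ) →ₗ[ℂ] ℂ), IsIdempotentBasis (tmul F) A e χ := by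
  refine h.tangentProduct.exists_basis fun v k hk => hs v k ?_
  have : (fun w => h.tangentProduct.mul v w) = algMul _ v := funext fun w => tmul_eq_algMul v w
  rw [← this]
  exact hk

end TangentAlgebra

/-! ### Determinacy of the next order in the semisimple case -/

section Rigidity

variable {L : ℕ}

/-! ### The linearized associativity equations -/

/-- The iterated derivative at the origin of a vector of power series. -/
def vder (l : List (Fin L → ℂ)) (W : Fin L → Ser L) : Fin L → ℂ :=
  fun α => constantCoeff (sds l (W α))

theorem vder_perm {l l' : List (Fin L → ℂ)} (h : l.Perm l') (W : Fin L → Ser L) :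
    vder l W = vder l' W :=
  funext fun α => by rw [vder, vder, sds_perm h]

theorem vder_sub (l : List (Fin L → ℂ)) (W W' : Fin L → Ser L) :
    vder l (fun α => W α - W' α) = vder l W - vder l W' :=
  funext fun α => by simp only [vder, map_sub, Pi.sub_apply]

theorem vder_sum_cons {ι : Type} (s : Finset ι) (v : ι → Fin L → ℂ) (l : List (Fin L → ℂ))
    (W : Fin L → Ser L) : vder ((∑ i ∈ s, v i) :: l) W = ∑ i ∈ s, vder (v i :: l) W :=
  funext fun α => by
    simp only [vder, sds_cons, sd_sum_left, map_sum, Finset.sum_apply]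

theorem vder_zero_cons (l : List (Fin L → ℂ)) (W : Fin L → Ser L) :
    vder ((0 : Fin L → ℂ) :: l) W = 0 :=
  funext fun α => by simp only [vder, sds_cons, sd_zero_left, map_zero, Pi.zero_apply]

variable {A : Fin L → ℂ} {F F' : VecSeq L} {n : ℕ}

theorem tmul_eq_of_sm (hX : ∀ α, Sm Set.univ 3 (F' 0 α - F 0 α)) (u v : Fin L → ℂ) :
    tmul F' u v = tmul F u v :=
  funext fun α => by
    have := hX α [v, u] (by simp) (by simp)
    simp only [sds_cons, sds_nil, map_sub, sub_eq_zero] at this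
    exact this

/-- Subtract the associativity equations of the two sequences and differentiate `n` times at the
origin. All derivatives of the difference of order below `n + 2` vanish, so each product contributes
only its leading term, with the other factor frozen as the tangent product. -/
theorem linearized_assoc (hF : IsDescendant A F) (hF' : IsDescendant A F') (hn : 1 ≤ n)
    (hX : ∀ α, Sm Set.univ (n + 2) (F' 0 α - F 0 α)) {l : List (Fin L → ℂ)} (hl : l.length = n)
    (u v w : Fin L → ℂ) :
    tmul F (vder (u :: v :: l) fun α => F' 0 α - F 0 α) w +
        vder (tmul F u v :: w :: l) (fun α => F' 0 α - F 0 α) =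
      tmul F (vder (w :: v :: l) fun α => F' 0 α - F 0 α) u +
        vder (tmul F w v :: u :: l) (fun α => F' 0 α - F 0 α) := by
  classical
  set W : Fin L → Ser L := fun α => F' 0 α - F 0 α with hW
  funext α
  have key : ∀ u w : Fin L → ℂ, constantCoeff (sds l
      (∑ μ, sd u (sd v (F' 0 μ)) * pd μ 0 (sd w (F' 0 α)) -
        ∑ μ, sd u (sd v (F 0 μ)) * pd μ 0 (sd w (F 0 α)))) =
      (tmul F (vder (u :: v :: l) W) w + vder (tmul F u v :: w :: l) W) α := fun u w => by
    have h1 : ∑ μ, sd u (sd v (F' 0 μ)) * pd μ 0 (sd w (F' 0 α)) -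
        ∑ μ, sd u (sd v (F 0 μ)) * pd μ 0 (sd w (F 0 α)) =
        ∑ μ, sd v (sd u (W μ)) * pd μ 0 (sd w (F' 0 α)) +
        ∑ μ, sd u (sd v (F 0 μ)) * pd μ 0 (sd w (W α)) := by
      rw [← Finset.sum_sub_distrib, ← Finset.sum_add_distrib]
      refine Finset.sum_congr rfl fun μ _ => ?_
      simp only [hW, pd, map_sub, sd_sd v u]
      ring
    have h2 : ∀ μ, constantCoeff (sds l (sd v (sd u (W μ)) * pd μ 0 (sd w (F' 0 α)))) =
        vder (u :: v :: l) W μ * constantCoeff (pd μ 0 (sd w (F' 0 α))) := fun μ =>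
      (((hX μ).sd (Set.mem_univ u)).sd (Set.mem_univ v)).constantCoeff_mul _ (by simp)
        (by omega)
    have h3 : ∀ μ, constantCoeff (sds l (sd u (sd v (F 0 μ)) * pd μ 0 (sd w (W α)))) =
        tmul F u v μ * constantCoeff (pd μ 0 (sds l (sd w (W α)))) := fun μ => by
      rw [Sm.constantCoeff_mul' (V := Set.univ) (n := n) _ _ (by simp) hl]
      · rw [pd, sds_pderiv]
        rfl
      · rw [← sd_single]
        exact (((hX α).sd (Set.mem_univ w)).sd (Set.mem_univ _)).mono (by omega)
    rw [h1, map_add, map_add, map_sum, map_sum, map_sum, map_sum]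
    simp only [h2, h3]
    rw [sum_mul_constantCoeff_pd, sum_mul_constantCoeff_pd, Pi.add_apply,
      ← tmul_eq_of_sm (fun α => (hX α).mono (by omega)) _ w, ← sds_sd,
      sd_sd (tmul F u v) w]
    rfl
  rw [← key, ← key, hF.assoc_sd, hF'.assoc_sd]

theorem vder_unit_sub (hF : IsDescendant A F) (hF' : IsDescendant A F') (l : List (Fin L → ℂ)) :
    vder (A :: l) (fun α => F' 0 α - F 0 α) = 0 :=
  funext fun α => by
    rw [vder, map_sub, map_sub, sds_cons, sds_cons, hF.string_sd, hF'.string_sd, sub_self]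
    rfl

variable {ι : Type} [Fintype ι] [DecidableEq ι] {e : ι → Fin L → ℂ}
  {χ : ι → (Fin L → ℂ) →ₗ[ℂ] ℂ}

/-- Insert `e i`, `e i`, `e j` into the linearized equation and apply `χ k`: both tangent products
vanish, as `χ k` kills `e i` and `e j`, and so does the term with `e j * e i = 0`. -/
theorem char_vder_of_ne (hF : IsDescendant A F) (hF' : IsDescendant A F') (hn : 1 ≤ n)
    (hX : ∀ α, Sm Set.univ (n + 2) (F' 0 α - F 0 α)) (hB : IsIdempotentBasis (tmul F) A e χ)
    {l : List (Fin L → ℂ)} (hl : l.length = n) {i j k : ι} (hij : i ≠ j) (hik : i ≠ k)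
    (hjk : j ≠ k) : χ k (vder (e i :: e j :: l) fun α => F' 0 α - F 0 α) = 0 := by
  have := congrArg (χ k) (linearized_assoc hF hF' hn hX hl (e i) (e i) (e j))
  rw [map_add, map_add, hB.mul, hB.mul, hB.idem_mul_self, hB.idem_mul_idem hij.symm,
    vder_zero_cons, hB.char_idem, hB.char_idem, if_neg hjk.symm, if_neg hik.symm] at this
  simpa using this

/-- The same substitution with `j = k`: one tangent product now survives and trades an `e k` for an
`e i`. -/
theorem char_vder_mixed (hF : IsDescendant A F) (hF' : IsDescendant A F') (hn : 1 ≤ n)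
    (hX : ∀ α, Sm Set.univ (n + 2) (F' 0 α - F 0 α)) (hB : IsIdempotentBasis (tmul F) A e χ)
    {l : List (Fin L → ℂ)} (hl : l.length = n) {i k : ι} (hik : i ≠ k) :
    χ k (vder (e i :: e k :: l) fun α => F' 0 α - F 0 α) =
      -χ k (vder (e i :: e i :: l) fun α => F' 0 α - F 0 α) := by
  have := congrArg (χ k) (linearized_assoc hF hF' hn hX hl (e i) (e i) (e k))
  rw [map_add, map_add, hB.mul, hB.mul, hB.idem_mul_self, hB.idem_mul_idem hik.symm,
    vder_zero_cons, hB.char_idem, hB.char_idem, if_pos rfl, if_neg hik.symm, mul_one, mul_zero,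
    map_zero, add_zero] at this
  exact eq_neg_of_add_eq_zero_right this

theorem sum_char_vder (hF : IsDescendant A F) (hF' : IsDescendant A F')
    (hB : IsIdempotentBasis (tmul F) A e χ) (l : List (Fin L → ℂ)) (k : ι) :
    ∑ i, χ k (vder (e i :: l) fun α => F' 0 α - F 0 α) = 0 := by
  rw [← map_sum, ← vder_sum_cons, ← hB.unit_eq, vder_unit_sub hF hF', map_zero]

/-- A first-order deformation of a semisimple solution is determined by its pure derivatives along
the idempotents. -/
theorem sm_of_pure (hF : IsDescendant A F) (hF' : IsDescendant A F') (hn : 1 ≤ n)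
    (hX : ∀ α, Sm Set.univ (n + 2) (F' 0 α - F 0 α)) (hB : IsIdempotentBasis (tmul F) A e χ)
    (h : ∀ i k, i ≠ k →
      χ k (vder (List.replicate (n + 2) (e i)) fun α => F' 0 α - F 0 α) = 0) :
    ∀ α, Sm Set.univ (n + 3) (F' 0 α - F 0 α) := by
  set W : Fin L → Ser L := fun α => F' 0 α - F 0 α with hW
  -- Induction on the number of directions other than the distinguished copies of `e i`: each is
  -- removed, by vanishing or by a trade for another `e i`, until a pure derivative remains.
  have h1 : ∀ (l : List ι) (a : ℕ) (i k : ι), i ≠ k → a + 1 + l.length = n + 2 →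
      χ k (vder (List.replicate (a + 1) (e i) ++ l.map e) W) = 0 := by
    intro l
    induction l with
    | nil =>
      intro a i k hik hl
      obtain rfl : a = n + 1 := by simpa using hl
      simpa using h i k hik
    | cons j l ih =>
      intro a i k hik hl
      rw [List.length_cons] at hl
      have h2 : ∀ v, vder (List.replicate (a + 1) (e i) ++ v :: l.map e) W =
          vder (e i :: v :: (List.replicate a (e i) ++ l.map e)) W := fun v => by
        refine vder_perm ?_ W
        rw [List.replicate_succ, List.cons_append]
        exact List.Perm.cons _ List.perm_middle
      have hlen : (List.replicate a (e i) ++ l.map e).length = n := by simp; omega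
      have h3 : χ k (vder (e i :: e i :: (List.replicate a (e i) ++ l.map e)) W) = 0 := by
        have := ih (a + 1) i k hik (by omega)
        simpa [List.replicate_succ] using this
      rw [List.map_cons, h2]
      by_cases hj : i = j
      · rw [← hj, h3]
      by_cases hjk : j = k
      · rw [hjk, char_vder_mixed hF hF' hn hX hB hlen hik, h3, neg_zero]
      · exact char_vder_of_ne hF hF' hn hX hB hlen hj hik hjk
  have h2 : ∀ (l : List ι) (k : ι), l.length = n + 2 → χ k (vder (l.map e) W) = 0 := by
    have h3 : ∀ (i k : ι) (l : List ι), i ≠ k → l.length = n + 1 →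
        χ k (vder (e i :: l.map e) W) = 0 := fun i k l hik hl => by
      simpa using h1 l 0 i k hik (by omega)
    intro l k hl
    obtain ⟨i, l, rfl⟩ := List.exists_cons_of_length_eq_add_one hl
    have hl : l.length = n + 1 := by simpa using hl
    rw [List.map_cons]
    by_cases hik : i = k
    -- All summands with index other than `k` are already zero. The string equation fixes
    -- derivatives along the unit, the sum of the idempotents, so the last summand vanishes too.
    · have h4 := sum_char_vder hF hF' hB (l.map e) k
      rw [Finset.sum_eq_single k (fun j _ hj => h3 j k l hj hl) (by simp)] at h4
      rw [hik]
      exact h4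
    · exact h3 i k l hik hl
  intro α l _ hl
  by_cases hl' : l.length < n + 2
  · exact hX α l (by simp) hl'
  refine apply_sds_of_span (χ := fun i v => χ i v) hB.sum (coeff 0) (n + 2) (W α)
    (fun l hl => ?_) l (by omega)
  have h3 : vder (l.map e) W = 0 := hB.ext fun k => by rw [h2 l k hl, map_zero]
  exact congrFun h3 α

/-- The relation between the pure derivatives along two idempotents. -/
theorem char_vder_replicate (hF : IsDescendant A F) (hF' : IsDescendant A F') (hn : 1 ≤ n)
    (hX : ∀ α, Sm Set.univ (n + 2) (F' 0 α - F 0 α)) (hB : IsIdempotentBasis (tmul F) A e χ)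
    {i k : ι} (hik : i ≠ k) :
    χ k (vder (e i :: List.replicate (n + 1) (e k)) fun α => F' 0 α - F 0 α) =
      (-1) ^ (n + 1) * χ k (vder (List.replicate (n + 2) (e i)) fun α => F' 0 α - F 0 α) := by
  set W : Fin L → Ser L := fun α => F' 0 α - F 0 α with hW
  have h1 : ∀ a b, a + b = n + 1 →
      χ k (vder (List.replicate (a + 1) (e i) ++ List.replicate b (e k)) W) =
        (-1) ^ b * χ k (vder (List.replicate (n + 2) (e i)) W) := by
    intro a b
    induction b generalizing a with
    | zero =>
      rintro rfl
      simp
    | succ b ih =>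
      intro hab
      have h2 : ∀ v, vder (List.replicate (a + 1) (e i) ++ v :: List.replicate b (e k)) W =
          vder (e i :: v :: (List.replicate a (e i) ++ List.replicate b (e k))) W := fun v => by
        refine vder_perm ?_ W
        rw [List.replicate_succ, List.cons_append]
        exact List.Perm.cons _ List.perm_middle
      rw [List.replicate_succ (n := b), h2, char_vder_mixed hF hF' hn hX hB (by simp; omega) hik]
      have h3 := ih (a + 1) (by omega)
      rw [List.replicate_succ, List.replicate_succ, List.cons_append, List.cons_append] at h3
      rw [h3, pow_succ]
      ring
  simpa using h1 0 (n + 1) (by omega)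

end Rigidity

section Determinacy

variable {L : ℕ} {A : Fin L → ℂ} {F F' : VecSeq L}

/-! ### Reconstruction from the small phase space -/

theorem Sm.coeff_eq_zero {k : ℕ} {g : Ser L} (h : Sm Set.univ k g) {m : Fin L × ℕ →₀ ℕ}
    (hm : ∀ j, m j ≠ 0 → j.2 = 0) (hk : m.degree < k) : coeff m g = 0 := by
  classical
  induction k generalizing g m with
  | zero => omega
  | succ k ih =>
    by_cases h0 : m = 0
    · subst h0
      exact h [] (by simp) (by simp)
    obtain ⟨m, ⟨β, b⟩, rfl⟩ := exists_eq_add_single h0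
    obtain rfl : b = 0 := hm (β, b) (by simp)
    rw [← coeff_pderiv_eq_zero_iff]
    change coeff m (pd β 0 g) = 0
    rw [← sd_single]
    refine ih (h.sd (Set.mem_univ _)) (fun j hj => hm j ?_) ?_
    · rw [Finsupp.add_apply]
      omega
    · rw [map_add, Finsupp.degree_single] at hk
      omega

theorem lvl_of_pderiv {c : ℤ} {g : Ser L} (h0 : constantCoeff g = 0)
    (h : ∀ j : Fin L × ℕ, Lvl (c - 1 + j.2) (pderiv ℂ j g)) : Lvl c g := fun m hm => by
  by_cases hm0 : m = 0
  · rw [hm0, coeff_zero_eq_constantCoeff_apply, h0]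
  obtain ⟨m, j, rfl⟩ := exists_eq_add_single hm0
  rw [← coeff_pderiv_eq_zero_iff]
  refine h j m ?_
  rw [map_add, wt_single] at hm
  omega

theorem IsAncestor.lvl (h : IsAncestor A F) (a : ℕ) (α : Fin L) : Lvl (a + 2) (F a α) :=
  h.lev a α

/-- Monomials in the small variables are covered by `hS`, as their weight is their degree. In any
other monomial a variable of positive index is lowered by the recursion relation, whose difference
is bilinear in known factors and differences at monomials of smaller degree. -/
theorem IsAncestor.lvl_of_sm (h : IsAncestor A F) (h' : IsAncestor A F') {n : ℕ}
    (hL : ∀ α, Lvl (n + 2) (F' 0 α - F 0 α)) (hS : ∀ α, Sm Set.univ (n + 3) (F' 0 α - F 0 α))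
    (α : Fin L) : Lvl (n + 3) (F' 0 α - F 0 α) := by
  classical
  suffices H : ∀ (d : ℕ) (m : Fin L × ℕ →₀ ℕ), m.degree = d → ∀ α, wt m < n + 3 →
      coeff m (F' 0 α - F 0 α) = 0 from fun m hm => H _ m rfl α hm
  intro d
  induction d using Nat.strong_induction_on with
  | _ d ih =>
    intro m hd α hm
    by_cases hsm : ∀ j, m j ≠ 0 → j.2 = 0
    · refine (hS α).coeff_eq_zero hsm ?_
      rw [wt_eq_degree fun j hj => hsm j (Finsupp.mem_support_iff.1 hj)] at hm
      omega
    push Not at hsm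
    obtain ⟨⟨β, b⟩, hj, hb⟩ := hsm
    obtain ⟨b, rfl⟩ := Nat.exists_eq_succ_of_ne_zero hb
    obtain ⟨m, rfl⟩ : ∃ m', m = m' + Finsupp.single (β, b + 1) 1 :=
      ⟨m - Finsupp.single (β, b + 1) 1, (tsub_add_cancel_of_le (by
        simpa [Nat.one_le_iff_ne_zero] using hj)).symm⟩
    rw [map_add, wt_single] at hm
    rw [map_add, Finsupp.degree_single] at hd
    by_cases hm0 : m = 0
    · subst hm0
      refine hL α _ ?_
      rw [map_add, wt_single, map_zero]
      simp only
      omega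
    obtain ⟨m, k, rfl⟩ := exists_eq_add_single hm0
    rw [map_add, wt_single] at hm
    rw [map_add, Finsupp.degree_single] at hd
    push_cast at hm
    rw [← coeff_pderiv_eq_zero_iff, ← coeff_pderiv_eq_zero_iff, pderiv_pderiv_comm k]
    have e : pderiv ℂ (β, b + 1) (pderiv ℂ k (F' 0 α - F 0 α)) =
        ∑ μ, (pderiv ℂ (β, b) (F' 0 μ - F 0 μ) * pd μ 0 (pderiv ℂ k (F' 0 α)) +
          pderiv ℂ (β, b) (F 0 μ) * pd μ 0 (pderiv ℂ k (F' 0 α - F 0 α))) := by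
      have h1 := h.descendant.trr_all 0 α (β, b) k
      have h2 := h'.descendant.trr_all 0 α (β, b) k
      simp only [pd] at h1 h2
      rw [map_sub, map_sub, h1, h2, ← Finset.sum_sub_distrib]
      refine Finset.sum_congr rfl fun μ _ => ?_
      simp only [pd, map_sub]
      ring
    rw [e, map_sum]
    refine Finset.sum_eq_zero fun μ _ => ?_
    have hwt : ∀ p ∈ Finset.HasAntidiagonal.antidiagonal m, wt p.1 + wt p.2 = wt m ∧
        p.1.degree + p.2.degree = m.degree := fun p hp => by
      rw [← Finset.HasAntidiagonal.mem_antidiagonal.1 hp, map_add, map_add]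
      exact ⟨rfl, rfl⟩
    rw [map_add, coeff_mul, coeff_mul, Finset.sum_eq_zero, Finset.sum_eq_zero, add_zero]
    · intro p hp
      obtain ⟨h1, h2⟩ := hwt p hp
      by_cases hp1 : wt p.1 < 1 + b
      · rw [((h.lvl 0 μ).pderiv (β, b)) p.1 (by push_cast; omega), zero_mul]
      · have hp0 : p.1.degree ≠ 0 := fun h0 => by
          rw [Finsupp.degree_eq_zero_iff] at h0
          rw [h0, map_zero] at hp1
          omega
        rw [pd, coeff_pderiv_eq_zero_iff.2 (coeff_pderiv_eq_zero_iff.2 (ih _ _ _ rfl α _)), mul_zero]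
        · rw [map_add, map_add, Finsupp.degree_single, Finsupp.degree_single]
          omega
        · rw [map_add, map_add, wt_single, wt_single]
          push_cast
          omega
    · intro p hp
      obtain ⟨h1, h2⟩ := hwt p hp
      by_cases hp1 : wt p.2 < k.2
      · rw [(((h'.lvl 0 α).pderiv k).pderiv (μ, 0)) p.2 (by push_cast; omega), mul_zero]
      · rw [coeff_pderiv_eq_zero_iff.2 (ih _ _ _ rfl μ _), zero_mul]
        · rw [map_add, Finsupp.degree_single]
          omega
        · rw [map_add, wt_single]
          simp only
          omega

/-- Two ancestor sequences that agree to some order agree to the next one if their restrictions to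
the small phase space do. -/
theorem IsAncestor.lev_of_sm (h : IsAncestor A F) (h' : IsAncestor A F') {n : ℕ}
    (hL : Lev (2 + n) (Jof A F' - Jof A F)) (hS : ∀ α, Sm Set.univ (n + 3) (F' 0 α - F 0 α)) :
    Lev (3 + n) (Jof A F' - Jof A F) := by
  have hL' : ∀ (a : ℕ) α, Lvl (a + (2 + n)) (F' a α - F a α) := fun a α => hL a α
  have key : ∀ (a : ℕ) α, Lvl (a + (3 + n)) (F' a α - F a α) := by
    have h0 := h.lvl_of_sm h' (fun α => (hL' 0 α).mono (by push_cast; omega)) hS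
    intro a
    induction a with
    | zero => exact fun α => (h0 α).mono (by push_cast; omega)
    | succ a ih =>
      intro α
      refine lvl_of_pderiv ?_ fun j => ?_
      · exact (hL' (a + 1) α).constantCoeff (by push_cast; omega)
      · have e : ∀ {F : VecSeq L}, IsDescendant A F → pderiv ℂ j (F (a + 1) α) =
            ∑ μ, pd μ 0 (F a α) * pderiv ℂ j (F 0 μ) - pderiv ℂ (j.1, j.2 + 1) (F a α) :=
          fun h => eq_sub_of_add_eq (h.shift α j.1 a j.2)
        have e2 : pderiv ℂ j (F' (a + 1) α - F (a + 1) α) =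
            ∑ μ, (pderiv ℂ (μ, 0) (F' a α - F a α) * pderiv ℂ j (F' 0 μ) +
              pderiv ℂ (μ, 0) (F a α) * pderiv ℂ j (F' 0 μ - F 0 μ)) -
            pderiv ℂ (j.1, j.2 + 1) (F' a α - F a α) := by
          rw [map_sub, e h.descendant, e h'.descendant, sub_sub_sub_comm, ← Finset.sum_sub_distrib,
            ← map_sub]
          congr 1
          refine Finset.sum_congr rfl fun μ _ => ?_
          simp only [pd, map_sub]
          ring
        rw [e2]
        refine (Lvl.sum _ fun μ _ => Lvl.add ?_ ?_).sub ?_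
        · exact (((ih α).pderiv (μ, 0)).mul ((h'.lvl 0 μ).pderiv j)).mono (by push_cast; omega)
        · exact (((h.lvl a α).pderiv (μ, 0)).mul ((h0 μ).pderiv j)).mono (by push_cast; omega)
        · exact ((ih α).pderiv (j.1, j.2 + 1)).mono (by push_cast; omega)
  intro a α m hm
  cases a with
  | ofNat a => exact key a α m hm
  | negSucc k => simp [Jof_apply, ext_negSucc]

end Determinacy

section LeadingTerm

variable {L : ℕ} {A : Fin L → ℂ} {F : VecSeq L}

/-! ### The leading term of the action along the idempotents -/

theorem coeff_sds_dir (w : LV L ℂ) (l : List (Fin L → ℂ)) (m : Fin L × ℕ →₀ ℕ) :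
    ∃ B₀ : ℕ, ∀ B ≥ B₀, ∀ g : Ser L, coeff m (sds l (dir w g)) =
      coeff m (sds l (∑ b ∈ Finset.range B, ∑ β, posC w (β, b) * pd β b g)) := by
  induction l generalizing m with
  | nil => exact dir_coeff w m
  | cons v l ih =>
    choose B hB using ih
    refine ⟨∑ β, B (m + Finsupp.single (β, 0) 1), fun B' hB' g => ?_⟩
    have hc : ∀ f : Ser L, coeff m (sds (v :: l) f) =
        ∑ β, v β * (coeff (m + Finsupp.single (β, 0) 1) (sds l f) * (m (β, 0) + 1)) := fun f => by
      rw [sds_cons, sds_sd, sd_apply, map_sum]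
      refine Finset.sum_congr rfl fun β _ => ?_
      rw [map_smul, coeff_pderiv, smul_eq_mul]
    rw [hc, hc]
    refine Finset.sum_congr rfl fun β _ => ?_
    rw [hB _ B' (le_trans ?_ hB')]
    exact Finset.single_le_sum (f := fun β => B (m + Finsupp.single (β, 0) 1))
      (fun _ _ => Nat.zero_le _) (Finset.mem_univ β)

/-- A linear combination of the components of a vector of power series. -/
def lcomb (φ : (Fin L → ℂ) →ₗ[ℂ] ℂ) (W : Fin L → Ser L) : Ser L :=
  ∑ α, φ (Pi.single α 1) • W α

theorem constantCoeff_sds_lcomb (φ : (Fin L → ℂ) →ₗ[ℂ] ℂ) (W : Fin L → Ser L)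
    (l : List (Fin L → ℂ)) : constantCoeff (sds l (lcomb φ W)) = φ (vder l W) := by
  have h1 : vder l W = ∑ α, vder l W α • (Pi.single α (1 : ℂ) : Fin L → ℂ) := by
    funext β
    simp [Finset.sum_apply, Pi.single_apply]
  conv_rhs => rw [h1, map_sum]
  rw [lcomb, map_sum, map_sum]
  refine Finset.sum_congr rfl fun α _ => ?_
  rw [map_smul, constantCoeff_smul, map_smul, smul_eq_mul, smul_eq_mul, mul_comm]
  rfl

/-- By `hess_sd` two derivatives of `F (a + 1)` are second derivatives of `F 0` times first
derivatives of `F a`. At the relevant order the latter must absorb all remaining derivatives, which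
leaves `e * e = e` contracted with the previous case. -/
theorem vder_replicate_idem (h : IsAncestor A F) {e : Fin L → ℂ} (he : tmul F e e = e) (a : ℕ) :
    vder (List.replicate (a + 2) e) (F a) = e := by
  induction a with
  | zero => exact he
  | succ a ih =>
    funext α
    have h1 : ∀ μ, Sm Set.univ (a + 1) (pd μ 0 (F a α)) := fun μ =>
      ((h.lvl a α).pderiv (μ, 0)).sm (by push_cast; omega)
    have h2 : vder (List.replicate (a + 2) e) (F a) α = e α := congrFun ih α
    rw [← h2, vder, List.replicate_succ, List.replicate_succ, sds_cons, sds_cons,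
      h.descendant.hess_sd, map_sum, map_sum, vder, List.replicate_succ, sds_cons, sds_sd,
      ← sum_mul_constantCoeff_pd]
    refine Finset.sum_congr rfl fun μ _ => ?_
    rw [(h1 μ).constantCoeff_mul' _ (by simp) (by simp), pd, sds_pderiv]
    congr 1
    exact congrFun he μ

variable {ι : Type} [Fintype ι] [DecidableEq ι] {e : ι → Fin L → ℂ}
  {χ : ι → (Fin L → ℂ) →ₗ[ℂ] ℂ}

/-- Along `e i` the leading Taylor coefficient of `∂F 0` is a tangent product with `e i`, by the
recursion relation. The character `χ k` kills it, so one more order of vanishing is gained. -/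
theorem sm_lcomb_pd (h : IsAncestor A F) (hB : IsIdempotentBasis (tmul F) A e χ) {i k : ι}
    (hik : i ≠ k) (β : Fin L) (b : ℕ) :
    Sm {e i} (b + 2) (lcomb (χ k) fun α => pd β b (F 0 α)) := by
  intro l hl hlen
  rw [constantCoeff_sds_lcomb]
  have h1 : ∀ α, Sm Set.univ (b + 1) (pd β b (F 0 α)) := fun α =>
    ((h.lvl 0 α).pderiv (β, b)).sm (by push_cast; omega)
  by_cases hlb : l.length < b + 1
  · have : vder l (fun α => pd β b (F 0 α)) = 0 := funext fun α => h1 α l (by simp) hlb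
    rw [this, map_zero]
  have h0 : χ k (e i) = 0 := by rw [hB.char_idem, if_neg hik.symm]
  rw [List.eq_replicate_of_mem (a := e i) (l := l) (by simpa using hl),
    show l.length = b + 1 by omega, List.replicate_succ]
  cases b with
  | zero =>
    have : vder (e i :: List.replicate 0 (e i)) (fun α => pd β 0 (F 0 α)) =
        tmul F (Pi.single β 1) (e i) := funext fun α => by
      rw [tmul, sd_single, pd, ← sd_pderiv]
      rfl
    rw [this, hB.mul, h0, mul_zero]
  | succ b =>
    have h2 : ∀ α, Sm Set.univ (b + 1) (pd β b (F 0 α)) := fun α =>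
      ((h.lvl 0 α).pderiv (β, b)).sm (by push_cast; omega)
    have : vder (e i :: List.replicate (b + 1) (e i)) (fun α => pd β (b + 1) (F 0 α)) =
        tmul F (vder (List.replicate (b + 1) (e i)) fun α => pd β b (F 0 α)) (e i) :=
      funext fun α => by
        rw [vder, sds_cons, pd, sd_pderiv]
        have := h.descendant.trr_sd α β b (e i)
        rw [pd] at this
        rw [this, map_sum, map_sum, tmul, ← sum_mul_constantCoeff_pd]
        exact Finset.sum_congr rfl fun μ _ => (h2 μ).constantCoeff_mul _ (by simp) (by simp)
    rw [this, hB.mul, h0, mul_zero]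

/-- The loop term contributes `(-1)^n r_n e i`, by `vder_replicate_idem`. The vector field term does
not contribute, because the extra order of vanishing in `sm_lcomb_pd` exceeds the number of
derivatives. -/
theorem char_leading (h : IsAncestor A F) (hB : IsIdempotentBasis (tmul F) A e χ) {n : ℕ}
    {r : ℕ → Matrix (Fin L) (Fin L) ℂ} (hr : ∀ i < n, r i = 0) {i k : ι} (hik : i ≠ k) :
    χ k (vder (List.replicate (n + 2) (e i)) fun α =>
      nrm (Jof A F) (loop n r (Jof A F)) (0 : ℕ) α) = (-1) ^ n * χ k ((r n).mulVec (e i)) := by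
  set J := Jof A F with hJ
  have hw : Lev (2 + n) (loop n r J) := h.lev.loop_of n n hr
  have h1 : vder (List.replicate (n + 2) (e i)) (fun α => loop n r J (0 : ℕ) α) =
      (-1 : ℂ) ^ n • (r n).mulVec (e i) := by
    have h2 := vder_replicate_idem h (hB.idem_mul_self i) n
    funext α
    rw [vder, loop_apply, Finset.sum_range_succ, Finset.sum_eq_zero, zero_add, map_sum, map_sum,
      Pi.smul_apply, Matrix.mulVec, dotProduct, Finset.smul_sum]
    · refine Finset.sum_congr rfl fun μ _ => ?_
      have h3 : constantCoeff (sds (List.replicate (n + 2) (e i)) (F n μ)) = e i μ := congrFun h2 μ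
      have h4 : ((0 : ℕ) : ℤ) + (n : ℤ) = (n : ℕ) := by simp
      rw [h4, hJ, Jof_nat]
      rw [← neg_one_pow_smul, map_smul, constantCoeff_smul, map_smul, constantCoeff_smul, h3,
        smul_eq_mul, smul_eq_mul, smul_eq_mul]
      ring
    · intro j hj
      rw [hr j (Finset.mem_range.1 hj)]
      simp
  have h2 : χ k (vder (List.replicate (n + 2) (e i)) fun α => dir (loop n r J) (F 0 α)) = 0 := by
    obtain ⟨B, hB0⟩ := coeff_sds_dir (loop n r J) (List.replicate (n + 2) (e i)) 0
    have h3 : (vder (List.replicate (n + 2) (e i)) fun α => dir (loop n r J) (F 0 α)) =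
        vder (List.replicate (n + 2) (e i)) fun α =>
          ∑ b ∈ Finset.range B, ∑ β, posC (loop n r J) (β, b) * pd β b (F 0 α) :=
      funext fun α => by
        rw [vder, ← coeff_zero_eq_constantCoeff_apply, hB0 B le_rfl,
          coeff_zero_eq_constantCoeff_apply, vder]
    have h4 : lcomb (χ k) (fun α =>
          ∑ b ∈ Finset.range B, ∑ β, posC (loop n r J) (β, b) * pd β b (F 0 α)) =
        ∑ b ∈ Finset.range B, ∑ β, posC (loop n r J) (β, b) *
          lcomb (χ k) fun α => pd β b (F 0 α) := by
      simp only [lcomb, Finset.mul_sum, Finset.smul_sum, mul_smul_comm]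
      rw [Finset.sum_comm]
      exact Finset.sum_congr rfl fun b _ => Finset.sum_comm
    rw [h3, ← constantCoeff_sds_lcomb, h4, map_sum, map_sum]
    refine Finset.sum_eq_zero fun b _ => ?_
    rw [map_sum, map_sum]
    refine Finset.sum_eq_zero fun β _ => ?_
    -- The orders of vanishing of the two factors add up to at least `n + 3`, one more than the
    -- number of derivatives taken.
    have h5 : Sm {e i} (n + 1 - b) (posC (loop n r J) (β, b)) := by
      rcases le_or_gt b (n + 1) with hb | hb
      · exact (hw.posC (β, b)).sm (by push_cast [Nat.cast_sub hb]; omega)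
      · exact fun _ _ h => absurd h (by omega)
    exact (h5.mul (sm_lcomb_pd h hB hik β b)) _ (by simp) (by simp; omega)
  have h3 : (vder (List.replicate (n + 2) (e i)) fun α => nrm J (loop n r J) (0 : ℕ) α) =
      vder (List.replicate (n + 2) (e i)) (fun α => loop n r J (0 : ℕ) α) -
        vder (List.replicate (n + 2) (e i)) fun α => dir (loop n r J) (F 0 α) := by
    rw [← vder_sub]
    congr 1
  rw [h3, map_sub, h2, sub_zero, h1, map_smul, smul_eq_mul]

end LeadingTerm

/-! ### Correction of a single order by an element of the Lie algebra -/

section Step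

variable {N : ℕ} {A : Fin (N + 1) → ℂ} {η : Matrix (Fin N) (Fin N) ℂ} {F F' : VecSeq (N + 1)}

/-! ### Matching two open-closed sequences at one order -/

/-- The metric as a degenerate bilinear form on `ℂ^{N+1}`. -/
def bform (η : Matrix (Fin N) (Fin N) ℂ) :
    (Fin (N + 1) → ℂ) →ₗ[ℂ] (Fin (N + 1) → ℂ) →ₗ[ℂ] ℂ :=
  LinearMap.mk₂ ℂ (fun u v => ∑ α : Fin N, ∑ μ : Fin N, η α μ * u α.castSucc * v μ.castSucc)
    (fun u u' v => by
      simp only [Pi.add_apply, mul_add, add_mul, Finset.sum_add_distrib])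
    (fun c u v => by
      simp only [Pi.smul_apply, smul_eq_mul, Finset.mul_sum]
      exact Finset.sum_congr rfl fun α _ => Finset.sum_congr rfl fun μ _ => by ring)
    (fun u v v' => by
      simp only [Pi.add_apply, mul_add, Finset.sum_add_distrib])
    (fun c u v => by
      simp only [Pi.smul_apply, smul_eq_mul, Finset.mul_sum]
      exact Finset.sum_congr rfl fun α _ => Finset.sum_congr rfl fun μ _ => by ring)

theorem bform_apply (u v : Fin (N + 1) → ℂ) : bform η u v =
    ∑ α : Fin N, ∑ μ : Fin N, η α μ * u α.castSucc * v μ.castSucc := rfl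

theorem IsOpenClosed.sd_eq (h : IsOpenClosed η F) (v : Fin (N + 1) → ℂ) (a : ℕ) (μ : Fin N) :
    sd v (F a μ.castSucc) = ∑ β : Fin N, v β.castSucc • pd β.castSucc 0 (F a μ.castSucc) := by
  rw [sd_apply, Fin.sum_univ_castSucc, pd, h.indep, smul_zero, add_zero]

theorem IsOpenClosed.bform_vder (h : IsOpenClosed η F) (u v : Fin (N + 1) → ℂ)
    (l : List (Fin (N + 1) → ℂ)) :
    bform η u (vder (v :: l) (F 0)) = bform η v (vder (u :: l) (F 0)) := by
  let x : Fin N → Fin N → ℂ := fun β μ =>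
    constantCoeff (sds l (pd β.castSucc 0 (F 0 μ.castSucc)))
  have hx : ∀ α β, ∑ μ, η α μ * x β μ = ∑ μ, η β μ * x α μ := fun α β => by
    have := congrArg (fun g => constantCoeff (sds l g)) (h.closed α β 0 0)
    simp only [map_sum, map_smul, constantCoeff_smul] at this
    exact this
  have e : ∀ u v, bform η u (vder (v :: l) (F 0)) =
      ∑ α : Fin N, ∑ β : Fin N, u α.castSucc * v β.castSucc * ∑ μ, η α μ * x β μ := fun u v => by
    rw [bform_apply]
    refine Finset.sum_congr rfl fun α _ => ?_
    simp only [Finset.mul_sum]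
    rw [Finset.sum_comm]
    refine Finset.sum_congr rfl fun μ _ => ?_
    rw [vder, sds_cons, h.sd_eq, map_sum, map_sum, Finset.mul_sum]
    refine Finset.sum_congr rfl fun β _ => ?_
    rw [map_smul, constantCoeff_smul, smul_eq_mul]
    ring
  rw [e, e, Finset.sum_comm]
  refine Finset.sum_congr rfl fun β _ => Finset.sum_congr rfl fun α _ => ?_
  rw [hx α β]
  ring

variable {ι : Type} [Fintype ι] {e : ι → Fin (N + 1) → ℂ}
  {χ : ι → (Fin (N + 1) → ℂ) →ₗ[ℂ] ℂ}

/-- The matrix with the given entries in a basis of idempotents. -/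
def idemMat (e : ι → Fin (N + 1) → ℂ) (χ : ι → (Fin (N + 1) → ℂ) →ₗ[ℂ] ℂ) (d : ι → ι → ℂ) :
    Matrix (Fin (N + 1)) (Fin (N + 1)) ℂ :=
  Matrix.of fun α β => ∑ i, ∑ k, d k i * e k α * χ i (Pi.single β 1)

theorem idemMat_mulVec (d : ι → ι → ℂ) (v : Fin (N + 1) → ℂ) :
    (idemMat e χ d).mulVec v = ∑ i, ∑ k, (d k i * χ i v) • e k := by
  have h1 : v = ∑ β, v β • (Pi.single β (1 : ℂ) : Fin (N + 1) → ℂ) := by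
    funext β
    simp [Finset.sum_apply, Pi.single_apply]
  have h2 : ∀ i, χ i v = ∑ β, v β * χ i (Pi.single β 1) := fun i => by
    conv_lhs => rw [h1, map_sum]
    simp only [map_smul, smul_eq_mul]
  funext α
  simp only [Matrix.mulVec, dotProduct, idemMat, Matrix.of_apply, Finset.sum_apply, Pi.smul_apply,
    smul_eq_mul, h2, Finset.mul_sum, Finset.sum_mul]
  rw [Finset.sum_comm]
  refine Finset.sum_congr rfl fun i _ => ?_
  rw [Finset.sum_comm]
  refine Finset.sum_congr rfl fun k _ => Finset.sum_congr rfl fun β _ => ?_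
  ring

variable [DecidableEq ι]

/-- Symmetry of the closed sector makes the form invariant under the tangent product, so distinct
idempotents are orthogonal. -/
theorem IsOpenClosed.bform_idem (h : IsOpenClosed η F) (hB : IsIdempotentBasis (tmul F) A e χ)
    (k : ι) (v : Fin (N + 1) → ℂ) : bform η (e k) v = χ k v * bform η (e k) (e k) := by
  have h1 : ∀ u v, vder [u, v] (F 0) = tmul F v u := fun u v => rfl
  have h2 : ∀ j, j ≠ k → bform η (e k) (e j) = 0 := fun j hj => by
    conv_lhs => rw [← hB.idem_mul_self j, ← h1, h.bform_vder, h1, hB.idem_mul_idem hj, map_zero]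
  conv_lhs => rw [hB.sum v, map_sum]
  rw [Finset.sum_eq_single k, map_smul, smul_eq_mul]
  · intro j _ hj
    rw [map_smul, h2 j hj, smul_zero]
  · simp

/-- The difference of the pure derivatives along the idempotents, with vanishing diagonal. -/
def pureDiff (F F' : VecSeq (N + 1)) (e : ι → Fin (N + 1) → ℂ)
    (χ : ι → (Fin (N + 1) → ℂ) →ₗ[ℂ] ℂ) (n : ℕ) (k i : ι) : ℂ :=
  if k = i then 0 else
    (-1) ^ n * χ k (vder (List.replicate (n + 2) (e i)) fun α => F' 0 α - F 0 α)

theorem char_idemMat {m : (Fin (N + 1) → ℂ) → (Fin (N + 1) → ℂ) → Fin (N + 1) → ℂ}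
    (hB : IsIdempotentBasis m A e χ) (d : ι → ι → ℂ) (k : ι) (v : Fin (N + 1) → ℂ) :
    χ k ((idemMat e χ d).mulVec v) = ∑ i, d k i * χ i v := by
  rw [idemMat_mulVec, map_sum]
  refine Finset.sum_congr rfl fun i _ => ?_
  rw [map_sum, Finset.sum_eq_single k]
  · rw [map_smul, hB.char_idem, if_pos rfl, smul_eq_mul, mul_one]
  · intro j _ hj
    rw [map_smul, hB.char_idem, if_neg hj.symm, smul_zero]
  · simp

theorem char_idemMat_pureDiff {m : (Fin (N + 1) → ℂ) → (Fin (N + 1) → ℂ) → Fin (N + 1) → ℂ}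
    (hB : IsIdempotentBasis m A e χ) {n : ℕ} {i k : ι} (hik : i ≠ k) :
    χ k ((idemMat e χ (pureDiff F F' e χ n)).mulVec (e i)) =
      (-1) ^ n * χ k (vder (List.replicate (n + 2) (e i)) fun α => F' 0 α - F 0 α) := by
  rw [char_idemMat hB, Finset.sum_eq_single i]
  · rw [hB.char_idem, if_pos rfl, pureDiff, if_neg hik.symm, mul_one]
  · intro j _ hj
    rw [hB.char_idem, if_neg hj, mul_zero]
  · simp

/-- The last coordinate direction `ε` spans an ideal, because closed potentials do not depend on it.
If `χ i ε ≠ 0`, then `e i` is a multiple of `ε`. Derivatives of closed components along `e i` then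
vanish, so the pure derivative of the difference is again a multiple of `ε`, and `χ k` kills it for
`k ≠ i`. -/
theorem idemMat_last (hF : IsOpenClosed η F) (hF' : IsOpenClosed η F')
    (hB : IsIdempotentBasis (tmul F) A e χ) (n : ℕ) (α : Fin (N + 1)) :
    idemMat e χ (pureDiff F F' e χ n) α (Fin.last N) = 0 := by
  refine Finset.sum_eq_zero fun i _ => Finset.sum_eq_zero fun k _ => ?_
  set ε : Fin (N + 1) → ℂ := Pi.single (Fin.last N) 1 with hε
  by_cases hi : χ i ε = 0
  · rw [hi, mul_zero]
  have hlast : ∀ v : Fin (N + 1) → ℂ, (∀ α : Fin N, v α.castSucc = 0) → v = v (Fin.last N) • ε :=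
    fun v hv => by
      funext α
      cases α using Fin.lastCases with
      | last => simp [hε]
      | cast α => simp [hε, hv, (Fin.castSucc_lt_last α).ne]
  have h1 : ∀ α : Fin N, e i α.castSucc = 0 := fun α => by
    have h2 := congrFun (hB.idem_mul i ε) α.castSucc
    rw [tmul, hε, sd_single, pd, hF.indep, map_zero, map_zero, eq_comm, Pi.smul_apply, smul_eq_mul,
      mul_eq_zero] at h2
    exact h2.resolve_left hi
  have h2 : ∀ {F : VecSeq (N + 1)}, IsOpenClosed η F → ∀ α : Fin N,
      sd (e i) (F 0 α.castSucc) = 0 := fun h α => by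
    rw [h.sd_eq]
    exact Finset.sum_eq_zero fun β _ => by rw [h1, zero_smul]
  by_cases hki : k = i
  · rw [pureDiff, if_pos hki, zero_mul, zero_mul]
  rw [pureDiff, if_neg hki]
  have h3 := hlast (vder (List.replicate (n + 2) (e i)) fun α => F' 0 α - F 0 α) fun α => by
    rw [vder, List.replicate_succ, sds_cons, map_sub, h2 hF', h2 hF, sub_zero, map_zero, map_zero]
  have h4 : χ k ε = 0 := by
    have h5 := congrArg (χ k) (hlast (e i) h1)
    have h6 := congrArg (χ i) (hlast (e i) h1)
    rw [map_smul, hB.char_idem, if_neg hki, smul_eq_mul, eq_comm, mul_eq_zero] at h5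
    rw [map_smul, hB.char_idem, if_pos rfl, smul_eq_mul] at h6
    refine h5.resolve_left fun h0 => ?_
    rw [h0, zero_mul] at h6
    exact one_ne_zero h6
  rw [h3, map_smul, h4, smul_zero, mul_zero, zero_mul, zero_mul]

/-- Closedness of both sequences makes derivatives of their difference symmetric for the form.
Applied to `e k` and the pure derivative along `e i`, this relates two opposite matrix entries once
`char_vder_replicate` has converted the mixed derivative; the result is the symplectic condition in
the idempotent basis. -/
theorem idemMat_symp (hF : IsOpenClosed η F) (hF' : IsOpenClosed η F') (hD : IsDescendant A F)
    (hD' : IsDescendant A F') {n : ℕ} (hn : 1 ≤ n)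
    (hX : ∀ α, Sm Set.univ (n + 2) (F' 0 α - F 0 α)) (hB : IsIdempotentBasis (tmul F) A e χ)
    (α μ : Fin N) :
    ∑ κ : Fin N, idemMat e χ (pureDiff F F' e χ n) κ.castSucc α.castSucc * η κ μ + (-1) ^ n *
      ∑ κ : Fin N, η α κ * idemMat e χ (pureDiff F F' e χ n) κ.castSucc μ.castSucc = 0 := by
  set d := pureDiff F F' e χ n with hd
  have hW : ∀ u v l, bform η u (vder (v :: l) fun α => F' 0 α - F 0 α) =
      bform η v (vder (u :: l) fun α => F' 0 α - F 0 α) := fun u v l => by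
    rw [vder_sub, vder_sub, map_sub, map_sub, hF.bform_vder, hF'.bform_vder]
  have hdd : ∀ i k, d k i * bform η (e k) (e k) + (-1) ^ n * (d i k * bform η (e i) (e i)) = 0 :=
    fun i k => by
      by_cases hik : i = k
      · simp [hd, pureDiff, hik]
      have h1 := hW (e k) (e i) (List.replicate (n + 1) (e i))
      rw [hF.bform_idem hB k, ← List.replicate_succ, hF.bform_idem hB i, char_vder_replicate hD hD' hn hX hB (Ne.symm hik)] at h1
      rw [hd, pureDiff, pureDiff, if_neg hik, if_neg (Ne.symm hik)]
      linear_combination (-1) ^ n * h1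
  have hb : ∀ v w, bform η v w = ∑ k, χ k v * (χ k w * bform η (e k) (e k)) := fun v w => by
    conv_lhs => rw [hB.sum v, map_sum, LinearMap.sum_apply]
    refine Finset.sum_congr rfl fun k _ => ?_
    rw [map_smul, LinearMap.smul_apply, hF.bform_idem hB, smul_eq_mul]
  have key : ∀ v w, bform η ((idemMat e χ d).mulVec v) w +
      (-1) ^ n * bform η v ((idemMat e χ d).mulVec w) = 0 := fun v w => by
    rw [hb, hb]
    simp only [char_idemMat hB, Finset.sum_mul, Finset.mul_sum]
    conv_lhs => arg 2; rw [Finset.sum_comm]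
    rw [← Finset.sum_add_distrib]
    refine Finset.sum_eq_zero fun k _ => ?_
    rw [← Finset.sum_add_distrib]
    refine Finset.sum_eq_zero fun i _ => ?_
    linear_combination χ i v * χ k w * hdd i k
  have := key (Pi.single α.castSucc 1) (Pi.single μ.castSucc 1)
  have hs : ∀ α μ : Fin N, (Pi.single α.castSucc 1 : Fin (N + 1) → ℂ) μ.castSucc =
      if μ = α then 1 else 0 := fun α μ => by
    simp [Pi.single_apply]
  rw [bform_apply, bform_apply] at this
  simp only [hs, Matrix.mulVec_single_one, Matrix.col_apply, mul_ite, mul_one, mul_zero, ite_mul,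
    zero_mul, Finset.sum_ite_eq', Finset.mem_univ, if_true] at this
  rw [← this]
  congr 1
  · exact Finset.sum_congr rfl fun κ _ => mul_comm _ _
  · congr 1
    symm
    rw [Finset.sum_eq_single α]
    · simp
    · intro κ _ hκ
      simp [hκ]
    · simp

/-- The matrix has the differences of pure derivatives as entries, with the sign that cancels the
one in `char_leading`. After the correction all these differences are zero, so `sm_of_pure` and
`lev_of_sm` raise the level of agreement. -/
theorem exists_step (hF : IsOpenClosed η F) (hF' : IsOpenClosed η F') (hA : IsAncestor A F)
    (hA' : IsAncestor A F') {n : ℕ} (hn : 1 ≤ n) (hL : Lev (2 + n) (Jof A F' - Jof A F))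
    (hB : IsIdempotentBasis (tmul F) A e χ) : ∃ s : Matrix (Fin (N + 1)) (Fin (N + 1)) ℂ,
      (∀ α, s α (Fin.last N) = 0) ∧
      (∀ α μ, ∑ κ : Fin N, s κ.castSucc α.castSucc * η κ μ + (-1) ^ n *
        ∑ κ : Fin N, η α κ * s κ.castSucc μ.castSucc = 0) ∧
      ∀ (ρ : Loop (N + 1)) (F'' : VecSeq (N + 1)), Ord n ρ → ρ.coeff n = s →
        ActsTo A ρ.exp F F'' → Lev (3 + n) (Jof A F' - Jof A F'') := by
  have hX : ∀ {F F' : VecSeq (N + 1)}, Lev (2 + n) (Jof A F' - Jof A F) →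
      ∀ α, Sm Set.univ (n + 2) (F' 0 α - F 0 α) := fun h α =>
    Lvl.sm (n := 0 + (2 + n)) (h (0 : ℕ) α) (by push_cast; omega)
  refine ⟨idemMat e χ (pureDiff F F' e χ n), idemMat_last hF hF' hB n,
    idemMat_symp hF hF' hA.descendant hA'.descendant hn (hX hL) hB, fun ρ F'' hρ hs hact => ?_⟩
  have hA'' := hact.ancestor_right
  have h1 := hact.lev_sub hn hρ
  have h2 : Lev (2 + n) (Jof A F'' - Jof A F) :=
    (h1.mono (k := 2 + n) (by omega)).of_sub (hA.lev.nrm_loop_of n n hρ)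
  have h3 : Lev (2 + n) (Jof A F' - Jof A F'') := by
    have := hL.sub h2
    rwa [sub_sub_sub_cancel_right] at this
  have h4 : tmul F'' = tmul F := funext fun u => funext fun v =>
    tmul_eq_of_sm (fun α => (hX h2 α).mono (by omega)) u v
  refine hA''.lev_of_sm hA' h3 (sm_of_pure hA''.descendant hA'.descendant hn (hX h3)
    (by rw [h4]; exact hB) fun i k hik => ?_)
  have h5 : vder (List.replicate (n + 2) (e i)) (fun α => F'' 0 α - F 0 α) =
      vder (List.replicate (n + 2) (e i)) fun α =>
        nrm (Jof A F) (loop n ρ.coeff (Jof A F)) (0 : ℕ) α := by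
    rw [← sub_eq_zero, ← vder_sub]
    funext α
    exact Lvl.sm (V := Set.univ) (n := 0 + (3 + n)) (k := n + 3) (h1 (0 : ℕ) α)
      (by push_cast; omega) _ (by simp) (by simp)
  have h6 : (vder (List.replicate (n + 2) (e i)) fun α => F' 0 α - F'' 0 α) =
      vder (List.replicate (n + 2) (e i)) (fun α => F' 0 α - F 0 α) -
        vder (List.replicate (n + 2) (e i)) (fun α => F'' 0 α - F 0 α) := by
    rw [← vder_sub]
    simp only [sub_sub_sub_cancel_right]
  rw [h6, map_sub, h5, char_leading hA hB (r := ρ.coeff) hρ hik, hs, char_idemMat_pureDiff hB hik, ← mul_assoc,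
    ← mul_pow, neg_one_mul, neg_neg, one_pow, one_mul, sub_self]

end Step

section Transitivity

variable {L : ℕ}

/-! ### Comparison of two group elements -/

theorem exp_zero : (0 : Loop L).exp = 1 := by
  refine lc_ext fun n => ?_
  rw [exp_eq_expL, expL, lc_mkL, Finset.sum_range_succ']
  simp [lc_zero]

theorem ord_zero_loop (n : ℕ) : Ord n (0 : Loop L) := fun i _ => lc_zero i

theorem lc_mul_of_ord {M M' : Loop L} {n : ℕ} (h : Ord n M) : lc (M * M') n = lc M n * lc M' 0 := by
  rw [lc_mul, Finset.sum_eq_single (n, 0)]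
  · intro p hp hne
    have hp := Finset.HasAntidiagonal.mem_antidiagonal.1 hp
    rw [h p.1 ?_, zero_mul]
    by_contra hlt
    exact hne (Prod.ext (by simp only; omega) (by simp only; omega))
  · intro h
    exact absurd (Finset.HasAntidiagonal.mem_antidiagonal.2 (add_zero n)) h

theorem ord_of_exp {ρ : Loop L} (h1 : Ord 1 ρ) {n : ℕ} (h : Ord n (ρ.exp - 1)) :
    Ord n ρ ∧ lc ρ n = lc (ρ.exp - 1) n := by
  have key : ∀ m, Ord m ρ → lc ρ m = lc (ρ.exp - 1) m := fun m hm => by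
    have := exp_congr h1 (ord_zero_loop 1) (n := m) (by rwa [sub_zero]) m (Nat.lt_succ_self m)
    rw [exp_zero, sub_zero, lc_sub, sub_eq_zero] at this
    exact this.symm
  have h2 : ∀ m ≤ n, Ord m ρ := fun m => by
    induction m with
    | zero => exact fun _ i hi => absurd hi (by omega)
    | succ m ih =>
      intro hm i hi
      rcases Nat.lt_succ_iff_lt_or_eq.1 hi with hi | rfl
      · exact ih (by omega) i hi
      · rw [key i (ih (by omega)), h i (by omega)]
  exact ⟨h2 n le_rfl, key n (h2 n le_rfl)⟩

/-- Take `ρ` to be the logarithm of `exp r' exp (-r)`; its leading term is that of `r' - r`. This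
turns a modification of the generator at order `n` into a subsequent action. -/
theorem ActsTo.quotient {A : Fin L → ℂ} {F F₁ F₂ : VecSeq L} {r r' : Loop L} (h : Ord 1 r)
    (h' : Ord 1 r') {n : ℕ} (hn : Ord n (r' - r)) (h₁ : ActsTo A r.exp F F₁)
    (h₂ : ActsTo A r'.exp F F₂) :
    ∃ ρ : Loop L, Ord n ρ ∧ ρ.coeff n = lc (r' - r) n ∧ ActsTo A ρ.exp F₁ F₂ := by
  have hneg : Ord 1 (-r) := fun i hi => by rw [lc_neg, h i hi, neg_zero]
  have hinv : r.exp * (-r).exp = 1 := exp_mul_exp_neg h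
  have hinv' : (-r).exp * r.exp = 1 := by
    have := exp_mul_exp_neg hneg
    rwa [neg_neg] at this
  have hneg0 : lc (-r).exp 0 = 1 := by
    rw [exp_eq_expL]
    exact lc_expL_zero _ _
  have hP0 : Loop.coeff (r'.exp * (-r).exp) 0 = 1 := by
    rw [Loop.coeff_zero_mul, h₂.coeff_zero, one_mul]
    exact hneg0
  obtain ⟨ρ, hρ, hexp⟩ := exists_log hP0
  have hc := exp_congr h' h hn
  have hE : Ord n (r'.exp - r.exp) := by
    have := (hc.mono (Nat.le_succ n)).add hn
    rwa [sub_add_cancel] at this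
  have hEn : lc (r'.exp - r.exp) n = lc (r' - r) n := by
    have := hc n (Nat.lt_succ_self n)
    rwa [lc_sub, sub_eq_zero] at this
  have hP : r'.exp * (-r).exp - 1 = (r'.exp - r.exp) * (-r).exp := by rw [sub_mul, hinv]
  have hPn : Ord n ((r'.exp - r.exp) * (-r).exp) :=
    hE.mul (b := 0) fun i hi => absurd hi (by omega)
  obtain ⟨h3, h4⟩ := ord_of_exp (ord_one_iff.2 hρ) (n := n) (by rwa [hexp, hP])
  refine ⟨ρ, h3, ?_, ?_⟩
  · rw [hexp, hP, lc_mul_of_ord hE, hneg0, mul_one, hEn] at h4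
    exact h4
  · obtain ⟨F₃, h5⟩ := ActsTo.exists h₁.ancestor_right hP0
    have h6 := h₁.mul h5
    rw [mul_assoc, hinv', mul_one] at h6
    rw [hexp, h₂.unique h6]
    exact h5

variable {N : ℕ} {A : Fin (N + 1) → ℂ} {η : Matrix (Fin N) (Fin N) ℂ} {F F' : VecSeq (N + 1)}

/-! ### Transitivity -/

/-- Equal structure constants are agreement of the second derivatives of `F 0` at the origin, the
starting point of the induction over orders. -/
theorem lev_three_of_structConst {A : Fin L → ℂ} {F F' : VecSeq L} (h : IsAncestor A F)
    (h' : IsAncestor A F') (hc : ∀ α β γ, constantCoeff (pd β 0 (pd γ 0 (F 0 α))) =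
      constantCoeff (pd β 0 (pd γ 0 (F' 0 α)))) : Lev 3 (Jof A F' - Jof A F) := by
  have := h.lev_of_sm h' (n := 0) (by simpa using h'.lev.sub h.lev) fun α l _ hl => ?_
  · simpa using this
  by_cases hl2 : l.length < 2
  · exact Lvl.sm (V := Set.univ) (n := (0 : ℕ) + 2) ((h'.lvl 0 α).sub (h.lvl 0 α)) (by simp) l
      (by simp) hl2
  · obtain ⟨u, v, rfl⟩ := List.length_eq_two.1 (show l.length = 2 by omega)
    have h1 : tmul F v u = tmul F' v u := by
      rw [tmul_eq_algMul, tmul_eq_algMul]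
      simp only [hc]
    rw [map_sub, map_sub, sub_eq_zero]
    exact (congrFun h1 α).symm

theorem tmul_eq_of_lev {A : Fin L → ℂ} {F F' : VecSeq L} (h : Lev 3 (Jof A F' - Jof A F)) :
    tmul F' = tmul F :=
  funext fun u => funext fun v => tmul_eq_of_sm
    (fun α => Lvl.sm (n := (0 : ℕ) + 3) (h (0 : ℕ) α) (by simp)) u v

/-! ### Transitivity by successive corrections -/

theorem exists_openLie (hη : η.IsSymm) (hη' : IsUnit η.det) (hF : IsOpenClosed η F)
    (hF' : IsOpenClosed η F') (hA : IsAncestor A F) (hA' : IsAncestor A F')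
    (hs : IsSemisimple fun α β γ => constantCoeff (pd β 0 (pd γ 0 (F 0 α))))
    (hc : ∀ α β γ, constantCoeff (pd β 0 (pd γ 0 (F 0 α))) =
      constantCoeff (pd β 0 (pd γ 0 (F' 0 α)))) :
    ∃ r : Loop (N + 1), IsOpenLie η r ∧ ActsTo A r.exp F F' := by
  classical
  obtain ⟨ι, _, _, e, χ, hB⟩ := hA.descendant.exists_idempotents hs
  -- A correction must depend only on the current truncation `f`. It is therefore characterized by
  -- its effect on whatever sequence `exp f` produces from `F`.
  let Good : ℕ → Loop (N + 1) → Matrix (Fin (N + 1)) (Fin (N + 1)) ℂ → Prop := fun n f s =>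
    (∀ α, s α (Fin.last N) = 0) ∧
    (∀ α μ, ∑ κ : Fin N, s κ.castSucc α.castSucc * η κ μ + (-1) ^ (n + 1) *
      ∑ κ : Fin N, η α κ * s κ.castSucc μ.castSucc = 0) ∧
    ∀ (F₁ F₂ : VecSeq (N + 1)) (ρ : Loop (N + 1)), ActsTo A f.exp F F₁ → Ord (n + 1) ρ →
      ρ.coeff (n + 1) = s → ActsTo A ρ.exp F₁ F₂ →
      Lev (3 + ((n + 1 : ℕ) : ℤ)) (Jof A F' - Jof A F₂)
  -- The default value 0 is never used along the construction, since `hgood` supplies a correction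
  -- at each stage.
  let step : ℕ → Loop (N + 1) → Matrix (Fin (N + 1)) (Fin (N + 1)) ℂ := fun n f =>
    if h : ∃ s, Good n f s then h.choose else 0
  have hsucc : ∀ n, approxL step (n + 1) - approxL step n =
      mkL fun i => if i = n + 1 then step n (approxL step n) else 0 := fun n => by
    rw [approxL, add_sub_cancel_left]
  have key : ∀ n, IsOpenLie η (approxL step n) ∧ ∀ F₁, ActsTo A (approxL step n).exp F F₁ →
      Lev (3 + n) (Jof A F' - Jof A F₁) := by
    intro n
    induction n with
    | zero =>
      refine ⟨⟨ord_zero_loop 1, fun i α => ?_, fun i α μ => ?_⟩, fun F₁ h => ?_⟩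
      · exact congrFun (congrFun (lc_zero i) α) _
      · have : Loop.coeff (approxL step 0) i = 0 := lc_zero i
        simp [this]
      · rw [approxL, exp_zero] at h
        rw [← (ActsTo.one hA).unique h]
        simpa using lev_three_of_structConst hA hA' hc
    | succ n ih =>
      obtain ⟨hlie, hlev⟩ := ih
      obtain ⟨F₁, h₁⟩ := ActsTo.exists hA (hlie.openLoop).coeff_zero
      have hgood : ∃ s, Good n (approxL step n) s := by
        obtain ⟨s, hs1, hs2, hs3⟩ := exists_step (n := n + 1)
          (h₁.isOpenClosed hη hη' hlie.openLoop hF) hF' h₁.ancestor_right hA' (by omega)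
          ((hlev F₁ h₁).mono (by push_cast; omega))
          (by rw [tmul_eq_of_lev h₁.lev_sub_three]; exact hB)
        refine ⟨s, hs1, hs2, fun F₁' F₂ ρ h2 h3 h4 h5 => ?_⟩
        rw [← h₁.unique h2] at h5
        exact hs3 ρ F₂ h3 h4 h5
      have hstep : Good n (approxL step n) (step n (approxL step n)) := by
        simp only [step, dif_pos hgood]
        exact hgood.choose_spec
      have hci : ∀ i, (approxL step (n + 1)).coeff i = (approxL step n).coeff i +
          if i = n + 1 then step n (approxL step n) else 0 := fun i => by
        change lc (approxL step (n + 1)) i = lc (approxL step n) i + _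
        rw [approxL, lc_add, lc_mkL]
      have hlt : (approxL step n).coeff (n + 1) = 0 := lc_approxL_of_lt step (Nat.lt_succ_self n)
      have hlie' : IsOpenLie η (approxL step (n + 1)) := by
        refine ⟨ord_one_iff.2 ?_, fun i α => ?_, fun i α μ => ?_⟩
        · have := hci 0
          rw [if_neg (by omega), add_zero] at this
          exact this.trans (ord_one_iff.1 hlie.ord)
        · rw [hci]
          split_ifs
          · rw [Matrix.add_apply, hlie.last_col, hstep.1, add_zero]
          · rw [add_zero, hlie.last_col]
        · rw [hci]
          by_cases hi : i = n + 1
          · subst hi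
            rw [if_pos rfl, hlt, zero_add]
            exact hstep.2.1 α μ
          · rw [if_neg hi, add_zero]
            exact hlie.symp i α μ
      refine ⟨hlie', fun F₂ h₂ => ?_⟩
      obtain ⟨ρ, h3, h4, h5⟩ := h₁.quotient hlie.ord hlie'.ord (n := n + 1) (by
        rw [hsucc]
        exact fun i hi => by rw [lc_mkL, if_neg (by omega)]) h₂
      rw [hsucc, lc_mkL, if_pos rfl] at h4
      exact hstep.2.2 F₁ F₂ ρ h₁ h3 h4 h5
  have hlie : IsOpenLie η (limL step) := by
    have hl : ∀ i, (limL step).coeff i = (approxL step i).coeff i := fun i =>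
      (lc_approxL_of_le step le_rfl).symm
    exact ⟨ord_one_iff.2 (lc_limL_zero step), fun i α => by rw [hl]; exact (key i).1.last_col i α,
      fun i α μ => by rw [hl]; exact (key i).1.symp i α μ⟩
  obtain ⟨F₂, h₂⟩ := ActsTo.exists hA hlie.openLoop.coeff_zero
  refine ⟨limL step, hlie, ?_⟩
  -- The limit differs from the truncation at `n` only from order `n + 1` on, so both act alike
  -- below level `3 + n`, where the truncation already reaches `F'`.
  have hlev : ∀ n : ℕ, Lev (3 + n) (Jof A F' - Jof A F₂) := fun n => by
    obtain ⟨hl, hlev⟩ := key n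
    obtain ⟨F₁, h₁⟩ := ActsTo.exists hA hl.openLoop.coeff_zero
    obtain ⟨ρ, h3, -, h5⟩ := h₁.quotient hl.ord hlie.ord (ord_limL_sub step n) h₂
    have h6 := h5.lev_sub (by omega) h3
    have h7 := (h6.mono (k := 2 + ((n + 1 : ℕ) : ℤ)) (by omega)).of_sub
      (h₁.ancestor_right.lev.nrm_loop_of (n + 1) (n + 1) h3)
    have h8 := (hlev F₁ h₁).sub (h7.mono (k := 3 + n) (by push_cast; omega))
    rwa [sub_sub_sub_cancel_right] at h8
  have := Jof_injective (sub_eq_zero.1 (Lev.eq_zero hlev))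
  rw [this]
  exact h₂

end Transitivity

section Pairs

variable {N : ℕ} {η : Matrix (Fin N) (Fin N) ℂ} {A : Fin (N + 1) → ℂ}
  {c : Fin (N + 1) → Fin (N + 1) → Fin (N + 1) → ℂ}

/-! ### The action on pairs of ancestor potentials -/

theorem PairActsTo.unique (hη : IsUnit η.det) {R : Loop (N + 1)} {P Q Q' : Ser N × Ser (N + 1)}
    (h : PairActsTo η A R P Q) (h' : PairActsTo η A R P Q') : Q = Q' := by
  obtain ⟨F, F₁, h1, h2, h3⟩ := h
  obtain ⟨F', F₁', h1', h2', h3'⟩ := h'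
  obtain rfl := h1.unique hη h1'
  obtain rfl := h3.unique h3'
  obtain ⟨-, -, h4, h5⟩ := hasPotentials_iff.1 h2
  obtain ⟨-, -, h4', h5'⟩ := hasPotentials_iff.1 h2'
  exact Prod.ext (h4.trans h4'.symm) (h5.trans h5'.symm)

theorem PairActsTo.mul (hη : IsUnit η.det) {R S : Loop (N + 1)} {P Q Q' : Ser N × Ser (N + 1)}
    (hS : PairActsTo η A S P Q) (hR : PairActsTo η A R Q Q') : PairActsTo η A (R * S) P Q' := by
  obtain ⟨F, F₁, h1, h2, h3⟩ := hS
  obtain ⟨F', F₂, h1', h2', h3'⟩ := hR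
  obtain rfl := h2.unique hη h1'
  exact ⟨F, F₂, h1, h2', h3.mul h3'⟩

theorem PairActsTo.exists (hη : η.IsSymm) (hη' : IsUnit η.det) {R : Loop (N + 1)}
    (hR : IsOpenLoop η R) (P : AncestorPairs η A c) :
    ∃ Q : AncestorPairs η A c, PairActsTo η A R P.1 Q.1 := by
  obtain ⟨P, ⟨F, hF⟩, hc⟩ := P
  obtain ⟨hA, hoc, h1, h2⟩ := hasPotentials_iff.1 hF
  obtain ⟨F', h⟩ := ActsTo.exists hA hR.coeff_zero
  have hF' : HasPotentials η A F' (closedPotential η (proj A) (closedSector F'))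
      (F' 0 (Fin.last N)) :=
    hasPotentials_iff.2 ⟨h.ancestor_right, h.isOpenClosed hη hη' hR hoc, rfl, rfl⟩
  refine ⟨⟨(_, _), ⟨F', hF'⟩, ?_⟩, F, F', hF, hF', h⟩
  rw [← hc]
  funext α β γ
  refine (hF'.structConst_eq hη' α β γ).trans ((hF.structConst_eq hη' α β γ).trans ?_).symm
  exact (h.lev_sub_three.constantCoeff_pd_pd α β γ).symm

theorem PairActsTo.exists_loop (hη : η.IsSymm) (hη' : IsUnit η.det) (hc : IsSemisimple c)
    (P Q : AncestorPairs η A c) : ∃ R : openLoopGroup η, PairActsTo η A R.1 P.1 Q.1 := by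
  obtain ⟨P, ⟨F, hF⟩, hP⟩ := P
  obtain ⟨Q, ⟨F', hF'⟩, hQ⟩ := Q
  obtain ⟨hA, hoc, -, -⟩ := hasPotentials_iff.1 hF
  obtain ⟨hA', hoc', -, -⟩ := hasPotentials_iff.1 hF'
  have e : ∀ α β γ, constantCoeff (pd β 0 (pd γ 0 (F 0 α))) = c α β γ := fun α β γ => by
    rw [← hF.structConst_eq hη', hP]
  have e' : ∀ α β γ, constantCoeff (pd β 0 (pd γ 0 (F' 0 α))) = c α β γ := fun α β γ => by
    rw [← hF'.structConst_eq hη', hQ]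
  obtain ⟨r, hr, h⟩ := exists_openLie hη hη' hoc hoc' hA hA' (by simpa only [e] using hc)
    fun α β γ => (e α β γ).trans (e' α β γ).symm
  obtain ⟨u, hu⟩ := isUnit_of_lc_zero (show lc r.exp 0 = 1 from h.coeff_zero)
  refine ⟨⟨u, ?_⟩, F, F', hF, hF', ?_⟩
  · change IsOpenLoop η (u : Loop (N + 1))
    rw [hu]
    exact hr.openLoop
  · change ActsTo A (u : Loop (N + 1)) F F'
    rwa [hu]

end Pairs

end OpenGivental

end

theorem mainTheorem3 (N : ℕ) (hN : 1 ≤ N)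
    (η : Matrix (Fin N) (Fin N) ℂ) (hη_symm : η.IsSymm) (hη_nondeg : IsUnit η.det)
    (A : Fin (N + 1) → ℂ) (hA : A ≠ 0)
    (c : Fin (N + 1) → Fin (N + 1) → Fin (N + 1) → ℂ) (hc : OpenGivental.IsSemisimple c) :
    ∃ _ : MulAction (OpenGivental.openLoopGroup η) (OpenGivental.AncestorPairs η A c),
      (∀ (R : OpenGivental.openLoopGroup η) (P Q : OpenGivental.AncestorPairs η A c),
        R • P = Q ↔ OpenGivental.PairActsTo η A (R.1 : OpenGivental.Loop (N + 1)) P.1 Q.1) ∧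
      MulAction.IsPretransitive (OpenGivental.openLoopGroup η)
        (OpenGivental.AncestorPairs η A c) := by
  have hex := fun (R : OpenGivental.openLoopGroup η) (P : OpenGivental.AncestorPairs η A c) =>
    OpenGivental.PairActsTo.exists hη_symm hη_nondeg R.2 P
  choose act hact using hex
  have huniq : ∀ (R : OpenGivental.openLoopGroup η) (P Q : OpenGivental.AncestorPairs η A c),
      OpenGivental.PairActsTo η A (R.1 : OpenGivental.Loop (N + 1)) P.1 Q.1 → act R P = Q :=
    fun R P Q h => Subtype.ext ((hact R P).unique hη_nondeg h)
  let M : MulAction (OpenGivental.openLoopGroup η) (OpenGivental.AncestorPairs η A c) :=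
    { smul := act
      one_smul := fun P => by
        obtain ⟨F, hF⟩ := P.2.1
        exact huniq 1 P P ⟨F, F, hF, hF, OpenGivental.ActsTo.one hF.1⟩
      mul_smul := fun R S P =>
        huniq (R * S) P _ ((hact S P).mul hη_nondeg (hact R (act S P))) }
  refine ⟨M, fun R P Q => ⟨?_, huniq R P Q⟩, ⟨fun P Q => ?_⟩⟩
  · rintro rfl
    exact hact R P
  · obtain ⟨R, hR⟩ := OpenGivental.PairActsTo.exists_loop hη_symm hη_nondeg hc P Q
    exact ⟨R, huniq R P Q hR⟩
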